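/- **Conventions.** Digraphs are finite. For a digraph $H$, $|H|$ is its number of vertices. An *oriented tree* (respectively *oriented forest*) is a digraph without loops, with at most one edge between any two vertices, whose underlying graph is a tree (respectively has no cycle); its *leaves* are the vertices of degree $1$ in the underlying graph. A *tournament* is a loopless digraph with exactly one of the edges $uv$, $vu$ for all distinct vertices $u,v$. A *directed path* $v_0\to v_1\to\dots\to v_\ell$ (with $\ell\ge 0$ and distinct $v_i$) has length $\ell$, first vertex $v_0$ and last vertex $v_\ell$. A sequence $P_1\dots P_s$ of directed paths is a *path partition* of a directed path $P$ if $P=\bigcup_i P_i$, the last vertex of $P_i$ is the first vertex of $P_{i+1}$ for each $i<s$, and the paths are otherwise pairwise vertex-disjoint (whenever $i<j$, a vertex on both $P_i$ and $P_j$ is the last vertex of $P_i$ and the first vertex of $P_j$). An *out-arborescence* (respectively *in-arborescence*) with root $t$ is an oriented tree containing $t$ in which, for every vertex $v$, the path between $t$ and $v$ is directed from $t$ to $v$ (respectively from $v$ to $t$). An *in-leaf* is a vertex with in-degree $0$ and out-degree $1$, an *out-leaf* one with out-degree $0$ and in-degree $1$. For $\diamond\in\{+,-\}$, $+$-neighbours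 are out-neighbours and $-$-neighbours are in-neighbours. $[s]=\{1,\dots,s\}$. **Definition.** Let $r\ge 1$ be an integer and $m$ a real number. A digraph $D$ is an *$(r,m)$-good decomposition* of an oriented tree $T$ if $V(D)=V(T)$ and there are distinct $x,y\in V(D)$; a directed path $P$ from $x$ to $y$ with a path partition $P=P_1S_2P_2S_3\dots P_{r-1}S_rP_r$ into directed paths; an in-arborescence $S_1$ with root $x$; an out-arborescence $S_{r+1}$ with root $y$; oriented forests $F_i^+,F_i^-$ for $i\in[r+1]$; and, for some $0\le \ell\le 2r$, vertices $s_j,t_j$ and directed paths $Q_j$ from $s_j$ to $t_j$ for $j\in[\ell]$, such that, writing $F_i=F_i^-\cup F_i^+$: 1. $T\subseteq S_1\cup P\cup S_{r+1}\cup\bigcup_{i\in[r+1]}F_i\cup\bigcup_{j\in[\ell]}Q_j=D$. 2. The following sets (some possibly empty), over $i\in[r+1]$ and $j\in[\ell]$, are pairwise disjoint with union $V(T)$: $V(P)$, $V(F_i^+)\setminus V(S_i)$, $V(F_i^-)\setminus V(S_i)$, $V(S_1)\setminus\{x\}$, $V(S_{r+1})\setminus\{y\}$, $V(Q_j)\setminus\{s_j,t_j\}$.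 3. Each $P_i$, $i\in[r]$, has length at least $2000m$. 4. For each $i\in[r+1]$ and $\diamond\in\{+,-\}$: $V(S_i)\subseteq V(F_i^\diamond)$, $|F_i^\diamond|\le m$, and each component of $F_i^\diamond$ has exactly one vertex in $V(S_i)$, which furthermore has only $\diamond$-neighbours in $F_i^\diamond$. 5. $F_1^-$ and $F_{r+1}^+$ have no edges, and $|S_1|,|S_{r+1}|\ge 2$. 6. The number of in-leaves of $S_1$ plus the number of out-leaves of $S_{r+1}$ is at most the number of leaves of $T$. 7. For each $a\in[\ell]$, either (i) for some $1\le j<j'\le r+1$, $s_a\in V(F_j)$, $t_a\in V(F_{j'})$ and $Q_a$ has length $3(j'-j)+1$; or (ii) for some $2\le j\le r$, $s_a\in V(F_j^-)\setminus V(S_j)$, $t_a$ is the last vertex of $S_j$, and $Q_a$ has length $3$. **Lemma 4.4.** For every real $\mu>0$ and all integers $r,k\ge 1$ there is an $n_0$ such that the following holds for every $n\ge n_0$ and every real $m\ge\mu n$. Every tournament with $n+k-2$ vertices contains a copy of every $n$-vertex oriented tree with exactly $k$ leaves that has an $(r,m)$-good decomposition. -/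

import Mathlib

namespace TreesInTournaments

/-- An oriented graph: a digraph with at most one edge between any two vertices (and no loops). -/
def IsOriented {V : Type*} (D : Digraph V) : Prop :=
  ∀ u v, D.Adj u v → ¬ D.Adj v u

/-- A tournament: no loops, and exactly one of `uv`, `vu` is an edge whenever `u ≠ v`. -/
def IsTournament {V : Type*} (G : Digraph V) : Prop :=
  (∀ v, ¬ G.Adj v v) ∧ ∀ u v, u ≠ v → Xor (G.Adj u v) (G.Adj v u)

/-- An oriented tree: an oriented graph whose underlying graph is a tree. -/
def IsOrientedTree {V : Type*} (T : Digraph V) : Prop :=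
  IsOriented T ∧ T.toSimpleGraphInclusive.IsTree

/-- An oriented forest: an oriented graph whose underlying graph has no cycle. -/
def IsOrientedForest {V : Type*} (T : Digraph V) : Prop :=
  IsOriented T ∧ T.toSimpleGraphInclusive.IsAcyclic

/-- The leaves: the vertices of degree one in the underlying graph. -/
def leaves {V : Type*} (T : Digraph V) : Set V :=
  {v | (T.toSimpleGraphInclusive.neighborSet v).ncard = 1}

/-- `G` contains a copy of `T`. -/
def ContainsCopy {V W : Type*} (G : Digraph W) (T : Digraph V) : Prop :=
  ∃ f : V ↪ W, ∀ u v, T.Adj u v → G.Adj (f u) (f v)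

/-- The symbol `◇ ∈ {+, -}`; `+` stands for "out" and `-` for "in". -/
inductive Sign : Type
  | plus : Sign
  | minus : Sign

/-- A digraph whose vertex set is a subset of `V`. -/
@[ext]
structure SubDigraph (V : Type*) where
  verts : Set V
  Adj : V → V → Prop
  left_mem : ∀ {u v}, Adj u v → u ∈ verts
  right_mem : ∀ {u v}, Adj u v → v ∈ verts

namespace SubDigraph

variable {V : Type*}

/-- The digraph on the vertex set of `H`. -/
def coe (H : SubDigraph V) : Digraph H.verts := ⟨fun u v => H.Adj u v⟩

/-- A digraph with vertex set all of `V`. -/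
def ofDigraph (D : Digraph V) : SubDigraph V where
  verts := Set.univ
  Adj := D.Adj
  left_mem _ := trivial
  right_mem _ := trivial

/-- The union of a family of digraphs: take the union of vertex sets and of edge sets. -/
def iUnion {ι : Sort*} (H : ι → SubDigraph V) : SubDigraph V where
  verts := ⋃ i, (H i).verts
  Adj u v := ∃ i, (H i).Adj u v
  left_mem := fun ⟨i, h⟩ => Set.mem_iUnion.2 ⟨i, (H i).left_mem h⟩
  right_mem := fun ⟨i, h⟩ => Set.mem_iUnion.2 ⟨i, (H i).right_mem h⟩

/-- The union of two digraphs. -/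
def union (H K : SubDigraph V) : SubDigraph V where
  verts := H.verts ∪ K.verts
  Adj u v := H.Adj u v ∨ K.Adj u v
  left_mem := fun h => h.imp H.left_mem K.left_mem
  right_mem := fun h => h.imp H.right_mem K.right_mem

instance : Union (SubDigraph V) := ⟨union⟩

/-- `H ⊆ K`: containment of vertex sets and of edge sets. -/
instance : HasSubset (SubDigraph V) :=
  ⟨fun H K => H.verts ⊆ K.verts ∧ ∀ u v, H.Adj u v → K.Adj u v⟩

/-- The number of vertices. -/
noncomputable def order (H : SubDigraph V) : ℕ := H.verts.ncard

/-- The out-neighbourhood of `v` for the sign `+`, the in-neighbourhood for the sign `-`. -/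
def nbrs (H : SubDigraph V) : Sign → V → Set V
  | .plus, v => {w | H.Adj v w}
  | .minus, v => {w | H.Adj w v}

/-- In `H`, the vertex `v` has only `◇`-neighbours. -/
def OnlyNbrs (H : SubDigraph V) : Sign → V → Prop
  | .plus, v => H.nbrs .minus v = ∅
  | .minus, v => H.nbrs .plus v = ∅

/-- The in-leaves: leaves whose only incident edge leaves them. -/
def inLeaves (H : SubDigraph V) : Set V :=
  {v ∈ H.verts | H.nbrs .minus v = ∅ ∧ (H.nbrs .plus v).ncard = 1}

/-- The out-leaves: leaves whose only incident edge enters them. -/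
def outLeaves (H : SubDigraph V) : Set V :=
  {v ∈ H.verts | H.nbrs .plus v = ∅ ∧ (H.nbrs .minus v).ncard = 1}

end SubDigraph

/-- A directed path `v₀ → v₁ → ⋯ → v_l`, given by its (non-empty, repetition-free) sequence of
vertices. -/
structure DiPath (V : Type*) where
  support : List V
  ne_nil : support ≠ []
  nodup : support.Nodup

namespace DiPath

variable {V : Type*}

def first (p : DiPath V) : V := p.support.head p.ne_nil

def last (p : DiPath V) : V := p.support.getLast p.ne_nil

/-- The number of edges. -/
def length (p : DiPath V) : ℕ := p.support.length - 1

/-- The path as a digraph: its edges are the pairs of consecutive vertices. -/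
def toSub (p : DiPath V) : SubDigraph V where
  verts := {v | v ∈ p.support}
  Adj u v := [u, v] <:+: p.support
  left_mem := fun h => h.subset (by simp)
  right_mem := fun h => h.subset (by simp)

end DiPath

/-- The sequence `L = P₁ … P_l` of directed paths is a path partition of `P`: `P` is their union,
each path ends where the next one starts, and apart from these common endvertices the paths are
pairwise vertex disjoint. -/
def IsPathPartition {V : Type*} (P : DiPath V) (L : List (DiPath V)) : Prop :=
  P.toSub = SubDigraph.iUnion (fun i : Fin L.length => (L.get i).toSub) ∧
  (∀ i j : Fin L.length, (j : ℕ) = i + 1 → (L.get i).last = (L.get j).first) ∧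
  (∀ i j : Fin L.length, i < j → ∀ v, v ∈ (L.get i).support → v ∈ (L.get j).support →
    v = (L.get i).last ∧ v = (L.get j).first)

/-- `A` is an out-arborescence with root `t`: an oriented tree in which, for every vertex `v`, the
path between `t` and `v` is directed from `t` to `v`. -/
def IsOutArborescence {V : Type*} (A : SubDigraph V) (t : V) : Prop :=
  IsOrientedTree A.coe ∧ t ∈ A.verts ∧
    ∀ v ∈ A.verts, ∃ p : DiPath V, p.first = t ∧ p.last = v ∧ p.toSub ⊆ A

/-- `A` is an in-arborescence with root `t`: an oriented tree in which, for every vertex `v`, the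
path between `t` and `v` is directed from `v` to `t`. -/
def IsInArborescence {V : Type*} (A : SubDigraph V) (t : V) : Prop :=
  IsOrientedTree A.coe ∧ t ∈ A.verts ∧
    ∀ v ∈ A.verts, ∃ p : DiPath V, p.first = v ∧ p.last = t ∧ p.toSub ⊆ A

/-- Indices of the sets in the vertex partition of a good decomposition. -/
inductive PartIndex (r l : ℕ) : Type
  | path : PartIndex r l
  | forest (d : Sign) (i : ℕ) (h : 1 ≤ i ∧ i ≤ r + 1) : PartIndex r l
  | inArb : PartIndex r l
  | outArb : PartIndex r l
  | link (j : Fin l) : PartIndex r l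

/-- `D` is an `(r, m)`-good decomposition for `T`, where `V(D) = V(T) = V`. The indices of `P_i`,
`S_i`, `F_i` are natural numbers; only the values `P_i` for `1 ≤ i ≤ r`, `S_i` for `2 ≤ i ≤ r` (the
directed paths, `segS`) and `F_i` for `1 ≤ i ≤ r + 1` play a role. -/
structure GoodDecomposition {V : Type*} (r : ℕ) (m : ℝ) (D T : Digraph V) where
  x : V
  y : V
  x_ne_y : x ≠ y
  /-- the directed `x,y`-path `P` -/
  P : DiPath V
  P_first : P.first = x
  P_last : P.last = y
  /-- the paths `P_i`, `1 ≤ i ≤ r` -/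
  segP : ℕ → DiPath V
  /-- the paths `S_i`, `2 ≤ i ≤ r` -/
  segS : ℕ → DiPath V
  /-- `P = P₁ S₂ P₂ S₃ … P_{r-1} S_r P_r` -/
  partition_P : IsPathPartition P
    (segP 1 :: (List.range' 2 (r - 1)).flatMap (fun i => [segS i, segP i]))
  /-- the in-arborescence `S₁` -/
  inArb : SubDigraph V
  isIn : IsInArborescence inArb x
  /-- the out-arborescence `S_{r+1}` -/
  outArb : SubDigraph V
  isOut : IsOutArborescence outArb y
  /-- the digraphs `S_i`, `1 ≤ i ≤ r + 1` -/
  S : ℕ → SubDigraph V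
  S_first : S 1 = inArb
  S_last : S (r + 1) = outArb
  S_mid : ∀ i, 2 ≤ i → i ≤ r → S i = (segS i).toSub
  /-- the forests `F_i^◇`, `1 ≤ i ≤ r + 1` -/
  F : Sign → ℕ → SubDigraph V
  l : ℕ
  l_le : l ≤ 2 * r
  /-- the paths `Q_i`, `i ∈ [l]`; the vertices `s_i`, `t_i` are its first and its last vertex -/
  Q : Fin l → DiPath V
  /-- `T ⊆ D` -/
  T_sub : SubDigraph.ofDigraph T ⊆ SubDigraph.ofDigraph D
  /-- `D = S₁ ∪ P ∪ S_{r+1} ∪ ⋃ F_i ∪ ⋃ Q_i` -/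
  D_eq : SubDigraph.ofDigraph D = inArb ∪ P.toSub ∪ outArb ∪
    SubDigraph.iUnion (fun i : Set.Icc 1 (r + 1) => F .minus i ∪ F .plus i) ∪
    SubDigraph.iUnion (fun j : Fin l => (Q j).toSub)
  /-- the sets which partition `V(T) = V(D)`, some of which may be empty -/
  part : PartIndex r l → Set V
  part_path : part .path = P.toSub.verts
  part_forest : ∀ d i h, part (.forest d i h) = (F d i).verts \ (S i).verts
  part_inArb : part .inArb = inArb.verts \ {x}
  part_outArb : part .outArb = outArb.verts \ {y}
  part_link : ∀ j, part (.link j) = (Q j).toSub.verts \ {(Q j).first, (Q j).last}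
  part_disjoint : Pairwise (fun a b => Disjoint (part a) (part b))
  part_cover : ⋃ a, part a = Set.univ
  length_segP : ∀ i, 1 ≤ i → i ≤ r → 2000 * m ≤ ((segP i).length : ℝ)
  S_sub_F : ∀ d i, 1 ≤ i → i ≤ r + 1 → (S i).verts ⊆ (F d i).verts
  order_F : ∀ d i, 1 ≤ i → i ≤ r + 1 → ((F d i).order : ℝ) ≤ m
  forest_F : ∀ d i, 1 ≤ i → i ≤ r + 1 → IsOrientedForest (F d i).coe
  /-- each component of `F_i^◇` has exactly one vertex in `S_i` -/
  component_F : ∀ d i, 1 ≤ i → i ≤ r + 1 →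
    ∀ c : (F d i).coe.toSimpleGraphInclusive.ConnectedComponent,
      ∃! v : (F d i).verts, v ∈ c.supp ∧ (v : V) ∈ (S i).verts
  /-- and this vertex has only `◇`-neighbours in `F_i^◇` -/
  nbrs_F : ∀ d i, 1 ≤ i → i ≤ r + 1 → ∀ v ∈ (S i).verts, (F d i).OnlyNbrs d v
  F_first : ∀ u v, ¬ (F .minus 1).Adj u v
  F_last : ∀ u v, ¬ (F .plus (r + 1)).Adj u v
  two_le_inArb : 2 ≤ inArb.order
  two_le_outArb : 2 ≤ outArb.order
  leaves_le : inArb.inLeaves.ncard + outArb.outLeaves.ncard ≤ (leaves T).ncard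
  link_Q : ∀ a : Fin l,
    (∃ j j', 1 ≤ j ∧ j < j' ∧ j' ≤ r + 1 ∧
      (Q a).first ∈ (F .minus j ∪ F .plus j).verts ∧
      (Q a).last ∈ (F .minus j' ∪ F .plus j').verts ∧
      (Q a).length = 3 * (j' - j) + 1) ∨
    (∃ j, 2 ≤ j ∧ j ≤ r ∧
      (Q a).first ∈ (F .minus j).verts \ (S j).verts ∧
      (Q a).last = (segS j).last ∧
      (Q a).length = 3)

/-- `T` has an `(r, m)`-good decomposition. -/
def HasGoodDecomposition {V : Type*} (r : ℕ) (m : ℝ) (T : Digraph V) : Prop :=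
  ∃ D : Digraph V, Nonempty (GoodDecomposition r m D T)

end TreesInTournaments

/-!
Place the tournament on a median order, so that the first vertex of every interval of positions has
at least half of the interval as out-neighbours and the last one at least half as in-neighbours. The
parts `S₁, …, S_{r+1}` of the decomposition (the cores) are embedded from left to right in disjoint
intervals. By a theorem of Dross and Havet an in- or out-arborescence with `p` vertices and `q`
leaves fits into `p + q - 1` consecutive positions; since `S₁` and `S_{r+1}` have at most `k` leaves
together, this is where the `k - 2` additional vertices of the tournament are spent. Every other
piece gets exactly as many positions as it has vertices. Between two consecutive cores there is room
for `P_i`, which has length at least `2000 m`, for the forests attached to the two cores, and for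
the inner vertices of the links. The forests are embedded greedily near their cores, each link jumps
over the gaps in steps of three edges, and finally `P_i` is threaded through *all* the positions
left over in its gap, as a spanning directed path with prescribed ends.
-/

namespace TreesInTournaments

open Finset

section MedianOrders

open Classical in
/-- The number of forward edges (edges `xy` with `x < y`) of `R` from `X` to `Y`. -/
noncomputable def numForward (R : ℤ → ℤ → Prop) (X Y : Finset ℤ) : ℕ :=
  #{p ∈ X ×ˢ Y | p.1 < p.2 ∧ R p.1 p.2}

/-- The natural order of `[lo, hi]` is a median order of the tournament `R`: no set `Y` can be
moved in front of its complement `X` with a gain in forward edges. Having the tournament live on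
integer positions makes intervals of a median order, which are median orders again, easy to
handle. -/
structure IsMedianOrder (R : ℤ → ℤ → Prop) (lo hi : ℤ) : Prop where
  adj_iff_not_adj : ∀ i j, lo ≤ i → i ≤ hi → lo ≤ j → j ≤ hi → i ≠ j → (R i j ↔ ¬ R j i)
  numForward_swap_le : ∀ X Y : Finset ℤ, Disjoint X Y → X ∪ Y = Icc lo hi →
    numForward (Function.swap R) X Y ≤ numForward R X Y

open Classical in
theorem exists_equiv_fin_maximizing_forward {α : Type*} [Fintype α] {n : ℕ}
    (hn : Fintype.card α = n) (r : α → α → Prop) :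
    ∃ e : Fin n ≃ α, ∀ f : Fin n → ℤ, Function.Injective f →
      #{p : Fin n × Fin n | f p.1 < f p.2 ∧ r (e p.1) (e p.2)} ≤
        #{p : Fin n × Fin n | p.1 < p.2 ∧ r (e p.1) (e p.2)} := by
  have : Nonempty (Fin n ≃ α) := ⟨(Fintype.equivFinOfCardEq hn).symm⟩
  obtain ⟨e, he⟩ := Finite.exists_max fun e : Fin n ≃ α =>
    #{p : Fin n × Fin n | p.1 < p.2 ∧ r (e p.1) (e p.2)}
  refine ⟨e, fun f hf => le_trans (le_of_eq ?_) (he ((Tuple.sort f).trans e))⟩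
  set σ := Tuple.sort f
  have hσ : StrictMono (f ∘ σ) :=
    (Tuple.monotone_sort f).strictMono_of_injective (hf.comp σ.injective)
  have hlt : ∀ i j, f i < f j ↔ σ.symm i < σ.symm j := fun i j => by
    simpa using hσ.lt_iff_lt (a := σ.symm i) (b := σ.symm j)
  refine card_equiv (σ.symm.prodCongr σ.symm) fun p => ?_
  rw [mem_filter_univ, mem_filter_univ]
  simp [hlt]

open Classical in
theorem card_backward_le_of_maximizing_forward {n : ℕ} (r : Fin n → Fin n → Prop)
    (hmax : ∀ f : Fin n → ℤ, Function.Injective f →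
      #{p : Fin n × Fin n | f p.1 < f p.2 ∧ r p.1 p.2} ≤
        #{p : Fin n × Fin n | p.1 < p.2 ∧ r p.1 p.2})
    (Y : Finset (Fin n)) :
    #{p ∈ Yᶜ ×ˢ Y | p.1 < p.2 ∧ r p.2 p.1} ≤ #{p ∈ Yᶜ ×ˢ Y | p.1 < p.2 ∧ r p.1 p.2} := by
  -- positions after moving `Y` to the front
  set f : Fin n → ℤ := fun i => if i ∈ Y then (i : ℤ) - n else i with hf
  have hinj : Function.Injective f := by
    intro i j hij
    simp only [hf] at hij
    split_ifs at hij <;> omega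
  set A : Finset (Fin n × Fin n) := {p | p.1 < p.2 ∧ r p.1 p.2} with hA
  set A' : Finset (Fin n × Fin n) := {p | f p.1 < f p.2 ∧ r p.1 p.2} with hA'
  set B := {p ∈ Yᶜ ×ˢ Y | p.1 < p.2 ∧ r p.1 p.2} with hB
  set C := {p ∈ Yᶜ ×ˢ Y | p.1 < p.2 ∧ r p.2 p.1} with hC
  have hBA : B ⊆ A := fun p hp => by simp_all
  have hsub : A \ B ∪ C.map (Equiv.prodComm _ _).toEmbedding ⊆ A' := by
    rintro ⟨u, v⟩ hp
    have := u.isLt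
    have := v.isLt
    simp only [hA, hB, hC, mem_union, mem_sdiff, mem_filter, mem_product, mem_compl,
      mem_map_equiv, Equiv.prodComm_symm, Equiv.prodComm_apply, Prod.fst_swap, Prod.snd_swap] at hp
    simp only [hA', hf, mem_filter_univ]
    grind
  have hdisj : Disjoint (A \ B) (C.map (Equiv.prodComm _ _).toEmbedding) := by
    rw [disjoint_left]
    rintro ⟨u, v⟩ hp hq
    simp only [hA, hC, mem_sdiff, mem_filter, mem_map_equiv, Equiv.prodComm_symm,
      Equiv.prodComm_apply, Prod.fst_swap, Prod.snd_swap] at hp hq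
    omega
  have := (card_le_card hsub).trans (hmax f hinj)
  rw [card_union_of_disjoint hdisj, card_map, card_sdiff_of_subset hBA] at this
  have := card_le_card hBA
  omega

open Classical in
theorem numForward_map {ι : Type*} [LinearOrder ι] (R : ℤ → ℤ → Prop)
    {f : ι ↪ ℤ} (hf : StrictMono f) (X Y : Finset ι) :
    numForward R (X.map f) (Y.map f) = #{p ∈ X ×ˢ Y | p.1 < p.2 ∧ R (f p.1) (f p.2)} := by
  rw [numForward, ← prodMap_map_product, filter_map, card_map]
  simp [Function.comp_def, hf.lt_iff_lt]

theorem exists_isMedianOrder {α : Type*} [Fintype α] [Nonempty α] (r : α → α → Prop)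
    (hr : ∀ a b, a ≠ b → (r a b ↔ ¬ r b a)) :
    ∃ e : ℤ → α, Set.InjOn e (Set.Icc 0 (Fintype.card α - 1)) ∧
      IsMedianOrder (fun i j => r (e i) (e j)) 0 (Fintype.card α - 1) := by
  generalize hn : Fintype.card α = n
  obtain ⟨E, hE⟩ := exists_equiv_fin_maximizing_forward hn r
  have : NeZero n := ⟨hn ▸ Fintype.card_ne_zero⟩
  set pos : Fin n ↪ ℤ := Fin.valEmbedding.trans Nat.castEmbedding
  have hpos : StrictMono pos := fun i j h => by simpa [pos] using h
  have huniv : Icc 0 ((n : ℤ) - 1) = univ.map pos := by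
    ext z
    simp only [mem_Icc, mem_map, mem_univ, true_and]
    exact ⟨fun hz => ⟨⟨z.toNat, by omega⟩, by simp [pos, hz.1]⟩,
      by rintro ⟨i, rfl⟩; simp [pos]⟩
  obtain ⟨e, he⟩ : ∃ e : ℤ → α, e ∘ pos = E :=
    ⟨fun z => E (Fin.ofNat n z.toNat), by ext i; simp [pos]⟩
  have hinj : Set.InjOn e (Set.Icc 0 (n - 1)) := by
    rw [← coe_Icc, huniv]
    intro i hi j hj hij
    obtain ⟨i, -, rfl⟩ := mem_map.1 (mem_coe.1 hi)
    obtain ⟨j, -, rfl⟩ := mem_map.1 (mem_coe.1 hj)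
    rw [E.injective (show E i = E j by simpa [← he] using hij)]
  refine ⟨e, hinj, fun i j hi hi' hj hj' hij => hr _ _ (hinj.ne ⟨hi, hi'⟩ ⟨hj, hj'⟩ hij), ?_⟩
  intro X Y hXY hunion
  obtain ⟨Y, -, rfl⟩ := subset_map_iff.1 (huniv ▸ hunion ▸ subset_union_right : Y ⊆ univ.map pos)
  obtain rfl : X = Yᶜ.map pos := by
    rw [compl_eq_univ_sdiff, Finset.map_sdiff, ← huniv, ← hunion, union_sdiff_cancel_right hXY]
  rw [numForward_map _ hpos, numForward_map _ hpos]
  rw [← he] at hE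
  exact card_backward_le_of_maximizing_forward (fun i j => r ((e ∘ pos) i) ((e ∘ pos) j)) hE Y

variable {R : ℤ → ℤ → Prop} {lo hi : ℤ}

theorem IsMedianOrder.mono (h : IsMedianOrder R lo hi) {lo' hi' : ℤ} (hlo : lo ≤ lo')
    (hhi : hi' ≤ hi) : IsMedianOrder R lo' hi' := by
  refine ⟨fun i j _ _ _ _ => h.adj_iff_not_adj i j (by omega) (by omega) (by omega) (by omega),
    fun X Y hXY hunion => ?_⟩
  rcases lt_or_ge hi' lo' with hlt | hle
  · obtain ⟨rfl, rfl⟩ := union_eq_empty.1 (hunion.trans (Icc_eq_empty (by omega)))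
    simp [numForward]
  have hmem : ∀ z, (z ∈ X ∨ z ∈ Y) ↔ lo' ≤ z ∧ z ≤ hi' := fun z => by
    rw [← mem_union, hunion, mem_Icc]
  -- the positions before `lo'` join `Y` and those after `hi'` join `X`
  have hext : ∀ q : ℤ → ℤ → Prop,
      numForward q (X ∪ Ioc hi' hi) (Y ∪ Ico lo lo') = numForward q X Y := by
    intro q
    unfold numForward
    congr 1
    ext ⟨x, y⟩
    have := hmem x
    have := hmem y
    simp only [mem_filter, mem_product, mem_union, mem_Ioc, mem_Ico]
    grind
  rw [← hext, ← hext]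
  refine h.numForward_swap_le _ _ ?_ ?_
  · rw [disjoint_left] at hXY ⊢
    intro z
    have := hmem z
    have := @hXY z
    simp only [mem_union, mem_Ioc, mem_Ico]
    grind
  · ext z
    have := hmem z
    simp only [mem_union, mem_Ioc, mem_Ico, mem_Icc]
    grind

open scoped Pointwise in
theorem numForward_neg (q : ℤ → ℤ → Prop) (X Y : Finset ℤ) :
    numForward (fun i j => q (-j) (-i)) X Y = numForward q (-Y) (-X) :=
  card_equiv ((Equiv.prodComm ℤ ℤ).trans ((Equiv.neg ℤ).prodCongr (Equiv.neg ℤ))) fun p => by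
    simp [and_comm]

open scoped Pointwise in
theorem IsMedianOrder.neg (h : IsMedianOrder R lo hi) :
    IsMedianOrder (fun i j => R (-j) (-i)) (-hi) (-lo) := by
  refine ⟨fun i j _ _ _ _ _ => h.adj_iff_not_adj (-j) (-i) (by omega) (by omega) (by omega)
    (by omega) (by omega), fun X Y hXY hunion => ?_⟩
  have hswap : Function.swap (fun i j => R (-j) (-i)) = fun i j => Function.swap R (-j) (-i) := rfl
  rw [hswap, numForward_neg, numForward_neg]
  refine h.numForward_swap_le _ _ ?_ ?_
  · simp only [disjoint_left, mem_neg'] at hXY ⊢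
    exact fun z hY hX => hXY hX hY
  · ext z
    have := congrArg (-z ∈ ·) hunion
    simp only [mem_union, mem_Icc, mem_neg', eq_iff_iff] at this ⊢
    grind

open Classical in
theorem numForward_singleton (q : ℤ → ℤ → Prop) (i j : ℤ) :
    numForward q {i} (Ioc i j) = #{y ∈ Ioc i j | q i y} := by
  rw [numForward, singleton_product, filter_map, card_map]
  congr 1
  ext z
  simp only [mem_filter, mem_Ioc, Function.comp, Function.Embedding.coeFn_mk]
  tauto

open Classical in
theorem IsMedianOrder.sub_le_two_mul_card_out (h : IsMedianOrder R lo hi) {i j : ℤ} (hlo : lo ≤ i)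
    (hij : i ≤ j) (hj : j ≤ hi) : j - i ≤ 2 * (#{y ∈ Ioc i j | R i y} : ℤ) := by
  have hle := (h.mono hlo hj).numForward_swap_le {i} (Ioc i j) (by simp)
    (by ext; simp; omega)
  rw [numForward_singleton, numForward_singleton] at hle
  have hin : {y ∈ Ioc i j | Function.swap R i y} = {y ∈ Ioc i j | ¬ R i y} :=
    filter_congr fun y hy => by
      have := mem_Ioc.1 hy
      exact h.adj_iff_not_adj y i (by omega) (by omega) (by omega) (by omega) (by omega)
  have hcard := card_filter_add_card_filter_not (s := Ioc i j) (fun y => R i y)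
  rw [hin] at hle
  rw [Int.card_Ioc] at hcard
  omega

open Classical in
theorem IsMedianOrder.sub_le_two_mul_card_in (h : IsMedianOrder R lo hi) {i j : ℤ} (hlo : lo ≤ i)
    (hij : i ≤ j) (hj : j ≤ hi) : j - i ≤ 2 * (#{x ∈ Ico i j | R x j} : ℤ) := by
  have hneg := h.neg.sub_le_two_mul_card_out (i := -j) (j := -i) (by omega) (by omega) (by omega)
  have : #{y ∈ Ioc (-j) (-i) | R (-y) (- -j)} = #{x ∈ Ico i j | R x j} :=
    card_equiv (Equiv.neg ℤ) fun y => by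
      simp only [mem_filter, mem_Ioc, mem_Ico, Equiv.neg_apply, neg_neg]
      grind
  omega

theorem IsMedianOrder.adj_succ (h : IsMedianOrder R lo hi) {i : ℤ} (hlo : lo ≤ i)
    (hi' : i + 1 ≤ hi) : R i (i + 1) := by
  classical
  have hout := h.sub_le_two_mul_card_out hlo (by omega) hi'
  obtain ⟨y, hy⟩ := card_pos.1 (show 0 < #{y ∈ Ioc i (i + 1) | R i y} by omega)
  rw [mem_filter, mem_Ioc] at hy
  obtain rfl : y = i + 1 := by omega
  exact hy.2

open Classical in
theorem IsMedianOrder.sub_le_card_out_Icc (h : IsMedianOrder R lo hi) {i s t : ℤ}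
    (hlo : lo ≤ i) (his : i < s) (hst : s ≤ t + 1) (ht : t ≤ hi) :
    t - i ≤ 2 * (#{y ∈ Icc s t | R i y} : ℤ) + 2 * (s - 1 - i) := by
  have hout := h.sub_le_two_mul_card_out (j := t) hlo (by omega) ht
  have hsub : {y ∈ Ioc i t | R i y} ⊆ {y ∈ Icc s t | R i y} ∪ Ioo i s := by grind
  have hcard := (card_le_card hsub).trans (card_union_le _ _)
  rw [Int.card_Ioo] at hcard
  omega

open Classical in
theorem IsMedianOrder.sub_le_card_in_Icc (h : IsMedianOrder R lo hi) {j s t : ℤ} (hs : lo ≤ s)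
    (hst : s ≤ t + 1) (htj : t < j) (hj : j ≤ hi) :
    j - s ≤ 2 * (#{x ∈ Icc s t | R x j} : ℤ) + 2 * (j - 1 - t) := by
  have hin := h.sub_le_two_mul_card_in (j := j) hs (by omega) hj
  have hsub : {x ∈ Ico s j | R x j} ⊆ {x ∈ Icc s t | R x j} ∪ Ioo t j := by grind
  have hcard := (card_le_card hsub).trans (card_union_le _ _)
  rw [Int.card_Ioo] at hcard
  omega

end MedianOrders

section ThreePaths

variable {R : ℤ → ℤ → Prop} {lo hi : ℤ}

open Classical in
theorem numForward_eq_sum (q : ℤ → ℤ → Prop) (X Y : Finset ℤ) :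
    numForward q X Y = ∑ y ∈ Y, #{x ∈ X | x < y ∧ q x y} := by
  simp only [numForward, card_filter, sum_product_right]

open Classical in
theorem IsMedianOrder.card_mul_le (h : IsMedianOrder R lo hi) {X Y Y' Z : Finset ℤ} {c : ℕ}
    (hXY : Disjoint X Y) (hunion : X ∪ Y = Icc lo hi) (hY' : Y' ⊆ Y)
    (hback : ∀ y ∈ Y', c ≤ #{x ∈ X | x < y ∧ R y x})
    (hforw : ∀ x ∈ X, ∀ y ∈ Y, R x y → x ∈ Z) : #Y' * c ≤ #Z * #Y :=
  calc #Y' * c ≤ ∑ y ∈ Y', #{x ∈ X | x < y ∧ R y x} := by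
        simpa using card_nsmul_le_sum Y' _ c hback
    _ ≤ ∑ y ∈ Y, #{x ∈ X | x < y ∧ R y x} := sum_le_sum_of_subset hY'
    _ = numForward (Function.swap R) X Y := (numForward_eq_sum _ _ _).symm
    _ ≤ numForward R X Y := h.numForward_swap_le X Y hXY hunion
    _ ≤ #(Z ×ˢ Y) := card_le_card fun p hp => by
        simp only [mem_filter, mem_product] at hp ⊢
        exact ⟨hforw _ hp.1.1 _ hp.1.2 hp.2.2, hp.1.2⟩
    _ = #Z * #Y := card_product Z Y

theorem card_le_two_mul_card_filter_lt {Y : Finset ℤ} {u : ℤ} (hY : ∀ y ∈ Y, u < y) :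
    #Y ≤ 2 * #{y ∈ Y | u + (#Y / 2 : ℕ) < y} := by
  have hsub : Y ⊆ {y ∈ Y | u + (#Y / 2 : ℕ) < y} ∪ Ioc u (u + (#Y / 2 : ℕ)) := fun y hy => by
    have := hY y hy
    rw [mem_union, mem_filter, mem_Ioc]
    grind
  have hcard := (card_le_card hsub).trans (card_union_le _ _)
  rw [Int.card_Ioc] at hcard
  omega

/-- If there were no edge from `X` to `Y`, then `X` and `Y` would be almost disjoint and almost
cover the interval, and moving `Y` in front of the rest would gain the edges from `Y` back to
`X`. -/
theorem IsMedianOrder.exists_adj_of_dense (h : IsMedianOrder R lo hi) {X Y : Finset ℤ}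
    (hX : X ⊆ Icc lo hi) (hY : Y ⊆ Icc lo hi) {b c : ℤ}
    (hb : 0 ≤ b) (hc : 0 ≤ c)
    (hXd : ∀ t, lo - 1 ≤ t → t ≤ hi → t - (lo - 1) ≤ 2 * #{x ∈ X | x ≤ t} + b)
    (hYd : hi - (lo - 1) ≤ 2 * #Y + c) (hlen : 12 * b + 9 * c + 50 ≤ hi - (lo - 1)) :
    ∃ x ∈ X, ∃ y ∈ Y, x ≠ y ∧ R x y := by
  classical
  by_contra! hcon
  have hYlo : ∀ y ∈ Y, lo - 1 < y := fun y hy => by have := mem_Icc.1 (hY hy); omega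
  have hadj : ∀ x ∈ X, ∀ y ∈ Y, x ≠ y → R y x := fun x hx y hy hxy => by
    have := mem_Icc.1 (hX hx)
    have := mem_Icc.1 (hY hy)
    exact (h.adj_iff_not_adj y x (by omega) (by omega) (by omega) (by omega) hxy.symm).2
      (hcon x hx y hy hxy)
  have hinter : #(X ∩ Y) ≤ 1 := card_le_one.2 fun x hx y hy => by
    rw [mem_inter] at hx hy
    by_contra hxy
    exact hcon y hy.1 x hx.2 (Ne.symm hxy) (hadj x hx.1 y hy.2 hxy)
  have hZ : #(Icc lo hi \ (X ∪ Y)) + #(X ∪ Y) = #(Icc lo hi) :=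
    card_sdiff_add_card_eq_card (union_subset hX hY)
  have hXY := card_union_add_card_inter X Y
  have hXle : #{x ∈ X | x ≤ hi} ≤ #X := card_filter_le _ _
  have hXhi := hXd hi (by omega) le_rfl
  have hYle : #Y ≤ #(Icc lo hi) := card_le_card hY
  rw [Int.card_Icc] at hZ hYle
  have hmul : #{y ∈ Y | lo - 1 + (#Y / 2 : ℕ) < y} * (2 * #(Icc lo hi \ (X ∪ Y)) + 1) ≤
      #(Icc lo hi \ (X ∪ Y)) * #Y := by
    refine h.card_mul_le disjoint_sdiff.symm (sdiff_union_of_subset hY) (filter_subset _ _)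
      (fun y hy => ?_) fun x hx y hy hxy => ?_
    · obtain ⟨hy, hlt⟩ := mem_filter.1 hy
      have := mem_Icc.1 (hY hy)
      have hsub : {x ∈ X | x ≤ y - 1} ⊆ {x ∈ Icc lo hi \ Y | x < y ∧ R y x} ∪ X ∩ Y := by
        intro x hx
        have := @hX x
        grind
      have := (card_le_card hsub).trans (card_union_le _ _)
      have := hXd (y - 1)
      omega
    · grind
  have hhalf := card_le_two_mul_card_filter_lt hYlo
  nlinarith

theorem IsMedianOrder.exists_three_path (h : IsMedianOrder R lo hi) {u e w : ℤ} (B : Finset ℤ)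
    (hu : lo ≤ u) (hue : u < e) (hew : e ≤ w) (hw : w ≤ hi)
    (hlen : 42 * (#B : ℤ) + 9 * (w - e) + 60 < e - u) :
    ∃ a b, (u < a ∧ a < e ∧ a ∉ B) ∧ (u < b ∧ b < e ∧ b ∉ B) ∧ a ≠ b ∧ R u a ∧ R a b ∧ R b w := by
  classical
  set X := {x ∈ Icc (u + 1) (e - 1) | R u x} \ B with hX
  have hXd : ∀ t, u + 1 - 1 ≤ t → t ≤ e - 1 →
      t - (u + 1 - 1) ≤ 2 * #{x ∈ X | x ≤ t} + 2 * (#B : ℤ) := fun t hut hte => by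
    have hout := h.sub_le_card_out_Icc (i := u) (s := u + 1) (t := t) hu (by omega) (by omega)
      (by omega)
    have hsub : {x ∈ Icc (u + 1) t | R u x} ⊆ {x ∈ X | x ≤ t} ∪ B := fun x => by
      simp only [hX, mem_filter, mem_union, mem_sdiff, mem_Icc]
      grind
    have := (card_le_card hsub).trans (card_union_le _ _)
    omega
  set Y := {y ∈ Icc (u + 1) (e - 1) | R y w} \ B
  have hYd : e - 1 - (u + 1 - 1) ≤ 2 * #Y + (2 * (#B : ℤ) + (w - e)) := by
    have hin := h.sub_le_card_in_Icc (j := w) (s := u + 1) (t := e - 1) (by omega) (by omega)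
      (by omega) hw
    have : #{y ∈ Icc (u + 1) (e - 1) | R y w} - #B ≤ #Y := le_card_sdiff _ _
    omega
  obtain ⟨a, ha, b, hb, hab, hadj⟩ :=
    (h.mono (lo' := u + 1) (hi' := e - 1) (by omega) (by omega)).exists_adj_of_dense
      (sdiff_subset.trans (filter_subset _ _)) (sdiff_subset.trans (filter_subset _ _))
      (by omega) (by omega) hXd hYd (by omega)
  simp only [mem_sdiff, mem_filter, mem_Icc] at ha hb
  exact ⟨a, b, ⟨by omega, by omega, ha.2⟩, ⟨by omega, by omega, hb.2⟩, hab, ha.1.2, hadj, hb.1.2⟩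

end ThreePaths

section SpanningPaths

theorem exists_isChain_perm_cons {α : Type*} {R : α → α → Prop} {w : α} {l : List α}
    (hl : l.IsChain R) (htour : ∀ z ∈ l, (R z w ↔ ¬ R w z)) (hex : ∃ z ∈ l, R z w)
    (hlast : ∀ u ∈ l.getLast?, R w u) :
    ∃ l' : List α, l'.IsChain R ∧ l'.Perm (w :: l) ∧ l'.head? = l.head? ∧
      l'.getLast? = l.getLast? := by
  induction l with
  | nil => simp at hex
  | cons x t ih =>
    rcases t with - | ⟨y, t⟩
    · obtain ⟨z, hz, hzw⟩ := hex
      obtain rfl := List.mem_singleton.1 hz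
      exact absurd (hlast z rfl) ((htour z hz).1 hzw)
    rw [List.isChain_cons_cons] at hl
    by_cases hins : R x w ∧ R w y
    · exact ⟨x :: w :: y :: t, by simp [hins, hl.2], List.Perm.swap _ _ _, rfl, by simp⟩
    have hex' : ∃ z ∈ y :: t, R z w := by
      obtain ⟨z, hz, hzw⟩ := hex
      rcases List.mem_cons.1 hz with rfl | hz
      · exact ⟨y, by simp, (htour y (by simp)).2 fun hwy => hins ⟨hzw, hwy⟩⟩
      · exact ⟨z, hz, hzw⟩
    obtain ⟨l', hchain, hperm, hhead, hlast'⟩ := ih hl.2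
      (fun z hz => htour z (List.mem_cons_of_mem _ hz)) hex' fun u hu => hlast u (by simpa using hu)
    obtain ⟨t', rfl⟩ : ∃ t', l' = y :: t' := List.head?_eq_some_iff.1 hhead
    exact ⟨x :: y :: t', List.isChain_cons_cons.2 ⟨hl.1, hchain⟩,
      (hperm.cons x).trans (List.Perm.swap _ _ _), rfl, by simpa using hlast'⟩

/-- The list `l` is a directed path in `R` with vertex set `X`, from `p` to `q`. -/
structure IsSpanningPath (R : ℤ → ℤ → Prop) (X : Finset ℤ) (p q : ℤ) (l : List ℤ) : Prop where
  chain : l.IsChain R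
  nodup : l.Nodup
  mem_iff : ∀ z, z ∈ l ↔ z ∈ X
  head : l.head? = some p
  last : l.getLast? = some q

variable {R : ℤ → ℤ → Prop} {lo hi : ℤ}

namespace IsSpanningPath

theorem singleton (R : ℤ → ℤ → Prop) (p : ℤ) : IsSpanningPath R {p} p p [p] :=
  ⟨by simp, by simp, by simp, rfl, rfl⟩

variable {X Y : Finset ℤ} {p q s t : ℤ} {l l' : List ℤ}

theorem length_eq (h : IsSpanningPath R X p q l) : l.length = #X := by
  rw [← List.toFinset_card_of_nodup h.nodup]
  congr 1
  ext z
  rw [List.mem_toFinset, h.mem_iff]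

theorem last_mem (h : IsSpanningPath R X p q l) : q ∈ X :=
  (h.mem_iff q).1 (List.mem_of_getLast? h.last)

theorem append (h : IsSpanningPath R X p q l) (h' : IsSpanningPath R Y s t l') (hqs : R q s)
    (hXY : Disjoint X Y) : IsSpanningPath R (X ∪ Y) p t (l ++ l') where
  chain := by
    refine List.isChain_append.2 ⟨h.chain, h'.chain, fun a ha b hb => ?_⟩
    rw [h.last, Option.mem_some_iff] at ha
    rw [h'.head, Option.mem_some_iff] at hb
    exact ha ▸ hb ▸ hqs
  nodup := List.nodup_append'.2 ⟨h.nodup, h'.nodup, fun a ha ha' =>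
    disjoint_left.1 hXY ((h.mem_iff a).1 ha) ((h'.mem_iff a).1 ha')⟩
  mem_iff z := by rw [List.mem_append, mem_union, h.mem_iff, h'.mem_iff]
  head := by simp [h.head]
  last := by simp [h'.last]

open scoped Pointwise in
theorem neg (h : IsSpanningPath (fun i j => R (-j) (-i)) X p q l) :
    IsSpanningPath R (-X) (-q) (-p) (l.reverse.map Neg.neg) where
  chain := by rw [List.isChain_map, List.isChain_reverse]; exact h.chain
  nodup := (List.nodup_reverse.2 h.nodup).map neg_injective
  mem_iff z := by simp [h.mem_iff, neg_eq_iff_eq_neg]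
  head := by simp [h.last]
  last := by simp [h.head]

theorem exists_insert (h : IsSpanningPath R X p q l) {w : ℤ} (hw : w ∉ X)
    (htour : ∀ z ∈ X, (R z w ↔ ¬ R w z)) (hex : ∃ z ∈ X, R z w) :
    ∃ u l', IsSpanningPath R (insert w X) p u l' ∧ (u = w ∨ u = q ∧ ¬ R q w) := by
  by_cases hqw : R q w
  · refine ⟨w, l ++ [w], ?_, Or.inl rfl⟩
    rw [insert_eq, union_comm]
    exact h.append (singleton R w) hqw (disjoint_singleton_right.2 hw)
  have hwq : R w q := by
    by_contra hwq
    exact hqw ((htour q h.last_mem).2 hwq)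
  obtain ⟨l', hchain, hperm, hhead, hlast⟩ := exists_isChain_perm_cons h.chain
    (fun z hz => htour z ((h.mem_iff z).1 hz)) (by simpa only [h.mem_iff] using hex)
    (by simpa [h.last] using hwq)
  refine ⟨q, l', ⟨hchain, ?_, fun z => ?_, hhead.trans h.head, hlast.trans h.last⟩,
    Or.inr ⟨rfl, hqw⟩⟩
  · rw [hperm.nodup_iff, List.nodup_cons, h.mem_iff]
    exact ⟨hw, h.nodup⟩
  · rw [hperm.mem_iff, List.mem_cons, h.mem_iff, mem_insert]

end IsSpanningPath

theorem IsMedianOrder.exists_isSpanningPath_prefix (h : IsMedianOrder R lo hi) {p q : ℤ}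
    (hp : lo ≤ p) (hpq : p ≤ q) (hq : q ≤ hi) {A : Finset ℤ} (hpA : p ∉ A)
    (hin : ∀ e, p < e → e ≤ q → e ∉ A → ∃ z, p ≤ z ∧ z < e ∧ z ∉ A ∧ R z e) :
    ∃ u l, IsSpanningPath R (Icc p q \ A) p u l ∧ ∀ z, u < z → z ≤ q → R u z → z ∈ A := by
  induction q, hpq using Int.leInduction with
  | base =>
    refine ⟨p, [p], ?_, by omega⟩
    rw [Icc_self, sdiff_eq_self_of_disjoint (disjoint_singleton_left.2 hpA)]
    exact IsSpanningPath.singleton R p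
  | succ q hpq ih =>
    obtain ⟨u, l, hl, hu⟩ := ih (by omega) fun e hpe heq => hin e hpe (by omega)
    have hIcc : Icc p (q + 1) = insert (q + 1) (Icc p q) := by ext; grind
    by_cases hqA : q + 1 ∈ A
    · rw [hIcc, insert_sdiff_of_mem _ hqA]
      exact ⟨u, l, hl, fun z => by grind⟩
    have hmem : ∀ z ∈ Icc p q \ A, (R z (q + 1) ↔ ¬ R (q + 1) z) := fun z hz => by
      have := mem_Icc.1 (mem_sdiff.1 hz).1
      exact h.adj_iff_not_adj _ _ (by omega) (by omega) (by omega) (by omega) (by omega)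
    obtain ⟨z, hpz, hzq, hzA, hz⟩ := hin (q + 1) (by omega) le_rfl hqA
    obtain ⟨u', l', hl', hu'⟩ := hl.exists_insert (by simp) hmem
      ⟨z, mem_sdiff.2 ⟨mem_Icc.2 ⟨hpz, by omega⟩, hzA⟩, hz⟩
    rw [hIcc, insert_sdiff_of_notMem _ hqA]
    exact ⟨u', l', hl', fun z => by grind⟩

theorem IsMedianOrder.exists_isSpanningPath_of_free_end (h : IsMedianOrder R lo hi) {p e c : ℤ}
    (hp : lo ≤ p) (hpe : p ≤ e) (he : e ≤ hi) {A : Finset ℤ} (hc : 2 * (#A : ℤ) < c)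
    (hA : ∀ z ∈ A, p + c ≤ z) (hfree : ∀ z, e - 2 * #A ≤ z → z ≤ e → z ∉ A) :
    ∃ l, IsSpanningPath R (Icc p e \ A) p e l := by
  classical
  have hin : ∀ e', p < e' → e' ≤ e → e' ∉ A → ∃ z, p ≤ z ∧ z < e' ∧ z ∉ A ∧ R z e' := by
    intro e' hpe' hee' _
    by_contra! hcon
    have hin := h.sub_le_two_mul_card_in (i := p) (j := e') hp hpe'.le (by omega)
    have hsub : {x ∈ Ico p e' | R x e'} ⊆ A := by grind
    have := card_le_card hsub
    obtain ⟨x, hx⟩ := card_pos.1 (show 0 < #{x ∈ Ico p e' | R x e'} by omega)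
    have := hA x (hsub hx)
    simp only [mem_filter, mem_Ico] at hx
    omega
  obtain ⟨u, l, hl, hu⟩ := h.exists_isSpanningPath_prefix hp hpe he
    (fun hpA => by have := hA p hpA; omega) hin
  have hul := hl.last_mem
  rw [mem_sdiff, mem_Icc] at hul
  -- the out-neighbours of `u` up to `e` are deleted, so `u` is too close to `e` to have any
  have hout := h.sub_le_two_mul_card_out (i := u) (j := e) (by omega) (by omega) he
  have hsub : {y ∈ Ioc u e | R u y} ⊆ A := by grind
  have := card_le_card hsub
  have hempty : {y ∈ Ioc u e | R u y} = ∅ := eq_empty_of_forall_notMem fun y hy => by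
    have hyA := hsub hy
    rw [mem_filter, mem_Ioc] at hy
    exact hfree y (by omega) hy.1.2 hyA
  rw [hempty, card_empty] at hout
  obtain rfl : u = e := by omega
  exact ⟨l, hl⟩

open scoped Pointwise in
theorem IsMedianOrder.exists_isSpanningPath (h : IsMedianOrder R lo hi) {p q e c : ℤ}
    (hp : lo ≤ p) (hpe : p ≤ e) (heq : e < q) (hq : q ≤ hi) {A : Finset ℤ}
    (hc : 2 * (#A : ℤ) < c) (hA : ∀ z ∈ A, p + c ≤ z ∧ z ≤ q - c)
    (hfree : ∀ z, e - 2 * #A ≤ z → z ≤ e + 1 + 2 * #A → z ∉ A) :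
    ∃ l, IsSpanningPath R (Icc p q \ A) p q l := by
  obtain ⟨l₁, hl₁⟩ := h.exists_isSpanningPath_of_free_end hp hpe (by omega) hc
    (fun z hz => (hA z hz).1) fun z hez hze => hfree z hez (by omega)
  have hcard : #(-A) = #A := card_neg A
  obtain ⟨l₂, hl₂⟩ := h.neg.exists_isSpanningPath_of_free_end (p := -q) (e := -(e + 1)) (c := c)
    (A := -A) (by omega) (by omega) (by omega) (by omega)
    (fun z hz => by have := hA _ (mem_neg'.1 hz); omega)
    fun z _ _ hz => hfree (-z) (by omega) (by omega) (mem_neg'.1 hz)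
  have hl₂ := hl₂.neg
  rw [neg_neg, neg_neg] at hl₂
  have hunion : Icc p q \ A = (Icc p e \ A) ∪ -(Icc (-q) (-(e + 1)) \ -A) := by
    ext z
    simp only [mem_union, mem_sdiff, mem_Icc, mem_neg', neg_neg]
    grind
  rw [hunion]
  refine ⟨_, hl₁.append hl₂ (h.adj_succ (by omega) (by omega)) (disjoint_left.2 fun z hz hz' => ?_)⟩
  simp only [mem_sdiff, mem_Icc, mem_neg'] at hz hz'
  omega

end SpanningPaths

section TreeEmbedding

/-- `X` is obtained from one vertex by adding vertices which are adjacent, in the underlying graph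
of `H`, to exactly one earlier vertex. -/
inductive IsGrown {A : Type*} [DecidableEq A] (H : A → A → Prop) : Finset A → Prop
  | singleton (v : A) : IsGrown H {v}
  | insert (X : Finset A) (u v : A) (hX : IsGrown H X) (hu : u ∈ X) (hv : v ∉ X)
      (huv : H u v ∨ H v u) (huniq : ∀ w ∈ X, H w v ∨ H v w → w = u) : IsGrown H (insert v X)

/-- From each element of `Y`, at most half of the positions of `[lo, hi]` above it, and at most half
of those below it, belong to `Y`. In a median order of `[lo, hi]` each element of `Y` then has an
out-neighbour and an in-neighbour outside `Y`, with two positions to spare at each end. -/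
structure IsSparse (Y : Finset ℤ) (lo hi : ℤ) : Prop where
  mem_Icc : ∀ y ∈ Y, y ∈ Icc lo hi
  card_above_le : ∀ y ∈ Y, 2 * (#{x ∈ Y | y < x} : ℤ) ≤ hi - y
  card_below_le : ∀ y ∈ Y, 2 * (#{x ∈ Y | x < y} : ℤ) ≤ y - lo

namespace IsSparse

variable {Y : Finset ℤ} {lo hi z : ℤ}

open scoped Pointwise in
theorem neg (h : IsSparse Y lo hi) : IsSparse (-Y) (-hi) (-lo) := by
  have hcard : ∀ y, #{x ∈ -Y | -y < x} = #{x ∈ Y | x < y} ∧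
      #{x ∈ -Y | x < -y} = #{x ∈ Y | y < x} := fun y =>
    ⟨card_equiv (Equiv.neg ℤ) (by simp [neg_lt (a := y)]),
      card_equiv (Equiv.neg ℤ) (by simp [lt_neg (b := y)])⟩
  refine ⟨fun y hy => ?_, fun y hy => ?_, fun y hy => ?_⟩
  all_goals
    rw [mem_neg'] at hy
    have := hcard (-y)
    rw [neg_neg] at this
  · have := Finset.mem_Icc.1 (h.mem_Icc _ hy)
    exact Finset.mem_Icc.2 ⟨by omega, by omega⟩
  · have := h.card_below_le _ hy
    omega
  · have := h.card_above_le _ hy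
    omega

theorem two_mul_card_above_le (h : IsSparse Y lo (hi - 2)) (hz : z ≤ hi) :
    2 * (#{x ∈ Y | z < x} : ℤ) ≤ hi - z := by
  rcases ({x ∈ Y | z < x}).eq_empty_or_nonempty with hempty | hne
  · rw [hempty, card_empty]
    omega
  obtain ⟨hw, hzw⟩ := mem_filter.1 (min'_mem _ hne)
  set w := min' _ hne
  have hsub : {x ∈ Y | z < x} ⊆ insert w {x ∈ Y | w < x} := fun x hx => by
    have := (min'_le _ x hx).eq_or_lt
    grind
  have := (card_le_card hsub).trans (card_insert_le _ _)
  have := h.card_above_le w hw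
  omega

open scoped Pointwise in
theorem two_mul_card_below_le (h : IsSparse Y (lo + 2) hi) (hz : lo ≤ z) :
    2 * (#{x ∈ Y | x < z} : ℤ) ≤ z - lo := by
  have hneg := h.neg
  rw [neg_add, ← sub_eq_add_neg] at hneg
  have := hneg.two_mul_card_above_le (z := -z) (by omega)
  have : #{x ∈ -Y | -z < x} = #{x ∈ Y | x < z} :=
    card_equiv (Equiv.neg ℤ) (by simp [neg_lt (a := z)])
  omega

protected theorem insert (h : IsSparse Y (lo + 2) (hi - 2)) (hlo : lo ≤ z) (hhi : z ≤ hi) :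
    IsSparse (insert z Y) lo hi := by
  have habove := h.two_mul_card_above_le hhi
  have hbelow := h.two_mul_card_below_le hlo
  have hle : ∀ (q : ℤ → Prop) [DecidablePred q], #{x ∈ insert z Y | q x} ≤ #{x ∈ Y | q x} + 1 :=
    fun q _ => by
      rw [filter_insert]
      split_ifs
      · exact card_insert_le _ _
      · omega
  refine ⟨forall_mem_insert .. |>.2 ⟨by simp [hlo, hhi], fun y hy => ?_⟩,
    forall_mem_insert .. |>.2 ⟨?_, fun y hy => ?_⟩,
    forall_mem_insert .. |>.2 ⟨?_, fun y hy => ?_⟩⟩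
  · have := Finset.mem_Icc.1 (h.mem_Icc y hy)
    exact Finset.mem_Icc.2 ⟨by omega, by omega⟩
  · rwa [filter_insert, if_neg (lt_irrefl z)]
  · have := hle (y < ·)
    have := h.card_above_le y hy
    omega
  · rwa [filter_insert, if_neg (lt_irrefl z)]
  · have := hle (· < y)
    have := h.card_below_le y hy
    omega

variable {R : ℤ → ℤ → Prop}

theorem exists_notMem_adj (h : IsSparse Y (lo + 2) (hi - 2)) (hR : IsMedianOrder R lo hi) {y : ℤ}
    (hy : y ∈ Y) : ∃ z ∉ Y, lo ≤ z ∧ z ≤ hi ∧ R y z := by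
  classical
  have hyIcc := Finset.mem_Icc.1 (h.mem_Icc y hy)
  have hout := hR.sub_le_two_mul_card_out (i := y) (j := hi) (by omega) (by omega) le_rfl
  have habove := h.card_above_le y hy
  obtain ⟨z, hz, hzY⟩ := exists_mem_notMem_of_card_lt_card
    (show #{x ∈ Y | y < x} < #{x ∈ Ioc y hi | R y x} by omega)
  simp only [mem_filter, mem_Ioc] at hz hzY
  exact ⟨z, fun hz' => hzY ⟨hz', hz.1.1⟩, by omega, hz.1.2, hz.2⟩

open scoped Pointwise in
theorem exists_adj_notMem (h : IsSparse Y (lo + 2) (hi - 2)) (hR : IsMedianOrder R lo hi) {y : ℤ}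
    (hy : y ∈ Y) : ∃ z ∉ Y, lo ≤ z ∧ z ≤ hi ∧ R z y := by
  have hneg := h.neg
  rw [neg_add, ← sub_eq_add_neg, neg_sub, sub_eq_neg_add 2 hi] at hneg
  obtain ⟨z, hzY, hlo, hhi, hz⟩ := hneg.exists_notMem_adj hR.neg (neg_mem_neg hy)
  exact ⟨-z, by rwa [mem_neg'] at hzY, by omega, by omega, by rwa [neg_neg] at hz⟩

end IsSparse

theorem IsMedianOrder.exists_isGrown_embedding {A : Type*} [DecidableEq A] {H : A → A → Prop}
    {X : Finset A} (hX : IsGrown H X) (hH : ∀ u v, H u v → ¬ H v u) {R : ℤ → ℤ → Prop} {lo hi : ℤ}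
    (hR : IsMedianOrder R lo hi) (hcard : 4 * (#X : ℤ) ≤ hi - lo + 4) :
    ∃ f : A → ℤ, Set.InjOn f X ∧ IsSparse (X.image f) lo hi ∧
      ∀ u ∈ X, ∀ v ∈ X, H u v → R (f u) (f v) := by
  induction hX generalizing lo hi with
  | singleton v =>
    rw [card_singleton] at hcard
    refine ⟨fun _ => lo, by simp, ?_, by simpa using fun hv => absurd hv (hH v v hv)⟩
    constructor <;> simp [filter_singleton] <;> omega
  | insert X u v _ hu hv huv huniq ih =>
    rw [card_insert_of_notMem hv] at hcard
    obtain ⟨f, hinj, hsparse, hadj⟩ :=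
      ih (hR.mono (lo' := lo + 2) (hi' := hi - 2) (by omega) (by omega)) (by omega)
    obtain ⟨z, hzX, hlo, hhi, huz, hzu⟩ : ∃ z ∉ X.image f, lo ≤ z ∧ z ≤ hi ∧
        (H u v → R (f u) z) ∧ (H v u → R z (f u)) := by
      rcases huv with huv | hvu
      · obtain ⟨z, hzX, hlo, hhi, hz⟩ := hsparse.exists_notMem_adj hR (mem_image_of_mem f hu)
        exact ⟨z, hzX, hlo, hhi, fun _ => hz, fun h => absurd h (hH _ _ huv)⟩
      · obtain ⟨z, hzX, hlo, hhi, hz⟩ := hsparse.exists_adj_notMem hR (mem_image_of_mem f hu)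
        exact ⟨z, hzX, hlo, hhi, fun h => absurd h (hH _ _ hvu), fun _ => hz⟩
    have hgv : Function.update f v z v = z := Function.update_self _ _ _
    have hgX : Set.EqOn (Function.update f v z) f X := fun w hw =>
      Function.update_of_ne (ne_of_mem_of_not_mem hw hv) _ _
    have himage : X.image (Function.update f v z) = X.image f := image_congr hgX
    refine ⟨Function.update f v z, ?_, ?_, ?_⟩
    · rw [coe_insert, Set.injOn_insert (by simpa using hv), hgv, ← coe_image, himage]
      exact ⟨hgX.injOn_iff.2 hinj, by simpa using hzX⟩
    · rw [image_insert, hgv, himage]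
      exact hsparse.insert hlo hhi
    · have hHv : ¬ H v v := fun hvv => hH v v hvv hvv
      grind

theorem exists_isGrown_embedding {A : Type*} [DecidableEq A] {H : A → A → Prop} {X : Finset A}
    (hX : IsGrown H X) (hH : ∀ u v, H u v → ¬ H v u) {R : ℤ → ℤ → Prop} {U : Finset ℤ}
    (hR : ∀ i ∈ U, ∀ j ∈ U, i ≠ j → (R i j ↔ ¬ R j i)) (hU : 4 * #X ≤ #U) :
    ∃ f : A → ℤ, Set.InjOn f X ∧ Set.MapsTo f X U ∧ ∀ u ∈ X, ∀ v ∈ X, H u v → R (f u) (f v) := by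
  have hX0 : 0 < #X := by cases hX <;> simp
  have : Nonempty U := (card_pos.1 (by omega)).to_subtype
  obtain ⟨e, he, hmedian⟩ := exists_isMedianOrder (α := U) (fun a b => R a b)
    fun a b hab => hR a a.2 b b.2 (Subtype.coe_ne_coe.2 hab)
  rw [Fintype.card_coe] at he hmedian
  obtain ⟨f, hinj, hsparse, hadj⟩ := hmedian.exists_isGrown_embedding hX hH (by omega)
  have hmaps : Set.MapsTo f X (Set.Icc 0 ((#U : ℤ) - 1)) := fun a ha =>
    coe_Icc (0 : ℤ) _ ▸ mem_coe.2 (hsparse.mem_Icc _ (mem_image_of_mem f ha))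
  exact ⟨fun a => e (f a), Subtype.val_injective.comp_injOn (he.comp hinj hmaps),
    fun a _ => (e (f a)).2, hadj⟩

end TreeEmbedding

section ForestExtension

variable {A : Type*} {H : A → A → Prop} {G : SimpleGraph A}

theorem eq_of_adj_of_isAcyclic (hacyc : G.IsAcyclic) {C : Set A} (hC : (G.induce C).Preconnected)
    {a b w : A} (ha : a ∈ C) (hb : b ∈ C) (hw : w ∉ C) (haw : G.Adj a w) (hbw : G.Adj b w) :
    a = b := by
  obtain ⟨p, hp⟩ := (hC ⟨a, ha⟩ ⟨b, hb⟩).exists_isPath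
  set q := p.map (SimpleGraph.Embedding.induce (G := G) C).toHom with hq
  have hqC : w ∉ q.support := by
    rw [hq, SimpleGraph.Walk.support_map, List.mem_map]
    rintro ⟨x, -, rfl⟩
    exact hw x.2
  have hqpath : (q.concat hbw).IsPath := (hp.map Subtype.val_injective).concat hqC hbw
  have := hacyc.subsingleton_path a w
  have heq : q.concat hbw = .cons haw .nil :=
    congrArg Subtype.val (Subsingleton.elim ⟨_, hqpath⟩ (SimpleGraph.Path.singleton haw))
  have hlength : q.length + 1 = 1 :=
    (q.length_concat hbw).symm.trans (congrArg SimpleGraph.Walk.length heq)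
  exact q.eq_of_length_eq_zero (Nat.succ.inj hlength)

variable [DecidableEq A]

theorem IsGrown.induce_connected (hG : ∀ u v, G.Adj u v ↔ H u v ∨ H v u) {C : Finset A}
    (hC : IsGrown H C) : (G.induce (C : Set A)).Connected := by
  induction hC with
  | singleton v =>
    rw [coe_singleton]
    exact .of_subsingleton
  | insert X u v _ hu _ huv _ ih =>
    have hunion : ((Insert.insert v X : Finset A) : Set A) = (X : Set A) ∪ {u, v} := by ext; grind
    rw [hunion]
    exact SimpleGraph.induce_union_connected ih.preconnected
      (SimpleGraph.induce_pair_connected_of_adj ((hG u v).2 huv)).preconnected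
      ⟨u, hu, Set.mem_insert u {v}⟩

theorem exists_isGrown_of_notMem [Finite A] (hG : ∀ u v, G.Adj u v ↔ H u v ∨ H v u)
    (hacyc : G.IsAcyclic) {X : Finset A} {c : A} (hc : c ∉ X) :
    ∃ C, IsGrown H C ∧ c ∈ C ∧ Disjoint C X ∧ ∀ v ∈ C, ∀ w, G.Adj v w → w ∈ X ∪ C := by
  obtain ⟨C, ⟨hgrown, hcC, hCX⟩, hmax⟩ :=
    (Set.toFinite {C : Finset A | IsGrown H C ∧ c ∈ C ∧ Disjoint C X}).exists_maximal
      ⟨{c}, .singleton c, mem_singleton_self c, disjoint_singleton_left.2 hc⟩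
  refine ⟨C, hgrown, hcC, hCX, fun v hv w hvw => ?_⟩
  by_contra hw
  rw [mem_union, not_or] at hw
  have hinsert : IsGrown H (insert w C) := .insert C v w hgrown hv hw.2 ((hG v w).1 hvw)
    fun u hu huw => eq_of_adj_of_isAcyclic hacyc (hgrown.induce_connected hG).preconnected hu hv
      hw.2 ((hG u w).2 huw) hvw
  exact hw.2 <| hmax ⟨hinsert, mem_insert_of_mem hcC, disjoint_insert_left.2 ⟨hw.1, hCX⟩⟩
    (subset_insert w C) (mem_insert_self w C)

/-- A stage of the extension of `f₀` from `S` to a forest: `f` agrees with `f₀` on `S`, it embeds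
`X ⊇ S`, placing the vertices outside `S` in `zone`, and the components of the forest minus `S`
lie inside or outside `X`. -/
structure IsPartialExtension (H : A → A → Prop) (R : ℤ → ℤ → Prop) (S : Finset A)
    (zone : Finset ℤ) (f₀ : A → ℤ) (X : Finset A) (f : A → ℤ) : Prop where
  subset : S ⊆ X
  mem_of_adj : ∀ u ∈ X, u ∉ S → ∀ v, H u v ∨ H v u → v ∈ X
  eqOn : ∀ s ∈ S, f s = f₀ s
  injOn : Set.InjOn f (X \ S : Finset A)
  mem_zone : ∀ v ∈ X, v ∉ S → f v ∈ zone
  map_adj : ∀ u ∈ X, ∀ v ∈ X, H u v → R (f u) (f v)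

namespace IsPartialExtension

variable {R : ℤ → ℤ → Prop} {S X C : Finset A} {zone : Finset ℤ} {f₀ f g : A → ℤ}

theorem refl (hout : ∀ s ∈ S, ∀ v, ¬ H v s) : IsPartialExtension H R S zone f₀ S f₀ where
  subset := Subset.rfl
  mem_of_adj u hu huS := absurd hu huS
  eqOn _ _ := rfl
  injOn := by simp
  mem_zone v hv hvS := absurd hv hvS
  map_adj u _ v hv huv := absurd huv (hout v hv u)

theorem union (h : IsPartialExtension H R S zone f₀ X f) (hout : ∀ s ∈ S, ∀ v, ¬ H v s)
    (hCX : Disjoint C X) (hC : ∀ v ∈ C, ∀ w, H v w ∨ H w v → w ∈ X ∪ C) {s : A} (hs : s ∈ S)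
    (hCs : ∀ v ∈ C, ∀ x ∈ X, H v x ∨ H x v → x = s) (hinj : Set.InjOn g C)
    (hmaps : Set.MapsTo g C ({z ∈ zone | R (f₀ s) z ∧ z ∉ image f (X \ S)} : Set ℤ))
    (hadj : ∀ u ∈ C, ∀ v ∈ C, H u v → R (g u) (g v)) :
    IsPartialExtension H R S zone f₀ (X ∪ C) (C.piecewise g f) := by
  have hX : ∀ v ∈ X, C.piecewise g f v = f v := fun v hv =>
    piecewise_eq_of_notMem _ _ _ (disjoint_right.1 hCX hv)
  have hC' : ∀ v ∈ C, C.piecewise g f v = g v := fun v hv => piecewise_eq_of_mem _ _ _ hv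
  have hne : ∀ w ∈ X, w ∉ S → ∀ v ∈ C, f w ≠ g v := fun w hw hwS v hv heq =>
    (hmaps hv).2.2 (heq ▸ mem_image_of_mem f (mem_sdiff.2 ⟨hw, hwS⟩))
  refine ⟨h.subset.trans subset_union_left, fun u hu huS v huv => ?_, fun t ht => ?_,
    fun a ha b hb hab => ?_, fun v hv hvS => ?_, fun u hu v hv huv => ?_⟩
  · exact (mem_union.1 hu).elim (fun hu => mem_union_left _ (h.mem_of_adj u hu huS v huv))
      fun hu => hC u hu v huv
  · rw [hX t (h.subset ht), h.eqOn t ht]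
  · have hinjX := h.injOn
    simp only [coe_sdiff, coe_union, Set.InjOn, Set.mem_sdiff, Set.mem_union, mem_coe]
      at ha hb hinjX hinj
    grind
  · rcases mem_union.1 hv with hv | hv
    · exact hX v hv ▸ h.mem_zone v hv hvS
    · exact hC' v hv ▸ (hmaps hv).1
  · rcases mem_union.1 hu with hu | hu <;> rcases mem_union.1 hv with hv | hv
    · exact hX u hu ▸ hX v hv ▸ h.map_adj u hu v hv huv
    · obtain rfl := hCs v hv u hu (.inr huv)
      rw [hX u hu, hC' v hv, h.eqOn u hs]
      exact (hmaps hv).2.1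
    · obtain rfl := hCs u hu v hv (.inl huv)
      exact absurd huv (hout v hs u)
    · exact hC' u hu ▸ hC' v hv ▸ hadj u hu v hv huv

theorem exists_adj_of_ne_univ [Fintype A] (h : IsPartialExtension H R S zone f₀ X f)
    (hG : ∀ u v, G.Adj u v ↔ H u v ∨ H v u) (hreach : ∀ v, ∃ s ∈ S, G.Reachable v s)
    (hX : X ≠ univ) : ∃ s ∈ S, ∃ c ∉ X, G.Adj c s := by
  obtain ⟨v, hv⟩ : ∃ v, v ∉ X := by simpa [eq_univ_iff_forall] using hX
  obtain ⟨s, hs, ⟨p⟩⟩ := hreach v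
  obtain ⟨d, -, hfst, hsnd⟩ := p.exists_boundary_dart {v | v ∉ X} hv (by simpa using h.subset hs)
  rw [Set.mem_ofPred_eq, not_not] at hsnd
  refine ⟨d.snd, ?_, d.fst, hfst, d.adj⟩
  by_contra hS
  exact hfst (h.mem_of_adj _ hsnd hS _ ((hG _ _).1 d.adj.symm))

theorem exists_ssubset [Fintype A] (h : IsPartialExtension H R S zone f₀ X f)
    (hG : ∀ u v, G.Adj u v ↔ H u v ∨ H v u) (hH : ∀ u v, H u v → ¬ H v u) (hacyc : G.IsAcyclic)
    (hreach : ∀ v, ∃ s ∈ S, G.Reachable v s)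
    (huniq : ∀ s ∈ S, ∀ t ∈ S, G.Reachable s t → s = t) (hout : ∀ s ∈ S, ∀ v, ¬ H v s)
    (hR : ∀ i ∈ zone, ∀ j ∈ zone, i ≠ j → (R i j ↔ ¬ R j i))
    (hdeg : ∀ s ∈ S, 5 * Fintype.card A ≤ Set.ncard {z | z ∈ zone ∧ R (f₀ s) z}) (hX : X ≠ univ) :
    ∃ Y g, X ⊂ Y ∧ IsPartialExtension H R S zone f₀ Y g := by
  classical
  obtain ⟨s, hs, c, hcX, hcs⟩ := h.exists_adj_of_ne_univ hG hreach hX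
  obtain ⟨C, hgrown, hcC, hCX, hsaturated⟩ := exists_isGrown_of_notMem hG hacyc hcX
  have hCs : ∀ v ∈ C, ∀ x ∈ X, H v x ∨ H x v → x = s := by
    intro v hv x hx hvx
    have hxS : x ∈ S := by
      by_contra hxS
      exact disjoint_left.1 hCX hv (h.mem_of_adj x hx hxS v hvx.symm)
    have hvc : G.Reachable v c := ((hgrown.induce_connected hG).preconnected ⟨v, hv⟩ ⟨c, hcC⟩).map
      (SimpleGraph.Embedding.induce _).toHom
    exact huniq x hxS s hs
      ((((hG v x).2 hvx).symm.reachable.trans hvc).trans hcs.reachable)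
  set U : Finset ℤ := {z ∈ zone | R (f₀ s) z} \ image f (X \ S) with hU
  have hUcard : 4 * #C ≤ #U := by
    have hdeg_s := hdeg s hs
    rw [show {z | z ∈ zone ∧ R (f₀ s) z} = ({z ∈ zone | R (f₀ s) z} : Finset ℤ) by simp,
      Set.ncard_coe_finset] at hdeg_s
    have : _ ≤ #U := le_card_sdiff (image f (X \ S)) {z ∈ zone | R (f₀ s) z}
    have := (card_image_le (s := X \ S) (f := f)).trans (card_le_univ _)
    have := card_le_univ C
    omega
  have hUzone : ∀ z ∈ U, z ∈ zone := fun z hz => (mem_filter.1 (mem_sdiff.1 hz).1).1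
  obtain ⟨g, hginj, hgU, hgadj⟩ := exists_isGrown_embedding hgrown hH
    (fun i hi j hj => hR i (hUzone i hi) j (hUzone j hj)) hUcard
  refine ⟨X ∪ C, C.piecewise g f, ?_, h.union hout hCX
    (fun v hv w hvw => hsaturated v hv w ((hG v w).2 hvw)) hs hCs hginj (fun v hv => ?_) hgadj⟩
  · exact ssubset_iff_of_subset subset_union_left |>.2 ⟨c, mem_union_right _ hcC, hcX⟩
  · simpa [hU, and_assoc] using hgU hv

end IsPartialExtension

theorem exists_forest_extension [Fintype A] (hG : ∀ u v, G.Adj u v ↔ H u v ∨ H v u)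
    (hH : ∀ u v, H u v → ¬ H v u) (hacyc : G.IsAcyclic) (S : Finset A)
    (hreach : ∀ v, ∃ s ∈ S, G.Reachable v s)
    (huniq : ∀ s ∈ S, ∀ t ∈ S, G.Reachable s t → s = t) (hout : ∀ s ∈ S, ∀ v, ¬ H v s)
    {R : ℤ → ℤ → Prop} (zone : Finset ℤ)
    (hR : ∀ i ∈ zone, ∀ j ∈ zone, i ≠ j → (R i j ↔ ¬ R j i)) (f₀ : A → ℤ)
    (hdeg : ∀ s ∈ S, 5 * Fintype.card A ≤ Set.ncard {z | z ∈ zone ∧ R (f₀ s) z}) :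
    ∃ f : A → ℤ, (∀ s ∈ S, f s = f₀ s) ∧ Set.InjOn f (Sᶜ : Finset A) ∧
      (∀ v, v ∉ S → f v ∈ zone) ∧ ∀ u v, H u v → R (f u) (f v) := by
  obtain ⟨X, ⟨f, hf⟩, hmax⟩ :=
    (Set.toFinite {X : Finset A | ∃ f, IsPartialExtension H R S zone f₀ X f}).exists_maximal
      ⟨S, f₀, .refl hout⟩
  obtain rfl : X = univ := by
    by_contra hX
    obtain ⟨Y, g, hXY, hg⟩ := hf.exists_ssubset hG hH hacyc hreach huniq hout hR hdeg hX
    exact hXY.not_subset (hmax ⟨g, hg⟩ hXY.subset)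
  exact ⟨f, hf.eqOn, by simpa [compl_eq_univ_sdiff] using hf.injOn,
    fun v => hf.mem_zone v (mem_univ v), fun u v => hf.map_adj u (mem_univ u) v (mem_univ v)⟩

end ForestExtension

section GreedyArborescence

variable {A : Type*} {t : A} {par : A → A} {R : ℤ → ℤ → Prop} {lo hi e : ℤ} {D : Finset A}
  {φ : A → ℤ}

/-- In the rooted tree with root `t` and parent function `par`, the node `a` has no child. The
value of `par` at the root is irrelevant. -/
def IsChildless (t : A) (par : A → A) (a : A) : Prop := ∀ c, c ≠ t → par c ≠ a

/-- A stage of the greedy embedding of the rooted tree with root `t` and parent function `par`, in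
which the positions are treated in increasing order: each receives a child of the first possible
node. The positions up to `e` have been treated, and `D` consists of the nodes placed so far. -/
structure IsGreedy (t : A) (par : A → A) (R : ℤ → ℤ → Prop) (lo e : ℤ) (D : Finset A)
    (φ : A → ℤ) : Prop where
  root_mem : t ∈ D
  root_eq : φ t = lo
  injOn : Set.InjOn φ D
  mem_Icc : ∀ a ∈ D, φ a ∈ Icc lo e
  par_adj : ∀ a ∈ D, a ≠ t → par a ∈ D ∧ φ (par a) < φ a ∧ R (φ (par a)) (φ a)
  exists_par_le : ∀ a ∈ D, ∀ c, c ≠ t → par c = a → ∀ j ∈ Ioc (φ a) e, R (φ a) j →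
    (c ∈ D → j < φ c) → ∃ b ∈ D, b ≠ t ∧ φ b = j ∧ φ (par b) ≤ φ a

namespace IsGreedy

theorem insert [DecidableEq A] (h : IsGreedy t par R lo e D φ) {c : A} (hct : c ≠ t) (hcD : c ∉ D)
    (hpar : par c ∈ D) (hR : R (φ (par c)) (e + 1))
    (hfirst : ∀ c', c' ≠ t → c' ∉ D → par c' ∈ D → R (φ (par c')) (e + 1) →
      φ (par c) ≤ φ (par c')) :
    IsGreedy t par R lo (e + 1) (insert c D) (Function.update φ c (e + 1)) := by
  have hD : ∀ b ∈ D, Function.update φ c (e + 1) b = φ b := fun b hb =>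
    Function.update_of_ne (ne_of_mem_of_not_mem hb hcD) _ _
  have hc : Function.update φ c (e + 1) c = e + 1 := Function.update_self ..
  have hle : ∀ b ∈ D, lo ≤ φ b ∧ φ b ≤ e := fun b hb => Finset.mem_Icc.1 (h.mem_Icc b hb)
  refine ⟨mem_insert_of_mem h.root_mem, (hD t h.root_mem).trans h.root_eq, ?_, ?_, ?_, ?_⟩
  · rw [coe_insert, Set.injOn_insert (by simpa using hcD), hc]
    exact ⟨Set.EqOn.injOn_iff hD |>.2 h.injOn, by grind⟩
  · grind
  · have := h.par_adj
    grind
  · refine forall_mem_insert .. |>.2 ⟨by simp, ?_⟩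
    rintro _ ha c' hc't rfl j hj hRj hc'
    rw [hD _ ha] at hj hRj ⊢
    obtain ⟨hj₁, hj₂⟩ := mem_Ioc.1 hj
    have hc'D : c' ∈ D → j < φ c' := fun hc'D => hD c' hc'D ▸ hc' (mem_insert_of_mem hc'D)
    rcases hj₂.lt_or_eq with hlt | rfl
    · obtain ⟨b, hb, hbt, hbj, hle_b⟩ :=
        h.exists_par_le _ ha c' hc't rfl j (mem_Ioc.2 ⟨hj₁, by omega⟩) hRj hc'D
      refine ⟨b, mem_insert_of_mem hb, hbt, (hD b hb).trans hbj, ?_⟩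
      rwa [hD _ (h.par_adj b hb hbt).1]
    · refine ⟨c, mem_insert_self .., hct, hc, ?_⟩
      rw [hD _ hpar]
      exact hfirst c' hc't (fun hmem => (hc'D hmem).not_ge ((hle c' hmem).2.trans (by omega))) ha
        hRj

theorem exists_succ (h : IsGreedy t par R lo e D φ) :
    ∃ D' φ', IsGreedy t par R lo (e + 1) D' φ' := by
  classical
  set candidates := {a ∈ D | R (φ a) (e + 1) ∧ ∃ c, c ≠ t ∧ c ∉ D ∧ par c = a}
  rcases candidates.eq_empty_or_nonempty with hempty | hne
  · refine ⟨D, φ, h.root_mem, h.root_eq, h.injOn, fun a ha => ?_, h.par_adj, ?_⟩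
    · exact Icc_subset_Icc_right (by omega) (h.mem_Icc a ha)
    rintro _ ha c hct rfl j hj hR hc
    rcases (mem_Ioc.1 hj).2.lt_or_eq with hlt | rfl
    · exact h.exists_par_le _ ha c hct rfl j (mem_Ioc.2 ⟨(mem_Ioc.1 hj).1, by omega⟩) hR hc
    · have hcD : c ∉ D := fun hcD => by
        have := Finset.mem_Icc.1 (h.mem_Icc c hcD)
        have := hc hcD
        omega
      exact absurd (mem_filter.2 ⟨ha, hR, c, hct, hcD, rfl⟩) (hempty ▸ notMem_empty _)
  · obtain ⟨a, ha, hmin⟩ := exists_min_image candidates φ hne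
    obtain ⟨haD, hR, c, hct, hcD, rfl⟩ := mem_filter.1 ha
    exact ⟨_, _, h.insert hct hcD haD hR fun c' hc't hc'D hpar hR' =>
      hmin _ (mem_filter.2 ⟨hpar, hR', c', hc't, hc'D, rfl⟩)⟩

end IsGreedy

theorem exists_isGreedy (t : A) (par : A → A) (R : ℤ → ℤ → Prop) (h : lo ≤ hi) :
    ∃ D φ, IsGreedy t par R lo hi D φ := by
  induction hi, h using Int.leInduction with
  | base =>
    refine ⟨{t}, fun _ => lo, mem_singleton_self t, rfl, by simp, by simp, by simp, ?_⟩
    simp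
  | succ e _ ih =>
    obtain ⟨D, φ, h⟩ := ih
    exact h.exists_succ

/-- Some child of `a` has not been placed at one of the positions up to `e`. -/
def IsOpenAt (t : A) (par : A → A) (D : Finset A) (φ : A → ℤ) (e : ℤ) (a : A) : Prop :=
  ∃ c, c ≠ t ∧ par c = a ∧ (c ∈ D → e < φ c)

namespace IsGreedy

theorem exists_isOpenAt [Finite A] (hg : IsGreedy t par R lo hi D φ) {d : A → ℕ}
    (hd : ∀ a, a ≠ t → d (par a) < d a) (hD : ∃ a, a ∉ D) (he : lo ≤ e)
    (hmiss : ∀ a ∈ D, φ a ≠ e) : ∃ a ∈ D, φ a < e ∧ IsOpenAt t par D φ e a := by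
  obtain ⟨c, hc, hmin⟩ : ∃ c, (c ∈ D → e < φ c) ∧ ∀ b, (b ∈ D → e < φ b) → d c ≤ d b :=
    Set.exists_min_image {c | c ∈ D → e < φ c} d (Set.toFinite _)
      (hD.imp fun a ha hmem => absurd hmem ha)
  have hct : c ≠ t := by
    rintro rfl
    exact (hc hg.root_mem).not_ge (hg.root_eq.trans_le he)
  have hpar : ¬ (par c ∈ D → e < φ (par c)) := fun h => (hmin _ h).not_gt (hd c hct)
  rw [Classical.not_imp, not_lt] at hpar
  exact ⟨par c, hpar.1, hpar.2.lt_of_ne (hmiss _ hpar.1), c, hct, rfl, hc⟩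

variable {a : A}

theorem sub_le_two_mul_card_early (hg : IsGreedy t par R lo hi D φ)
    (h : IsMedianOrder R lo hi) (ha : a ∈ D) (hopen : IsOpenAt t par D φ e a) (hae : φ a ≤ e)
    (hehi : e ≤ hi) : e - φ a ≤ 2 * (#{b ∈ D | φ b ∈ Ioc (φ a) e ∧ φ (par b) ≤ φ a} : ℤ) := by
  classical
  obtain ⟨c, hct, hca, hc⟩ := hopen
  have hhalf := h.sub_le_two_mul_card_out (Finset.mem_Icc.1 (hg.mem_Icc a ha)).1 hae hehi
  have hsub : {j ∈ Ioc (φ a) e | R (φ a) j} ⊆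
      image φ {b ∈ D | φ b ∈ Ioc (φ a) e ∧ φ (par b) ≤ φ a} := fun j hj => by
    obtain ⟨hj, hR⟩ := mem_filter.1 hj
    obtain ⟨b, hb, -, rfl, hle⟩ := hg.exists_par_le a ha c hct hca j
      (Ioc_subset_Ioc_right hehi hj) hR fun hcD => (mem_Ioc.1 hj).2.trans_lt (hc hcD)
    exact mem_image_of_mem φ (mem_filter.2 ⟨hb, hj, hle⟩)
  have := (card_le_card hsub).trans card_image_le
  omega

open Classical in
theorem card_inner_le (hg : IsGreedy t par R lo hi D φ) (hmiss : ∀ b ∈ D, φ b ≠ e)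
    (hlast : ∀ b ∈ D, φ b < e → IsOpenAt t par D φ e b → φ b ≤ φ a) :
    #{b ∈ D | φ b ∈ Ioc (φ a) e ∧ ¬ IsChildless t par b} ≤
      #{b ∈ D | φ b ∈ Ioc (φ a) e ∧ ¬ φ (par b) ≤ φ a} := by
  refine (card_le_card fun b hb => ?_).trans (card_image_le (f := par))
  obtain ⟨hbD, hb, hchild⟩ := mem_filter.1 hb
  obtain ⟨hab, hbe⟩ := mem_Ioc.1 hb
  simp only [IsChildless, not_forall, not_not] at hchild
  obtain ⟨c, hct, rfl⟩ := hchild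
  have hnot : ¬ IsOpenAt t par D φ e (par c) := fun hopen =>
    hab.not_ge (hlast _ hbD (hbe.lt_of_ne (hmiss _ hbD)) hopen)
  have hc : c ∈ D ∧ φ c ≤ e := by
    by_contra hc
    exact hnot ⟨c, hct, rfl, by grind⟩
  have hlt := (hg.par_adj c hc.1 hct).2.1
  exact mem_image.2 ⟨c, mem_filter.2 ⟨hc.1, mem_Ioc.2 ⟨by omega, hc.2⟩, by omega⟩, rfl⟩

open Classical in
theorem card_missed_Ioc_le (hg : IsGreedy t par R lo hi D φ) (h : IsMedianOrder R lo hi)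
    (ha : a ∈ D) (hopen : IsOpenAt t par D φ e a) (hae : φ a ≤ e) (hehi : e ≤ hi)
    (hmiss : ∀ b ∈ D, φ b ≠ e)
    (hlast : ∀ b ∈ D, φ b < e → IsOpenAt t par D φ e b → φ b ≤ φ a) :
    #(Ioc (φ a) e \ D.image φ) ≤ #{b ∈ D | φ b ∈ Ioc (φ a) e ∧ IsChildless t par b} := by
  have hearly := hg.sub_le_two_mul_card_early h ha hopen hae hehi
  have hinner := hg.card_inner_le hmiss hlast
  have hhit : #{b ∈ D | φ b ∈ Ioc (φ a) e} ≤ #(Ioc (φ a) e ∩ D.image φ) := by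
    refine card_le_card_of_injOn φ (fun b hb => ?_) (hg.injOn.mono (filter_subset _ _))
    obtain ⟨hbD, hb⟩ := mem_filter.1 hb
    exact mem_inter.2 ⟨hb, mem_image_of_mem φ hbD⟩
  have hsplit := card_sdiff_add_card_inter (Ioc (φ a) e) (D.image φ)
  have hpar := card_filter_add_card_filter_not (s := {b ∈ D | φ b ∈ Ioc (φ a) e})
    fun b => φ (par b) ≤ φ a
  have hchild := card_filter_add_card_filter_not (s := {b ∈ D | φ b ∈ Ioc (φ a) e})
    (IsChildless t par)
  rw [filter_filter, filter_filter] at hpar hchild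
  rw [Int.card_Ioc] at hsplit
  omega

open Classical in
theorem card_missed_le [Finite A] (hg : IsGreedy t par R lo hi D φ) (h : IsMedianOrder R lo hi)
    {d : A → ℕ} (hd : ∀ a, a ≠ t → d (par a) < d a) (hD : ∃ a, a ∉ D) (hehi : e ≤ hi) :
    #(Icc lo e \ D.image φ) ≤ #{b ∈ D | φ b ≤ e ∧ IsChildless t par b} := by
  induction hn : (e + 1 - lo).toNat using Nat.strong_induction_on generalizing e with
  | _ n ih =>
  rcases lt_or_ge e lo with hlt | hle
  · simp [Icc_eq_empty hlt.not_ge]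
  by_cases hmiss : ∀ b ∈ D, φ b ≠ e
  · obtain ⟨a₀, ha₀, ha₀e, hopen₀⟩ := hg.exists_isOpenAt hd hD hle hmiss
    obtain ⟨a, ha, hlast⟩ := exists_max_image {a ∈ D | φ a < e ∧ IsOpenAt t par D φ e a} φ
      ⟨a₀, mem_filter.2 ⟨ha₀, ha₀e, hopen₀⟩⟩
    obtain ⟨haD, hae, hopen⟩ := mem_filter.1 ha
    have haIcc := Finset.mem_Icc.1 (hg.mem_Icc a haD)
    have hbelow := ih _ (by omega) (by omega) rfl (e := φ a)
    have habove := hg.card_missed_Ioc_le h haD hopen hae.le hehi hmiss fun b hb hbe hopen =>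
      hlast b (mem_filter.2 ⟨hb, hbe, hopen⟩)
    have hmissed : #(Icc lo e \ D.image φ) ≤
        #(Icc lo (φ a) \ D.image φ) + #(Ioc (φ a) e \ D.image φ) := by
      refine (card_le_card fun z => ?_).trans (card_union_le _ _)
      grind
    have hleaves : #{b ∈ D | φ b ≤ φ a ∧ IsChildless t par b} +
        #{b ∈ D | φ b ∈ Ioc (φ a) e ∧ IsChildless t par b} ≤
          #{b ∈ D | φ b ≤ e ∧ IsChildless t par b} := by
      rw [← card_union_of_disjoint (disjoint_filter.2 fun b _ => by grind)]
      exact card_le_card (by grind)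
    omega
  · push Not at hmiss
    obtain ⟨b, hb, rfl⟩ := hmiss
    have hbelow := ih _ (by omega) (by omega) rfl (e := φ b - 1)
    refine (card_le_card ?_).trans (hbelow.trans (card_le_card ?_))
    · have := mem_image_of_mem φ hb
      intro z
      grind
    · exact monotone_filter_right _ fun c _ => And.imp_left fun hc => by omega

theorem mem_of_forall_isChildless [Finite A] (hg : IsGreedy t par R lo hi D φ) {d : A → ℕ}
    (hd : ∀ a, a ≠ t → d (par a) < d a) (hD : ∀ a, IsChildless t par a → a ∈ D) (a : A) :
    a ∈ D := by
  by_contra ha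
  obtain ⟨b, hb, hmax⟩ := Set.exists_max_image {b | b ∉ D} d (Set.toFinite _) ⟨a, ha⟩
  refine hb (hD b fun c hct => ?_)
  rintro rfl
  have hc : c ∉ D := fun hc => hb (hg.par_adj c hc hct).1
  exact (hmax c hc).not_gt (hd c hct)

end IsGreedy

theorem exists_isChildless [Finite A] {d : A → ℕ} (hd : ∀ a, a ≠ t → d (par a) < d a) :
    ∃ a, IsChildless t par a := by
  obtain ⟨a, -, hmax⟩ := Set.exists_max_image Set.univ d Set.finite_univ ⟨t, trivial⟩
  refine ⟨a, fun c hct => ?_⟩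
  rintro rfl
  exact (hmax c trivial).not_gt (hd c hct)

open Classical in
/-- Dross and Havet: the greedy embedding misses at most as many positions as there are leaves. -/
theorem IsMedianOrder.exists_rootedTree_embedding [Fintype A] (h : IsMedianOrder R lo hi)
    {d : A → ℕ} (hd : ∀ a, a ≠ t → d (par a) < d a)
    (hcard : Fintype.card A + #{a | IsChildless t par a} ≤ hi - lo + 2) :
    ∃ f : A → ℤ, Function.Injective f ∧ (∀ a, f a ∈ Icc lo hi) ∧ f t = lo ∧
      ∀ a, a ≠ t → R (f (par a)) (f a) := by
  have hA : 0 < Fintype.card A := Fintype.card_pos_iff.2 ⟨t⟩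
  have hleaf : 0 < #{a | IsChildless t par a} :=
    card_pos.2 ((exists_isChildless hd).imp fun a ha => by simpa using ha)
  obtain ⟨D, φ, hg⟩ := exists_isGreedy t par R (show lo ≤ hi by omega)
  have hD : ∀ a, a ∈ D := by
    by_contra! hD
    have hmissed := hg.card_missed_le h hd hD le_rfl
    have hplaced := (card_lt_univ_of_notMem hD.choose_spec).trans_le' (card_image_le (f := φ))
    have hsdiff := le_card_sdiff (D.image φ) (Icc lo hi)
    rw [Int.card_Icc] at hsdiff
    have hsub : {b ∈ D | φ b ≤ hi ∧ IsChildless t par b} ⊆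
        ({b | IsChildless t par b} : Finset A) := by grind
    have heq := eq_of_subset_of_card_le hsub (by omega)
    obtain ⟨a, ha⟩ := hD
    refine ha (hg.mem_of_forall_isChildless hd (fun b hb => ?_) a)
    exact (mem_filter.1 (heq.ge (by simpa using hb))).1
  exact ⟨φ, fun a b hab => hg.injOn (hD a) (hD b) hab, fun a => hg.mem_Icc a (hD a), hg.root_eq,
    fun a ha => (hg.par_adj a (hD a) ha).2.2⟩

end GreedyArborescence

section Arborescences

variable {V : Type*}

theorem DiPath.exists_dropLast (p : DiPath V) (hp : p.first ≠ p.last) :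
    ∃ q : DiPath V, q.first = p.first ∧ q.toSub ⊆ p.toSub ∧ p.toSub.Adj q.last p.last ∧
      q.support.length < p.support.length := by
  obtain ⟨s, hne, hnodup⟩ := p
  obtain ⟨l, v, rfl⟩ := (List.eq_nil_or_concat' s).resolve_left hne
  rcases List.eq_nil_or_concat' l with rfl | ⟨l, u, rfl⟩
  · exact absurd rfl hp
  have hprefix : l ++ [u] <+: l ++ [u] ++ [v] := List.prefix_append _ _
  refine ⟨⟨l ++ [u], by simp, hnodup.sublist hprefix.sublist⟩, ?_,
    ⟨hprefix.subset, fun a b hab => hab.trans hprefix.isInfix⟩, ⟨l, [], ?_⟩, by simp⟩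
  · exact (List.head_append_of_ne_nil (by simp)).symm
  · simp [DiPath.last]

theorem IsOrientedTree.parent_eq_of_adj [Finite V] {T : Digraph V} (hT : IsOrientedTree T) {t : V}
    {par : V → V} (hpar : ∀ v, v ≠ t → T.Adj (par v) v) {u v : V} (huv : T.Adj u v) :
    v ≠ t ∧ par v = u := by
  classical
  have := Fintype.ofFinite V
  have hadj : ∀ {a b}, T.Adj a b → s(a, b) ∈ T.toSimpleGraphInclusive.edgeFinset := by
    intro a b hab
    rw [SimpleGraph.mem_edgeFinset, SimpleGraph.mem_edgeSet]
    exact ⟨fun heq => hT.1 a b hab (heq ▸ hab), .inl hab⟩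
  have hinj : Set.InjOn (fun v => s(par v, v)) (univ.erase t : Finset V) := by
    intro a ha b hb hab
    rcases Sym2.eq_iff.1 hab with ⟨-, heq⟩ | ⟨hpa, hpb⟩
    · exact heq
    · refine absurd (hpar a (ne_of_mem_erase ha)) (hT.1 a (par a) ?_)
      rw [hpa, hpb]
      exact hpar b (ne_of_mem_erase hb)
  have hedges : (univ.erase t).image (fun v => s(par v, v)) =
      T.toSimpleGraphInclusive.edgeFinset := by
    refine eq_of_subset_of_card_le (fun e he => ?_) ?_
    · obtain ⟨a, ha, rfl⟩ := mem_image.1 he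
      exact hadj (hpar a (ne_of_mem_erase ha))
    · have := hT.2.card_edgeFinset
      rw [card_image_of_injOn hinj, card_erase_of_mem (mem_univ t), card_univ]
      omega
  obtain ⟨w, hw, hwe⟩ := mem_image.1 (hedges.ge (hadj huv))
  rcases Sym2.eq_iff.1 hwe with ⟨hpw, rfl⟩ | ⟨hpw, rfl⟩
  · exact ⟨ne_of_mem_erase hw, hpw⟩
  · exact absurd (hpw ▸ hpar w (ne_of_mem_erase hw)) (hT.1 w v huv)

namespace IsOutArborescence

variable {S : SubDigraph V} {t : V}

theorem exists_depth (h : IsOutArborescence S t) :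
    ∃ d : V → ℕ, ∀ v ∈ S.verts, v ≠ t → ∃ u, S.Adj u v ∧ d u < d v := by
  set lengths : V → Set ℕ := fun v =>
    {n | ∃ p : DiPath V, p.first = t ∧ p.last = v ∧ p.toSub ⊆ S ∧ p.support.length = n}
  refine ⟨fun v => sInf (lengths v), fun v hv hvt => ?_⟩
  obtain ⟨p, hfirst, hlast, hpS, hlength⟩ : sInf (lengths v) ∈ lengths v := by
    obtain ⟨p, hfirst, hlast, hpS⟩ := h.2.2 v hv
    exact Nat.sInf_mem ⟨_, p, hfirst, hlast, hpS, rfl⟩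
  obtain ⟨q, hqfirst, hqp, hadj, hlt⟩ :=
    p.exists_dropLast (by rw [hfirst, hlast]; exact hvt.symm)
  have hqS : q.toSub ⊆ S := ⟨subset_trans hqp.1 hpS.1, fun a b hab => hpS.2 _ _ (hqp.2 _ _ hab)⟩
  have hmem : q.support.length ∈ lengths q.last := ⟨q, hqfirst.trans hfirst, rfl, hqS, rfl⟩
  exact ⟨q.last, hpS.2 _ _ (hlast ▸ hadj), (Nat.sInf_le hmem).trans_lt (hlt.trans_eq hlength)⟩

theorem exists_parent [Finite V] (h : IsOutArborescence S t) :
    ∃ (par : S.verts → S.verts) (d : S.verts → ℕ),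
      (∀ a, a ≠ ⟨t, h.2.1⟩ → S.Adj (par a) a ∧ d (par a) < d a) ∧
      ∀ a b : S.verts, S.Adj a b → b ≠ ⟨t, h.2.1⟩ ∧ par b = a := by
  obtain ⟨d, hd⟩ := h.exists_depth
  have hpar : ∀ a : S.verts, ∃ b : S.verts, a ≠ ⟨t, h.2.1⟩ → S.Adj b a ∧ d b < d a := by
    intro a
    by_cases ha : (a : V) = t
    · exact ⟨a, fun hne => absurd (Subtype.ext ha) hne⟩
    · obtain ⟨u, hu, hlt⟩ := hd a a.2 ha
      exact ⟨⟨u, S.left_mem hu⟩, fun _ => ⟨hu, hlt⟩⟩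
  choose par hpar using hpar
  exact ⟨par, fun a => d a, hpar, fun _ _ => h.1.parent_eq_of_adj fun a ha => (hpar a ha).1⟩

end IsOutArborescence

theorem not_isChildless_root {A : Type*} [Finite A] [Nontrivial A] {t : A} {par : A → A}
    {d : A → ℕ} (hd : ∀ a, a ≠ t → d (par a) < d a) : ¬ IsChildless t par t := by
  intro ht
  obtain ⟨a, ha, hmin⟩ := Set.exists_min_image {a | a ≠ t} d (Set.toFinite _) (exists_ne t)
  exact (hmin (par a) (ht a ha)).not_gt (hd a ha)

theorem outLeaves_eq_image_isChildless {S : SubDigraph V} {t : S.verts} {par : S.verts → S.verts}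
    (hpar : ∀ a, a ≠ t → S.Adj (par a) a)
    (hadj : ∀ a b : S.verts, S.Adj a b → b ≠ t ∧ par b = a) (ht : ¬ IsChildless t par t) :
    S.outLeaves = Subtype.val '' {a | IsChildless t par a} := by
  ext v
  constructor
  · rintro ⟨hv, hout, -⟩
    refine ⟨⟨v, hv⟩, fun c hct hcv => ?_, rfl⟩
    have hc : (c : V) ∈ S.nbrs .plus v := by
      have := hpar c hct
      rwa [hcv] at this
    exact absurd hc (hout ▸ Set.notMem_empty _)
  · rintro ⟨a, ha, rfl⟩
    have hat : a ≠ t := fun hat => ht (hat ▸ ha)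
    refine ⟨a.2, Set.eq_empty_of_forall_notMem fun w hw => ?_, Set.ncard_eq_one.2 ⟨par a, ?_⟩⟩
    · obtain ⟨hwt, hwa⟩ := hadj a ⟨w, S.right_mem hw⟩ hw
      exact ha _ hwt hwa
    · refine Set.eq_singleton_iff_unique_mem.2 ⟨hpar a hat, fun w hw => ?_⟩
      exact congrArg Subtype.val (hadj ⟨w, S.left_mem hw⟩ a hw).2.symm

theorem IsOutArborescence.exists_embedding [Finite V] {S : SubDigraph V} {t : V}
    (h : IsOutArborescence S t) (hS : 2 ≤ S.order) {R : ℤ → ℤ → Prop} {lo hi : ℤ}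
    (hmedian : IsMedianOrder R lo hi) (hcard : S.order + S.outLeaves.ncard ≤ hi - lo + 2) :
    ∃ f : V → ℤ, Set.InjOn f S.verts ∧ (∀ v ∈ S.verts, f v ∈ Icc lo hi) ∧ f t = lo ∧
      ∀ u v, S.Adj u v → R (f u) (f v) := by
  classical
  have : Fintype S.verts := Fintype.ofFinite _
  obtain ⟨par, d, hpar, hadj⟩ := h.exists_parent
  have horder : S.order = Fintype.card S.verts := by
    rw [SubDigraph.order, ← Nat.card_coe_set_eq, Nat.card_eq_fintype_card]
  have : Nontrivial S.verts := Fintype.one_lt_card_iff_nontrivial.1 (by omega)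
  have hd := fun a ha => (hpar a ha).2
  rw [outLeaves_eq_image_isChildless (fun a ha => (hpar a ha).1) hadj (not_isChildless_root hd),
    Set.ncard_image_of_injective _ Subtype.val_injective, horder,
    ← coe_filter_univ, Set.ncard_coe_finset] at hcard
  obtain ⟨f, hinj, hmem, hroot, hf⟩ := hmedian.exists_rootedTree_embedding hd hcard
  have hext : ∀ v (hv : v ∈ S.verts), Function.extend Subtype.val f 0 v = f ⟨v, hv⟩ :=
    fun v hv => Subtype.val_injective.extend_apply f 0 ⟨v, hv⟩
  refine ⟨Function.extend Subtype.val f 0, fun a ha b hb hab => ?_, fun v hv => ?_, ?_,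
    fun u v huv => ?_⟩
  · rw [hext a ha, hext b hb] at hab
    exact congrArg Subtype.val (hinj hab)
  · exact hext v hv ▸ hmem _
  · rw [hext t h.2.1, hroot]
  · obtain ⟨hvt, hvu⟩ := hadj ⟨u, S.left_mem huv⟩ ⟨v, S.right_mem huv⟩ huv
    rw [hext u (S.left_mem huv), hext v (S.right_mem huv), ← hvu]
    exact hf _ hvt

/-- The reverse of `S`, which exchanges in-arborescences and out-arborescences. -/
def SubDigraph.flip (S : SubDigraph V) : SubDigraph V where
  verts := S.verts
  Adj u v := S.Adj v u
  left_mem h := S.right_mem h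
  right_mem h := S.left_mem h

theorem SubDigraph.toSimpleGraphInclusive_flip (S : SubDigraph V) :
    S.flip.coe.toSimpleGraphInclusive = S.coe.toSimpleGraphInclusive := by
  ext a b
  exact and_congr_right fun _ => or_comm

/-- The path traversed backwards. -/
def DiPath.reverse (p : DiPath V) : DiPath V where
  support := p.support.reverse
  ne_nil := by simpa using p.ne_nil
  nodup := List.nodup_reverse.2 p.nodup

theorem DiPath.toSub_reverse (p : DiPath V) : p.reverse.toSub = p.toSub.flip := by
  ext u v
  · exact List.mem_reverse
  · exact List.reverse_infix (l₁ := [v, u])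

theorem IsInArborescence.flip {S : SubDigraph V} {t : V} (h : IsInArborescence S t) :
    IsOutArborescence S.flip t := by
  obtain ⟨⟨hor, htree⟩, ht, hpath⟩ := h
  refine ⟨⟨fun u v huv => hor v u huv, S.toSimpleGraphInclusive_flip ▸ htree⟩, ht, fun v hv => ?_⟩
  obtain ⟨p, hfirst, hlast, hverts, hadj⟩ := hpath v hv
  refine ⟨p.reverse, (List.head_reverse _).trans hlast, (List.getLast_reverse _).trans hfirst, ?_⟩
  rw [p.toSub_reverse]
  exact ⟨hverts, fun a b => hadj b a⟩

theorem IsInArborescence.exists_embedding [Finite V] {S : SubDigraph V} {t : V}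
    (h : IsInArborescence S t) (hS : 2 ≤ S.order) {R : ℤ → ℤ → Prop} {lo hi : ℤ}
    (hmedian : IsMedianOrder R lo hi) (hcard : S.order + S.inLeaves.ncard ≤ hi - lo + 2) :
    ∃ f : V → ℤ, Set.InjOn f S.verts ∧ (∀ v ∈ S.verts, f v ∈ Icc lo hi) ∧ f t = hi ∧
      ∀ u v, S.Adj u v → R (f u) (f v) := by
  obtain ⟨f, hinj, hmem, hroot, hadj⟩ := h.flip.exists_embedding hS hmedian.neg
    (hcard.trans_eq (by ring))
  refine ⟨fun v => -f v, neg_injective.comp_injOn hinj, fun v hv => ?_, ?_,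
    fun u v huv => hadj v u huv⟩
  · obtain ⟨hlo, hhi⟩ := Finset.mem_Icc.1 (hmem v hv)
    exact Finset.mem_Icc.2 ⟨le_neg_of_le_neg hhi, neg_le.1 hlo⟩
  · exact neg_eq_iff_eq_neg.2 hroot

end Arborescences

section ForestsInDigraphs

variable {V : Type*}

theorem SubDigraph.adj_toSimpleGraphInclusive_iff {F : SubDigraph V} (hF : IsOriented F.coe)
    (u v : F.verts) : F.coe.toSimpleGraphInclusive.Adj u v ↔ F.Adj u v ∨ F.Adj v u := by
  refine ⟨fun h => h.2, fun h => ⟨?_, h⟩⟩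
  rintro rfl
  exact h.elim (fun h => hF _ _ h h) fun h => hF _ _ h h

theorem SubDigraph.exists_extension_out [Finite V] (F : SubDigraph V) (S : Set V)
    (hF : IsOrientedForest F.coe)
    (hcomp : ∀ c : F.coe.toSimpleGraphInclusive.ConnectedComponent,
      ∃! v : F.verts, v ∈ c.supp ∧ (v : V) ∈ S)
    (hout : ∀ v ∈ S, F.OnlyNbrs .plus v) {R : ℤ → ℤ → Prop} (zone : Finset ℤ)
    (hR : ∀ i ∈ zone, ∀ j ∈ zone, i ≠ j → (R i j ↔ ¬ R j i)) (f₀ : V → ℤ)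
    (hdeg : ∀ s ∈ S, 5 * F.order ≤ Set.ncard {z | z ∈ zone ∧ R (f₀ s) z}) :
    ∃ f : V → ℤ, Set.EqOn f f₀ S ∧ Set.InjOn f (F.verts \ S) ∧
      (∀ v ∈ F.verts \ S, f v ∈ zone) ∧ ∀ u v, F.Adj u v → R (f u) (f v) := by
  classical
  have : Fintype F.verts := Fintype.ofFinite _
  have horder : F.order = Fintype.card F.verts := by
    rw [SubDigraph.order, ← Nat.card_coe_set_eq, Nat.card_eq_fintype_card]
  have hmem : ∀ v : F.verts, v ∈ ({v | (v : V) ∈ S} : Finset F.verts) ↔ (v : V) ∈ S := by simp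
  obtain ⟨f, heq, hinj, hzone, hadj⟩ :=
    exists_forest_extension (H := fun u v : F.verts => F.Adj u v)
      (adj_toSimpleGraphInclusive_iff hF.1) (fun u v => hF.1 u v) hF.2
      ({v | (v : V) ∈ S} : Finset F.verts)
      (fun v => by
        obtain ⟨s, ⟨hs, hsS⟩, -⟩ := hcomp (F.coe.toSimpleGraphInclusive.connectedComponentMk v)
        exact ⟨s, (hmem s).2 hsS, (SimpleGraph.ConnectedComponent.exact hs).symm⟩)
      (fun s hs t ht hst =>
        (hcomp (F.coe.toSimpleGraphInclusive.connectedComponentMk t)).unique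
          ⟨SimpleGraph.ConnectedComponent.sound hst, (hmem s).1 hs⟩ ⟨rfl, (hmem t).1 ht⟩)
      (fun s hs v hvs => (hout s ((hmem s).1 hs)).subset hvs)
      zone hR (fun v => f₀ v) (fun s hs => horder ▸ hdeg s ((hmem s).1 hs))
  refine ⟨fun v => if hv : v ∈ F.verts then f ⟨v, hv⟩ else f₀ v, fun s hs => ?_, ?_, ?_,
    fun u v huv => ?_⟩
  · by_cases hsF : s ∈ F.verts
    · simpa only [hsF, dite_true] using heq ⟨s, hsF⟩ ((hmem _).2 hs)
    · simp only [hsF, dite_false]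
  · rintro a ⟨ha, haS⟩ b ⟨hb, hbS⟩ hab
    simp only [ha, hb, dite_true] at hab
    exact congrArg Subtype.val (hinj (by simpa using haS) (by simpa using hbS) hab)
  · rintro v ⟨hv, hvS⟩
    simpa only [hv, dite_true] using hzone _ (mt (hmem _).1 hvS)
  · simpa only [F.left_mem huv, F.right_mem huv, dite_true] using hadj _ _ huv

theorem SubDigraph.exists_extension_in [Finite V] (F : SubDigraph V) (S : Set V)
    (hF : IsOrientedForest F.coe)
    (hcomp : ∀ c : F.coe.toSimpleGraphInclusive.ConnectedComponent,
      ∃! v : F.verts, v ∈ c.supp ∧ (v : V) ∈ S)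
    (hin : ∀ v ∈ S, F.OnlyNbrs .minus v) {R : ℤ → ℤ → Prop} (zone : Finset ℤ)
    (hR : ∀ i ∈ zone, ∀ j ∈ zone, i ≠ j → (R i j ↔ ¬ R j i)) (f₀ : V → ℤ)
    (hdeg : ∀ s ∈ S, 5 * F.order ≤ Set.ncard {z | z ∈ zone ∧ R z (f₀ s)}) :
    ∃ f : V → ℤ, Set.EqOn f f₀ S ∧ Set.InjOn f (F.verts \ S) ∧
      (∀ v ∈ F.verts \ S, f v ∈ zone) ∧ ∀ u v, F.Adj u v → R (f u) (f v) := by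
  obtain ⟨f, heq, hinj, hzone, hadj⟩ := F.flip.exists_extension_out S (R := fun i j => R j i)
    ⟨fun u v huv hvu => hF.1 v u huv hvu, F.toSimpleGraphInclusive_flip ▸ hF.2⟩
    (F.toSimpleGraphInclusive_flip ▸ hcomp) hin zone
    (fun i hi j hj hij => hR j hj i hi hij.symm) f₀ hdeg
  exact ⟨f, heq, hinj, hzone, fun u v huv => hadj v u huv⟩

end ForestsInDigraphs

section Choice

theorem exists_eqOn_of_pairwise_disjoint {ι α β : Type*} [Nonempty β] {P : ι → Set α}
    (hP : Pairwise fun i j => Disjoint (P i) (P j)) (g : ι → α → β) :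
    ∃ f : α → β, ∀ i, Set.EqOn f (g i) (P i) := by
  have key : ∀ v, ∃ y, ∀ i, v ∈ P i → y = g i v := by
    intro v
    by_cases h : ∃ i, v ∈ P i
    · obtain ⟨i, hi⟩ := h
      refine ⟨g i v, fun j hj => ?_⟩
      rw [hP.eq (Set.not_disjoint_iff.2 ⟨v, hi, hj⟩)]
    · exact ⟨Classical.arbitrary β, fun i hi => absurd ⟨i, hi⟩ h⟩
  choose f hf using key
  exact ⟨f, fun i v hv => hf v i hv⟩

theorem exists_pairwise_disjoint_lists {ι α : Type*} [Fintype ι] {K : ℕ}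
    (Good : ι → List α → Prop) (hlen : ∀ a c, Good a c → c.length ≤ K)
    (hex : ∀ a (B : Finset α), #B ≤ Fintype.card ι * K → ∃ c, Good a c ∧ ∀ z ∈ c, z ∉ B) :
    ∃ c : ι → List α, (∀ a, Good a (c a)) ∧ Pairwise fun a b => (c a).Disjoint (c b) := by
  classical
  suffices key : ∀ s : Finset ι, ∃ c : ι → List α, (∀ a ∈ s, Good a (c a)) ∧
      (s : Set ι).Pairwise fun a b => (c a).Disjoint (c b) by
    obtain ⟨c, hgood, hdisj⟩ := key univ
    exact ⟨c, fun a => hgood a (mem_univ a), fun a b hab => hdisj (by simp) (by simp) hab⟩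
  intro s
  induction s using Finset.induction_on with
  | empty => exact ⟨fun _ => [], by simp, by simp⟩
  | insert a s ha ih =>
    obtain ⟨c, hgood, hdisj⟩ := ih
    have hB : #(s.biUnion fun b => (c b).toFinset) ≤ Fintype.card ι * K :=
      (card_biUnion_le_card_mul _ _ K fun b hb =>
        (List.toFinset_card_le _).trans (hlen b _ (hgood b hb))).trans
          (Nat.mul_le_mul_right _ (card_le_univ s))
    obtain ⟨c', hc', hc'B⟩ := hex a _ hB
    have hold : ∀ b ∈ s, Function.update c a c' b = c b := fun b hb =>
      Function.update_of_ne (ne_of_mem_of_not_mem hb ha) _ _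
    have hnew : ∀ b ∈ s, c'.Disjoint (c b) := fun b hb z hz hzb =>
      hc'B z hz (mem_biUnion.2 ⟨b, hb, List.mem_toFinset.2 hzb⟩)
    refine ⟨Function.update c a c', fun b hb => ?_, ?_⟩
    · rcases mem_insert.1 hb with rfl | hb
      · rwa [Function.update_self]
      · rw [hold b hb]
        exact hgood b hb
    · have : Std.Symm fun b d => (Function.update c a c' b).Disjoint (Function.update c a c' d) :=
        ⟨fun _ _ h => h.symm⟩
      rw [coe_insert, Set.pairwise_insert_of_symm]
      refine ⟨fun b hb d hd hbd => ?_, fun b hb _ => ?_⟩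
      · simpa only [hold b hb, hold d hd] using hdisj hb hd hbd
      · simpa only [Function.update_self, hold b hb] using hnew b hb

end Choice

section Links

/-- The arrangement of the cores along a median order: the `i`-th core, which consists of `S_{i+1}`,
occupies the interval `[a i, b i]`, and consecutive cores are far apart. Cores are counted from `0`
to `r`. -/
structure IsArrangement (lo hi : ℤ) (r : ℕ) (M : ℤ) (a b : ℕ → ℤ) : Prop where
  lo_le : lo ≤ a 0
  le_hi : b r ≤ hi
  core : ∀ i ≤ r, a i ≤ b i ∧ b i ≤ a i + 2 * M
  gap : ∀ i < r, b i + 2000 * M ≤ a (i + 1)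
  large : 100 ≤ M

variable {R : ℤ → ℤ → Prop} {lo hi : ℤ} {r : ℕ} {M : ℤ} {a b : ℕ → ℤ}

namespace IsArrangement

variable (h : IsArrangement lo hi r M a b)
include h

theorem add_le_of_lt {i j : ℕ} (hij : i < j) (hj : j ≤ r) : b i + 2000 * M ≤ a j := by
  have := h.large
  induction j with
  | zero => omega
  | succ j ih =>
    rcases Nat.lt_succ_iff_lt_or_eq.1 hij with hlt | rfl
    · have := ih hlt (by omega)
      have := h.gap j (by omega)
      have := h.core j (by omega)
      omega
    · exact h.gap i (by omega)

theorem start_mono {i j : ℕ} (hij : i ≤ j) (hj : j ≤ r) : a i ≤ a j := by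
  have := h.large
  rcases hij.eq_or_lt with rfl | hlt
  · exact le_rfl
  · have := h.add_le_of_lt hlt hj
    have := h.core i (by omega)
    omega

theorem lo_le_start {i : ℕ} (hi : i ≤ r) : lo ≤ a i :=
  h.lo_le.trans (h.start_mono (Nat.zero_le i) hi)

theorem end_le_hi {i : ℕ} (hi' : i ≤ r) : b i ≤ hi := by
  have := h.large
  have := h.le_hi
  rcases hi'.eq_or_lt with rfl | hlt
  · assumption
  · have := h.add_le_of_lt hlt le_rfl
    have := h.core r le_rfl
    omega

theorem start_succ_le {i j : ℕ} (hi' : i ≤ r) (hj : j < r) {z : ℤ} (haz : a i ≤ z)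
    (hzb : z ≤ b i) (hbz : b j < z) : a (j + 1) ≤ z := by
  have := h.large
  rcases Nat.lt_or_ge j i with hij | hij
  · exact (h.start_mono hij hi').trans haz
  · rcases hij.eq_or_lt with rfl | hlt
    · omega
    · have := h.add_le_of_lt hlt hj.le
      have := h.core j hj.le
      omega

theorem mem_gap_iff {i j : ℕ} (hi' : i < r) (hj : j < r) {z : ℤ} (hz : z ∈ Ioo (b j) (a (j + 1))) :
    z ∈ Ioo (b i) (a (i + 1)) ↔ i = j := by
  refine ⟨fun hzi => ?_, fun hij => hij ▸ hz⟩
  rw [mem_Ioo] at hz hzi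
  rcases lt_trichotomy i j with hlt | heq | hlt
  · have := h.start_mono (i := i + 1) (j := j) hlt hj.le
    have := h.core j hj.le
    omega
  · exact heq
  · have := h.start_mono (i := j + 1) (j := i) hlt hi'.le
    have := h.core i hi'.le
    omega

end IsArrangement

/-- `c` is a list of positions in the gaps between the cores, which together with the position `τ`
at its end form a directed path. It avoids `B`, keeps away from the cores and has `π i` elements in
the gap between the `i`-th and the next core. -/
structure IsRoute (R : ℤ → ℤ → Prop) (r : ℕ) (M : ℤ) (a b : ℕ → ℤ) (B : Finset ℤ) (τ : ℤ)
    (π : ℕ → ℕ) (c : List ℤ) : Prop where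
  chain : (c ++ [τ]).IsChain R
  nodup : c.Nodup
  notMem : ∀ z ∈ c, z ∉ B
  mem_gap : ∀ z ∈ c, ∃ i < r, b i + 8 * M ≤ z ∧ z ≤ a (i + 1) - 8 * M
  count : ∀ i < r, c.countP (· ∈ Ioo (b i) (a (i + 1))) = π i

namespace IsRoute

variable {B B' : Finset ℤ} {τ : ℤ} {π : ℕ → ℕ} {c : List ℤ}

theorem nil : IsRoute R r M a b B τ 0 [] :=
  ⟨by simp, by simp, by simp, by simp, by simp⟩

theorem anti (hc : IsRoute R r M a b B' τ π c) (hB : B ⊆ B') : IsRoute R r M a b B τ π c :=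
  { hc with notMem := fun z hz hzB => hc.notMem z hz (hB hzB) }

variable (h : IsArrangement lo hi r M a b)
include h

theorem cons (hc : IsRoute R r M a b B τ π c) {j : ℕ} (hj : j < r) {z : ℤ} (hzB : z ∉ B)
    (hbz : b j + 8 * M ≤ z) (hza : z ≤ a (j + 1) - 8 * M) (hzc : z ∉ c)
    (hchain : (z :: (c ++ [τ])).IsChain R) :
    IsRoute R r M a b B τ (π + Pi.single j 1) (z :: c) where
  chain := hchain
  nodup := hc.nodup.cons hzc
  notMem := List.forall_mem_cons.2 ⟨hzB, hc.notMem⟩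
  mem_gap := List.forall_mem_cons.2 ⟨⟨j, hj, hbz, hza⟩, hc.mem_gap⟩
  count i hi := by
    have hM := h.large
    have hz := h.mem_gap_iff hi hj (z := z) (mem_Ioo.2 ⟨by omega, by omega⟩)
    simp only [List.countP_cons, hc.count i hi, hz, decide_eq_true_eq, Pi.add_apply,
      Pi.single_apply]

theorem length_eq (hc : IsRoute R r M a b B τ π c) : c.length = ∑ i ∈ range r, π i := by
  have hM := h.large
  rw [← sum_congr rfl fun i hi => hc.count i (mem_range.1 hi)]
  have hgap := hc.mem_gap
  clear hc
  induction c with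
  | nil => simp
  | cons z c ih =>
    obtain ⟨⟨j, hj, hbz, hza⟩, hgap⟩ := List.forall_mem_cons.1 hgap
    have hz : ∀ i ∈ range r,
        (if z ∈ Ioo (b i) (a (i + 1)) then 1 else 0) = if i = j then 1 else 0 :=
      fun i hi => if_congr
        (h.mem_gap_iff (mem_range.1 hi) hj (mem_Ioo.2 ⟨by omega, by omega⟩)) rfl rfl
    simp only [List.countP_cons, List.length_cons, decide_eq_true_eq, sum_add_distrib,
      sum_congr rfl hz, sum_ite_eq', mem_range, hj, if_true, ih hgap]

end IsRoute

namespace IsArrangement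

variable (h : IsArrangement lo hi r M a b) (hR : IsMedianOrder R lo hi) {B : Finset ℤ}
include h hR

theorem exists_three_path_to_core {j : ℕ} (hj : j < r)
    (hB : (#(B ∩ Ioo (b j) (a (j + 1))) : ℤ) ≤ 18 * M) {w y : ℤ} (hbw : b j + 8 * M ≤ w)
    (hwb : w ≤ b j + 600 * M) (hay : a (j + 1) - 500 * M ≤ y) (hyb : y ≤ b (j + 1) + 40 * M)
    (hy : y ≤ hi) :
    ∃ p q, (w < p ∧ p ≤ a (j + 1) - 8 * M ∧ p ∉ B) ∧ (w < q ∧ q ≤ a (j + 1) - 8 * M ∧ q ∉ B) ∧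
      p ≠ q ∧ R w p ∧ R p q ∧ R q y := by
  have := h.large
  have := h.core j hj.le
  have := h.core (j + 1) hj
  have := h.gap j hj
  have := h.lo_le_start hj.le
  obtain ⟨e, hwe, hey, hea, hlen⟩ : ∃ e, w < e ∧ e ≤ y ∧ e ≤ a (j + 1) - 8 * M + 1 ∧
      42 * (18 * M) + 9 * (y - e) + 60 < e - w := by
    by_cases hya : y ≤ a (j + 1) - 8 * M + 1
    · exact ⟨y, by omega, le_rfl, hya, by omega⟩
    · exact ⟨a (j + 1) - 8 * M + 1, by omega, by omega, le_rfl, by omega⟩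
  obtain ⟨p, q, ⟨hwp, hpe, hpB⟩, ⟨hwq, hqe, hqB⟩, hpq, hRwp, hRpq, hRqy⟩ :=
    hR.exists_three_path (B ∩ Ioo (b j) (a (j + 1))) (by omega) hwe hey hy (by omega)
  have hnot : ∀ z, w < z → z < e → z ∉ B ∩ Ioo (b j) (a (j + 1)) → z ∉ B := fun z hwz hze hz hzB =>
    hz (mem_inter.2 ⟨hzB, mem_Ioo.2 ⟨by omega, by omega⟩⟩)
  exact ⟨p, q, ⟨hwp, by omega, hnot p hwp hpe hpB⟩, ⟨hwq, by omega, hnot q hwq hqe hqB⟩, hpq, hRwp,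
    hRpq, hRqy⟩

theorem exists_route_cons {j : ℕ} (hj : j < r)
    (hB : (#(B ∩ Ioo (b j) (a (j + 1))) : ℤ) ≤ 18 * M) {w y τ : ℤ} (hbw : b j + 8 * M ≤ w)
    (hwb : w ≤ b j + 600 * M) (hwB : w ∉ B) (hay : a (j + 1) - 500 * M ≤ y)
    (hyb : y ≤ b (j + 1) + 40 * M) (hy : y ≤ hi) {π : ℕ → ℕ} {c : List ℤ}
    (hc : IsRoute R r M a b B τ π c) (hhead : (c ++ [τ]).head? = some y)
    (hlarge : ∀ z ∈ c, a (j + 1) < z) :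
    ∃ c', IsRoute R r M a b B τ (π + Pi.single j 3) (w :: c') ∧ ∀ z ∈ c', w < z := by
  have := h.large
  have := h.gap j hj
  obtain ⟨p, q, ⟨hwp, hpa, hpB⟩, ⟨hwq, hqa, hqB⟩, hpq, hRwp, hRpq, hRqy⟩ :=
    h.exists_three_path_to_core hR hj hB hbw hwb hay hyb hy
  have hsmall : ∀ z ≤ a (j + 1), z ∉ c := fun z hz hzc => (hlarge z hzc).not_ge hz
  have hq := hc.cons h hj hqB (by omega) hqa (hsmall q (by omega))
    (List.isChain_cons.2 ⟨by simpa [hhead] using hRqy, hc.chain⟩)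
  have hp := hq.cons h hj hpB (by omega) hpa (List.not_mem_cons_of_ne_of_not_mem hpq
    (hsmall p (by omega))) (hq.chain.cons_cons hRpq)
  have hw := hp.cons h hj hwB hbw (by omega) (List.not_mem_cons_of_ne_of_not_mem hwp.ne
    (List.not_mem_cons_of_ne_of_not_mem hwq.ne (hsmall w (by omega)))) (hp.chain.cons_cons hRwp)
  refine ⟨p :: q :: c, ?_, ?_⟩
  · rwa [add_assoc, add_assoc, ← Pi.single_add, ← Pi.single_add] at hw
  · simp only [List.forall_mem_cons]
    exact ⟨hwp, hwq, fun z hz => by have := hlarge z hz; omega⟩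

theorem exists_route_from (hB : ∀ i < r, (#(B ∩ Ioo (b i) (a (i + 1))) : ℤ) ≤ 18 * M) {τ : ℤ}
    (n : ℕ) : ∀ (j : ℕ) (w : ℤ), j + n + 1 ≤ r → τ ≤ hi → a (j + n + 1) - 500 * M ≤ τ →
      τ ≤ b (j + n + 1) + 40 * M → b j + 8 * M ≤ w → w ≤ b j + 600 * M → w ∉ B →
      ∃ c, IsRoute R r M a b B τ (fun i => if j ≤ i ∧ i < j + n + 1 then 3 else 0) (w :: c) ∧
        ∀ z ∈ c, w < z := by
  induction n with
  | zero =>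
    intro j w hj hτ haτ hτb hbw hwb hwB
    have hπ : (fun i => if j ≤ i ∧ i < j + 0 + 1 then 3 else 0) = (0 + Pi.single j 3 : ℕ → ℕ) := by
      ext i
      simp only [zero_add, Pi.single_apply]
      exact if_congr (by omega) rfl rfl
    rw [hπ]
    exact h.exists_route_cons hR hj (hB j hj) hbw hwb hwB haτ hτb hτ .nil rfl (by simp)
  | succ n ih =>
    intro j w hj hτ haτ hτb hbw hwb hwB
    have := h.large
    have := h.core (j + 1) (by omega)
    have := h.gap (j + 1) (by omega)
    have := h.end_le_hi (i := j + 1 + 1) (by omega)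
    have := h.core (j + 1 + 1) (by omega)
    have := hB (j + 1) (by omega)
    obtain ⟨w', hw', hw'B⟩ : ∃ w' ∈ Icc (b (j + 1) + 8 * M) (b (j + 1) + 40 * M),
        w' ∉ B ∩ Ioo (b (j + 1)) (a (j + 1 + 1)) := by
      refine exists_mem_notMem_of_card_lt_card ?_
      rw [Int.card_Icc]
      omega
    rw [mem_Icc] at hw'
    have hw'B' : w' ∉ B := fun hB => hw'B (mem_inter.2 ⟨hB, mem_Ioo.2 ⟨by omega, by omega⟩⟩)
    have hadd : j + 1 + n + 1 = j + (n + 1) + 1 := by ring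
    obtain ⟨c, hc, hlarge⟩ := ih (j + 1) w' (by omega) hτ (hadd ▸ haτ) (hadd ▸ hτb) hw'.1
      (by omega) hw'B'
    have hπ : (fun i => if j ≤ i ∧ i < j + (n + 1) + 1 then 3 else 0) =
        (fun i => if j + 1 ≤ i ∧ i < j + 1 + n + 1 then 3 else 0) + Pi.single j 3 := by
      ext i
      simp only [Pi.add_apply, Pi.single_apply]
      grind
    rw [hπ]
    refine h.exists_route_cons hR (by omega) (hB j (by omega)) hbw hwb hwB (by omega) hw'.2
      (by omega) hc rfl (List.forall_mem_cons.2 ⟨by omega, fun z hz => ?_⟩)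
    have := hlarge z hz
    omega

theorem exists_route (hB : ∀ i < r, (#(B ∩ Ioo (b i) (a (i + 1))) : ℤ) ≤ 18 * M) {j j' : ℕ}
    (hjj' : j < j') (hj' : j' ≤ r) {σ τ : ℤ} (hσ : lo ≤ σ) (hσb : σ ≤ b j + 40 * M)
    (haσ : a j - 500 * M ≤ σ) (hτ : τ ≤ hi) (haτ : a j' - 500 * M ≤ τ)
    (hτb : τ ≤ b j' + 40 * M) :
    ∃ c, (σ :: (c ++ [τ])).IsChain R ∧
      IsRoute R r M a b B τ (fun i => if j ≤ i ∧ i < j' then 3 else 0) c := by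
  classical
  have := h.large
  have := h.gap j (by omega)
  have := h.core j (by omega)
  have := h.core (j + 1) (by omega)
  have := h.end_le_hi (i := j + 1) (by omega)
  have := hB j (by omega)
  obtain ⟨w, hbw, hwb, hσw, hwB⟩ : ∃ w, b j + 8 * M ≤ w ∧ w ≤ b j + 600 * M ∧ R σ w ∧
      w ∉ B ∩ Ioo (b j) (a (j + 1)) := by
    obtain ⟨s, hσs, hbs, hsb, hlen⟩ : ∃ s, σ < s ∧ b j + 8 * M ≤ s ∧ s ≤ b j + 600 * M + 1 ∧
        2 * (18 * M) + 2 * (s - 1 - σ) < b j + 600 * M - σ := by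
      by_cases hσb : σ < b j + 8 * M
      · exact ⟨b j + 8 * M, hσb, le_rfl, by omega, by omega⟩
      · exact ⟨σ + 1, by omega, by omega, by omega, by omega⟩
    have hout := hR.sub_le_card_out_Icc hσ hσs hsb (by omega)
    obtain ⟨w, hw, hwB⟩ := exists_mem_notMem_of_card_lt_card
      (s := B ∩ Ioo (b j) (a (j + 1))) (t := {y ∈ Icc s (b j + 600 * M) | R σ y}) (by omega)
    simp only [mem_filter, mem_Icc] at hw
    exact ⟨w, by omega, hw.1.2, hw.2, hwB⟩
  have hwB' : w ∉ B := fun hB => hwB (mem_inter.2 ⟨hB, mem_Ioo.2 ⟨by omega, by omega⟩⟩)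
  obtain ⟨n, rfl⟩ := Nat.exists_eq_add_of_lt hjj'
  obtain ⟨c, hc, -⟩ := h.exists_route_from hR hB n j w hj' hτ haτ hτb hbw hwb hwB'
  exact ⟨w :: c, hc.chain.cons_cons hσw, hc⟩

theorem exists_route_to_end {j : ℕ} (hj : j < r) {σ : ℤ} (haσ : a (j + 1) - 500 * M ≤ σ)
    (hσa : σ ≤ a (j + 1) - 220 * M)
    (hB : (#(B ∩ Ioo (a (j + 1) - 500 * M) (a (j + 1))) : ℤ) ≤ 2 * M) :
    ∃ c, (σ :: (c ++ [b (j + 1)])).IsChain R ∧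
      IsRoute R r M a b B (b (j + 1)) (Pi.single j 2) c := by
  have := h.large
  have := h.gap j hj
  have := h.core j hj.le
  have := h.core (j + 1) hj
  have := h.lo_le_start hj.le
  have hhi := h.end_le_hi (i := j + 1) hj
  obtain ⟨p, q, ⟨hσp, hpe, hpB⟩, ⟨hσq, hqe, hqB⟩, hpq, hRσp, hRpq, hRqb⟩ :=
    hR.exists_three_path (B ∩ Ioo (a (j + 1) - 500 * M) (a (j + 1))) (u := σ)
      (e := a (j + 1) - 8 * M + 1) (w := b (j + 1)) (by omega) (by omega) (by omega) hhi (by omega)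
  have hnot : ∀ z, σ < z → z < a (j + 1) - 8 * M + 1 →
      z ∉ B ∩ Ioo (a (j + 1) - 500 * M) (a (j + 1)) → z ∉ B := fun z hσz hze hz hzB =>
    hz (mem_inter.2 ⟨hzB, mem_Ioo.2 ⟨by omega, by omega⟩⟩)
  have hq := (IsRoute.nil (τ := b (j + 1))).cons h hj (hnot q hσq hqe hqB) (by omega) (by omega)
    List.not_mem_nil ((List.isChain_singleton _).cons_cons hRqb)
  have hp := hq.cons h hj (hnot p hσp hpe hpB) (by omega) (by omega) (by simpa using hpq)
    (hq.chain.cons_cons hRpq)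
  refine ⟨[p, q], hp.chain.cons_cons hRσp, ?_⟩
  rwa [zero_add, ← Pi.single_add] at hp

end IsArrangement

end Links

section DirectedPaths

variable {V : Type*}

theorem pair_infix_iff {l : List V} {u v : V} :
    [u, v] <:+: l ↔ ∃ i, ∃ h : i + 1 < l.length, l[i] = u ∧ l[i + 1] = v := by
  constructor
  · rintro ⟨s, t, rfl⟩
    exact ⟨s.length, by simp, by simp, by simp⟩
  · rintro ⟨i, hi, rfl, rfl⟩
    refine ⟨l.take i, l.drop (i + 2), ?_⟩
    conv_rhs => rw [← List.take_append_drop i l,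
      List.drop_eq_getElem_cons (by omega : i < l.length), List.drop_eq_getElem_cons hi]
    simp

namespace DiPath

variable (p : DiPath V)

theorem first_mem : p.first ∈ p.support := List.head_mem _

theorem last_mem : p.last ∈ p.support := List.getLast_mem _

theorem length_support_pos : 0 < p.support.length := List.length_pos_of_ne_nil p.ne_nil

theorem first_eq_getElem : p.first = p.support[0]'p.length_support_pos := List.head_eq_getElem _

theorem last_eq_getElem :
    p.last = p.support[p.support.length - 1]'(Nat.sub_one_lt_of_lt p.length_support_pos) :=
  List.getLast_eq_getElem _

theorem exists_adj_left {v : V} (hv : v ∈ p.support) (hne : v ≠ p.first) :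
    ∃ u, p.toSub.Adj u v := by
  obtain ⟨i, hi, rfl⟩ := List.getElem_of_mem hv
  cases i with
  | zero => exact absurd p.first_eq_getElem.symm hne
  | succ i => exact ⟨p.support[i], pair_infix_iff.2 ⟨i, hi, rfl, rfl⟩⟩

theorem exists_adj_right {v : V} (hv : v ∈ p.support) (hne : v ≠ p.last) :
    ∃ u, p.toSub.Adj v u := by
  obtain ⟨i, hi, rfl⟩ := List.getElem_of_mem hv
  by_cases h : i + 1 < p.support.length
  · exact ⟨p.support[i + 1], pair_infix_iff.2 ⟨i, h, rfl, rfl⟩⟩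
  · refine absurd ?_ hne
    rw [p.last_eq_getElem]
    congr 1
    omega

theorem not_adj_first (u : V) : ¬ p.toSub.Adj u p.first := by
  intro h
  obtain ⟨i, hi, -, hfirst⟩ := pair_infix_iff.1 h
  rw [p.first_eq_getElem] at hfirst
  have := p.nodup.getElem_inj_iff.1 hfirst
  omega

theorem not_adj_last (u : V) : ¬ p.toSub.Adj p.last u := by
  intro h
  obtain ⟨i, hi, hlast, -⟩ := pair_infix_iff.1 h
  rw [p.last_eq_getElem] at hlast
  have := p.nodup.getElem_inj_iff.1 hlast
  omega

theorem first_ne_last (h : 0 < p.length) : p.first ≠ p.last := by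
  intro heq
  rw [p.first_eq_getElem, p.last_eq_getElem] at heq
  have := p.nodup.getElem_inj_iff.1 heq
  simp only [length] at h
  omega

/-- The inner vertices of a directed path. -/
def inner : Set V := p.toSub.verts \ {p.first, p.last}

theorem mem_inner {v : V} : v ∈ p.inner ↔ v ∈ p.support ∧ v ≠ p.first ∧ v ≠ p.last := by
  simp [inner, toSub, not_or]

theorem ncard_verts_toSub : p.toSub.verts.ncard = p.length + 1 := by
  classical
  have hverts : p.toSub.verts = p.support.toFinset := by
    ext v
    simp [toSub]
  have := p.length_support_pos
  rw [hverts, Set.ncard_coe_finset, List.toFinset_card_of_nodup p.nodup, length]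
  omega

theorem ncard_inner (h : 0 < p.length) : p.inner.ncard = p.length - 1 := by
  have hends : {p.first, p.last} ⊆ p.toSub.verts := by
    rintro v (rfl | rfl)
    exacts [p.first_mem, p.last_mem]
  rw [inner, Set.ncard_sdiff hends, p.ncard_verts_toSub, Set.ncard_pair (p.first_ne_last h)]
  omega

theorem head?_map_support {β : Type*} (f : V → β) :
    (p.support.map f).head? = some (f p.first) := by
  rw [List.head?_map, List.head?_eq_some_head p.ne_nil]
  rfl

theorem getLast?_map_support {β : Type*} (f : V → β) :
    (p.support.map f).getLast? = some (f p.last) := by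
  rw [List.getLast?_map, List.getLast?_eq_some_getLast p.ne_nil]
  rfl

theorem exists_map_support_eq {β : Type*} {l : List β} (hl : l.length = p.support.length) :
    ∃ f : V → β, p.support.map f = l := by
  classical
  have hpos := p.length_support_pos
  refine ⟨fun v => l.getD (p.support.idxOf v) (l.head (List.ne_nil_of_length_pos (hl ▸ hpos))),
    List.ext_getElem (by simp [hl]) fun i hi _ => ?_⟩
  rw [List.length_map] at hi
  simp [p.nodup.idxOf_getElem i hi, hl, hi]

variable {p}

theorem rel_of_isChain_map {β : Type*} {R : β → β → Prop} {f : V → β}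
    (hc : (p.support.map f).IsChain R) {u v : V} (h : p.toSub.Adj u v) : R (f u) (f v) := by
  have huv := hc.infix (List.IsInfix.map f h)
  simpa using huv

theorem eqOn_verts {β : Type*} {f f' : V → β} (hinner : Set.EqOn f f' p.inner)
    (hfirst : f p.first = f' p.first) (hlast : f p.last = f' p.last) :
    Set.EqOn f f' p.toSub.verts := by
  intro v hv
  by_cases hvfirst : v = p.first
  · rwa [hvfirst]
  by_cases hvlast : v = p.last
  · rwa [hvlast]
  exact hinner (p.mem_inner.2 ⟨hv, hvfirst, hvlast⟩)

end DiPath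

theorem IsSpanningPath.exists_embedding {p : DiPath V} {R : ℤ → ℤ → Prop} {X : Finset ℤ}
    {s t : ℤ} {l : List ℤ} (hl : IsSpanningPath R X s t l) (hlen : #X = p.support.length) :
    ∃ f : V → ℤ, Set.InjOn f p.toSub.verts ∧ (∀ v ∈ p.toSub.verts, f v ∈ X) ∧
      (∀ v ∈ p.inner, f v ≠ s ∧ f v ≠ t) ∧ (∀ u v, p.toSub.Adj u v → R (f u) (f v)) ∧
      f p.first = s ∧ f p.last = t := by
  obtain ⟨f, rfl⟩ := p.exists_map_support_eq (hl.length_eq.trans hlen)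
  have hinj : Set.InjOn f p.toSub.verts := List.inj_on_of_nodup_map hl.nodup
  have hfirst : f p.first = s :=
    Option.some_injective _ ((p.head?_map_support f).symm.trans hl.head)
  have hlast : f p.last = t :=
    Option.some_injective _ ((p.getLast?_map_support f).symm.trans hl.last)
  refine ⟨f, hinj, fun v hv => (hl.mem_iff _).1 (List.mem_map_of_mem hv), fun v hv => ?_,
    fun u v huv => DiPath.rel_of_isChain_map hl.chain huv, hfirst, hlast⟩
  obtain ⟨hv, hvfirst, hvlast⟩ := p.mem_inner.1 hv
  rw [← hfirst, ← hlast]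
  exact ⟨hinj.ne hv p.first_mem hvfirst, hinj.ne hv p.last_mem hvlast⟩

end DirectedPaths

namespace GoodDecomposition

variable {V : Type*} {r : ℕ} {m : ℝ} {D T : Digraph V} (g : GoodDecomposition r m D T)

/-- The paths of the partition `P₁ S₂ P₂ ⋯ S_r P_r`, numbered from `0`: thus `seg (2 * i)` is
`P_{i+1}` and `seg (2 * i + 1)` is `S_{i+2}`. -/
def seg (t : ℕ) : DiPath V := if t % 2 = 0 then g.segP (t / 2 + 1) else g.segS (t / 2 + 2)

theorem seg_even (i : ℕ) : g.seg (2 * i) = g.segP (i + 1) := by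
  rw [seg, if_pos (by omega)]
  congr 1
  omega

theorem seg_odd (i : ℕ) : g.seg (2 * i + 1) = g.segS (i + 2) := by
  rw [seg, if_neg (by omega)]
  congr 1
  omega

theorem segP_cons_flatMap_eq (n : ℕ) :
    g.segP 1 :: (List.range' 2 n).flatMap (fun i => [g.segS i, g.segP i]) =
      (List.range (2 * n + 1)).map g.seg := by
  induction n with
  | zero => simp [seg]
  | succ n ih =>
    have hrange :
        List.range (2 * (n + 1) + 1) = List.range (2 * n + 1) ++ [2 * n + 1, 2 * (n + 1)] := by
      rw [show 2 * (n + 1) + 1 = (2 * n + 1) + 1 + 1 by ring, List.range_succ,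
        List.range_succ (n := 2 * n + 1), List.append_assoc]
      rfl
    rw [List.range'_concat, List.flatMap_append, ← List.cons_append, ih, hrange, List.map_append]
    simp only [List.map_cons, List.map_nil, List.flatMap_cons, List.flatMap_nil,
      List.append_nil, g.seg_odd n, g.seg_even (n + 1)]
    rw [one_mul, add_comm 2 n]

theorem isPathPartition_seg :
    IsPathPartition g.P ((List.range (2 * (r - 1) + 1)).map g.seg) :=
  g.segP_cons_flatMap_eq (r - 1) ▸ g.partition_P

theorem mem_P_iff (v : V) : v ∈ g.P.support ↔ ∃ t ≤ 2 * (r - 1), v ∈ (g.seg t).support := by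
  change v ∈ g.P.toSub.verts ↔ _
  rw [g.isPathPartition_seg.1]
  simp only [SubDigraph.iUnion, Set.mem_iUnion, DiPath.toSub, Set.mem_ofPred_eq]
  constructor
  · rintro ⟨i, hi⟩
    have := i.2
    simp only [List.length_map, List.length_range] at this
    exact ⟨i, by omega, by simpa using hi⟩
  · rintro ⟨t, ht, hv⟩
    exact ⟨⟨t, by simpa using (by omega)⟩, by simpa using hv⟩

theorem adj_P_iff (u v : V) :
    g.P.toSub.Adj u v ↔ ∃ t ≤ 2 * (r - 1), (g.seg t).toSub.Adj u v := by
  rw [g.isPathPartition_seg.1]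
  simp only [SubDigraph.iUnion]
  constructor
  · rintro ⟨i, hi⟩
    have := i.2
    simp only [List.length_map, List.length_range] at this
    exact ⟨i, by omega, by simpa using hi⟩
  · rintro ⟨t, ht, hv⟩
    exact ⟨⟨t, by simpa using (by omega)⟩, by simpa using hv⟩

theorem seg_last {t : ℕ} (ht : t + 1 ≤ 2 * (r - 1)) : (g.seg t).last = (g.seg (t + 1)).first := by
  simpa using g.isPathPartition_seg.2.1 ⟨t, by simpa using (by omega)⟩
    ⟨t + 1, by simpa using (by omega)⟩ rfl

theorem eq_of_mem_seg_of_mem_seg {s t : ℕ} (hst : s < t) (ht : t ≤ 2 * (r - 1)) {v : V}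
    (hs : v ∈ (g.seg s).support) (hv : v ∈ (g.seg t).support) :
    v = (g.seg s).last ∧ v = (g.seg t).first := by
  simpa using g.isPathPartition_seg.2.2 ⟨s, by simpa using (by omega)⟩
    ⟨t, by simpa using (by omega)⟩ hst v (by simpa using hs) (by simpa using hv)

theorem length_seg_even_pos (hm : 0 < m) {i : ℕ} (hi : i < r) : 0 < (g.seg (2 * i)).length := by
  rw [g.seg_even]
  have hlen := g.length_segP (i + 1) (by omega) (by omega)
  have hpos : (0 : ℝ) < (g.segP (i + 1)).length := by linarith
  exact_mod_cast hpos

theorem first_seg_zero (hr : 1 ≤ r) (hm : 0 < m) : (g.seg 0).first = g.x := by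
  by_contra hne
  rw [← g.P_first] at hne
  obtain ⟨u, hu⟩ := g.P.exists_adj_left ((g.mem_P_iff _).2 ⟨0, by omega, (g.seg 0).first_mem⟩) hne
  obtain ⟨t, ht, hut⟩ := (g.adj_P_iff _ _).1 hu
  rcases Nat.eq_zero_or_pos t with rfl | hpos
  · exact (g.seg 0).not_adj_first u hut
  · exact (g.seg 0).first_ne_last (g.length_seg_even_pos hm (i := 0) hr)
      (g.eq_of_mem_seg_of_mem_seg hpos ht (g.seg 0).first_mem ((g.seg t).toSub.right_mem hut)).1

theorem last_seg_last (hr : 1 ≤ r) (hm : 0 < m) : (g.seg (2 * (r - 1))).last = g.y := by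
  by_contra hne
  rw [← g.P_last] at hne
  obtain ⟨u, hu⟩ := g.P.exists_adj_right
    ((g.mem_P_iff _).2 ⟨_, le_rfl, (g.seg (2 * (r - 1))).last_mem⟩) hne
  obtain ⟨t, ht, hut⟩ := (g.adj_P_iff _ _).1 hu
  rcases ht.eq_or_lt with rfl | hlt
  · exact (g.seg (2 * (r - 1))).not_adj_last u hut
  · exact (g.seg (2 * (r - 1))).first_ne_last (g.length_seg_even_pos hm (i := r - 1) (by omega))
      (g.eq_of_mem_seg_of_mem_seg hlt le_rfl ((g.seg t).toSub.left_mem hut)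
        (g.seg (2 * (r - 1))).last_mem).2.symm

theorem x_notMem_seg (hr : 1 ≤ r) (hm : 0 < m) {t : ℕ} (ht : 0 < t) (ht' : t ≤ 2 * (r - 1)) :
    g.x ∉ (g.seg t).support := by
  intro h
  rw [← g.first_seg_zero hr hm] at h
  exact (g.seg 0).first_ne_last (g.length_seg_even_pos hm (i := 0) hr)
    (g.eq_of_mem_seg_of_mem_seg ht ht' (g.seg 0).first_mem h).1

theorem y_notMem_seg (hr : 1 ≤ r) (hm : 0 < m) {t : ℕ} (ht : t < 2 * (r - 1)) :
    g.y ∉ (g.seg t).support := by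
  intro h
  rw [← g.last_seg_last hr hm] at h
  exact (g.seg (2 * (r - 1))).first_ne_last (g.length_seg_even_pos hm (i := r - 1) (by omega))
    (g.eq_of_mem_seg_of_mem_seg ht le_rfl h (g.seg (2 * (r - 1))).last_mem).2.symm

theorem disjoint_inner_seg {i j : ℕ} (hij : i < j) (hj : j < r) :
    Disjoint (g.seg (2 * i)).inner (g.seg (2 * j)).inner := by
  rw [Set.disjoint_left]
  intro v hvi hvj
  rw [DiPath.mem_inner] at hvi hvj
  exact hvi.2.2 (g.eq_of_mem_seg_of_mem_seg (by omega) (by omega) hvi.1 hvj.1).1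

theorem disjoint_seg_odd (hm : 0 < m) {i j : ℕ} (hij : i < j) (hj : j + 1 < r) :
    Disjoint (g.seg (2 * i + 1)).toSub.verts (g.seg (2 * j + 1)).toSub.verts := by
  rw [Set.disjoint_left]
  intro v hvi hvj
  have hfirst : v = (g.seg (2 * (i + 1))).first :=
    (g.eq_of_mem_seg_of_mem_seg (by omega) (by omega) hvi hvj).1.trans (g.seg_last (by omega))
  have hlast : v = (g.seg (2 * (i + 1))).last :=
    (g.eq_of_mem_seg_of_mem_seg (by omega) (by omega)
      (hfirst ▸ (g.seg (2 * (i + 1))).first_mem) hvj).1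
  exact (g.seg (2 * (i + 1))).first_ne_last (g.length_seg_even_pos hm (by omega))
    (hfirst.symm.trans hlast)

/-- The vertex set of `S_{i+1}`, where `i ≤ r`. -/
def core (i : ℕ) : Set V := (g.S (i + 1)).verts

theorem core_zero : g.core 0 = g.inArb.verts := by
  rw [core, g.S_first]

theorem core_last : g.core r = g.outArb.verts := by
  rw [core, g.S_last]

theorem core_succ {i : ℕ} (hi : i + 1 < r) :
    g.core (i + 1) = (g.seg (2 * i + 1)).toSub.verts := by
  rw [core, g.S_mid (i + 1 + 1) (by omega) (by omega), g.seg_odd]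

theorem x_mem_P : g.x ∈ g.P.support := g.P_first ▸ g.P.first_mem

theorem y_mem_P : g.y ∈ g.P.support := g.P_last ▸ g.P.last_mem

theorem x_mem_core : g.x ∈ g.core 0 := g.core_zero ▸ g.isIn.2.1

theorem y_mem_core : g.y ∈ g.core r := g.core_last ▸ g.isOut.2.1

theorem core_succ_subset_P {i : ℕ} (hi : i + 1 < r) : g.core (i + 1) ⊆ g.P.toSub.verts := by
  rw [g.core_succ hi]
  exact fun v hv => (g.mem_P_iff v).2 ⟨_, by omega, hv⟩

theorem eq_x_of_mem_core_zero {v : V} (h : v ∈ g.core 0) (hP : v ∈ g.P.support) : v = g.x := by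
  by_contra hne
  have hdisj : Disjoint (g.part .inArb) (g.part .path) := g.part_disjoint (by simp)
  rw [g.part_inArb, g.part_path] at hdisj
  exact Set.disjoint_left.1 hdisj ⟨g.core_zero ▸ h, hne⟩ hP

theorem eq_y_of_mem_core_last {v : V} (h : v ∈ g.core r) (hP : v ∈ g.P.support) : v = g.y := by
  by_contra hne
  have hdisj : Disjoint (g.part .outArb) (g.part .path) := g.part_disjoint (by simp)
  rw [g.part_outArb, g.part_path] at hdisj
  exact Set.disjoint_left.1 hdisj ⟨g.core_last ▸ h, hne⟩ hP

theorem first_seg_mem_core (hr : 1 ≤ r) (hm : 0 < m) {i : ℕ} (hi : i < r) :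
    (g.seg (2 * i)).first ∈ g.core i := by
  cases i with
  | zero =>
    rw [Nat.mul_zero, g.first_seg_zero hr hm]
    exact g.x_mem_core
  | succ i =>
    rw [g.core_succ hi, show 2 * (i + 1) = 2 * i + 1 + 1 by ring, ← g.seg_last (by omega)]
    exact (g.seg (2 * i + 1)).last_mem

theorem last_seg_mem_core (hr : 1 ≤ r) (hm : 0 < m) {i : ℕ} (hi : i < r) :
    (g.seg (2 * i)).last ∈ g.core (i + 1) := by
  by_cases hi' : i + 1 < r
  · rw [g.core_succ hi', g.seg_last (by omega)]
    exact (g.seg (2 * i + 1)).first_mem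
  · obtain rfl : r = i + 1 := by omega
    have hy := g.last_seg_last hr hm
    rw [Nat.add_sub_cancel] at hy
    exact hy ▸ g.y_mem_core

theorem disjoint_core_zero_core_last : Disjoint (g.core 0) (g.core r) := by
  rw [Set.disjoint_left]
  intro v hin hout
  by_cases hvx : v = g.x
  · exact g.x_ne_y (hvx.symm.trans (g.eq_y_of_mem_core_last hout (hvx ▸ g.x_mem_P)))
  by_cases hvy : v = g.y
  · exact hvx (g.eq_x_of_mem_core_zero hin (hvy ▸ g.y_mem_P))
  have hdisj : Disjoint (g.part .inArb) (g.part .outArb) := g.part_disjoint (by simp)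
  rw [g.part_inArb, g.part_outArb] at hdisj
  exact Set.disjoint_left.1 hdisj ⟨g.core_zero ▸ hin, hvx⟩ ⟨g.core_last ▸ hout, hvy⟩

theorem disjoint_core (hr : 1 ≤ r) (hm : 0 < m) {i j : ℕ} (hij : i < j) (hj : j ≤ r) :
    Disjoint (g.core i) (g.core j) := by
  obtain ⟨j, rfl⟩ := Nat.exists_eq_succ_of_ne_zero (Nat.ne_zero_of_lt hij)
  rcases i with _ | i <;> rcases hj.eq_or_lt with hjr | hjr
  · rw [hjr]
    exact g.disjoint_core_zero_core_last
  · refine Set.disjoint_left.2 fun v hvi hvj => ?_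
    rw [g.eq_x_of_mem_core_zero hvi (g.core_succ_subset_P hjr hvj), g.core_succ hjr] at hvj
    exact g.x_notMem_seg hr hm (by omega) (by omega) hvj
  · refine Set.disjoint_left.2 fun v hvi hvj => ?_
    rw [hjr] at hvj
    rw [g.eq_y_of_mem_core_last hvj (g.core_succ_subset_P (by omega) hvi),
      g.core_succ (by omega)] at hvi
    exact g.y_notMem_seg hr hm (by omega) hvi
  · rw [g.core_succ (by omega), g.core_succ hjr]
    exact g.disjoint_seg_odd hm (by omega) hjr

theorem disjoint_core_inner_seg (hr : 1 ≤ r) (hm : 0 < m) {i j : ℕ} (hi : i ≤ r) (hj : j < r) :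
    Disjoint (g.core i) (g.seg (2 * j)).inner := by
  rw [Set.disjoint_left]
  intro v hvi hvj
  obtain ⟨hv, hvfirst, hvlast⟩ := (DiPath.mem_inner _).1 hvj
  have hvP : v ∈ g.P.support := (g.mem_P_iff v).2 ⟨2 * j, by omega, hv⟩
  cases i with
  | zero =>
    have hvx := g.eq_x_of_mem_core_zero hvi hvP
    rcases Nat.eq_zero_or_pos j with rfl | hpos
    · exact hvfirst (hvx.trans (g.first_seg_zero hr hm).symm)
    · exact g.x_notMem_seg hr hm (by omega) (by omega) (hvx ▸ hv)
  | succ i =>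
    rcases hi.lt_or_eq with hir | rfl
    · rw [g.core_succ hir] at hvi
      rcases lt_or_gt_of_ne (show 2 * i + 1 ≠ 2 * j by omega) with h | h
      · exact hvfirst (g.eq_of_mem_seg_of_mem_seg h (by omega) hvi hv).2
      · exact hvlast (g.eq_of_mem_seg_of_mem_seg h (by omega) hv hvi).1
    · have hvy := g.eq_y_of_mem_core_last hvi hvP
      rcases (Nat.le_of_lt_succ hj).lt_or_eq with h | rfl
      · exact g.y_notMem_seg hr hm (by omega) (hvy ▸ hv)
      · exact hvlast (hvy.trans (g.last_seg_last hr hm).symm)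

theorem verts_F_subset_of_forall_not_adj (d : Sign) {i : ℕ} (hi : 1 ≤ i) (hi' : i ≤ r + 1)
    (h : ∀ u v, ¬ (g.F d i).Adj u v) : (g.F d i).verts ⊆ (g.S i).verts := by
  intro v hv
  obtain ⟨s, ⟨hsv, hsS⟩, -⟩ := g.component_F d i hi hi'
    ((g.F d i).coe.toSimpleGraphInclusive.connectedComponentMk ⟨v, hv⟩)
  have hbot : (g.F d i).coe.toSimpleGraphInclusive = ⊥ := by
    ext u w
    simp only [Digraph.toSimpleGraphInclusive, SimpleGraph.fromRel_adj, SimpleGraph.bot_adj,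
      iff_false]
    rintro ⟨-, huw | huw⟩ <;> exact h _ _ huw
  rw [SimpleGraph.ConnectedComponent.mem_supp_iff, SimpleGraph.ConnectedComponent.eq, hbot,
    SimpleGraph.reachable_bot] at hsv
  rwa [hsv] at hsS

/-- The vertices of `F_{i+1}^+` outside `S_{i+1}`. -/
def outPart (i : ℕ) : Set V := (g.F .plus (i + 1)).verts \ (g.S (i + 1)).verts

/-- The vertices of `F_{i+2}^-` outside `S_{i+2}`. -/
def inPart (i : ℕ) : Set V := (g.F .minus (i + 2)).verts \ (g.S (i + 2)).verts

/-- Indices of the pieces into which the vertex set is cut for the embedding: the cores and the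
interiors of the paths `P_{i+1}` in the first summand, the sets `outPart i` and `inPart i` and the
interiors of the links in the second. -/
abbrev PieceIndex (r l : ℕ) : Type := (Fin (r + 1) ⊕ Fin r) ⊕ (Fin r ⊕ Fin r ⊕ Fin l)

/-- The pieces of the vertex set. Compared with `part`, the vertices on the spine
`S₁ ∪ P ∪ S_{r+1}` are distributed over the cores and the interiors of the `P_{i+1}`, and the
empty parts belonging to `F₁⁻` and `F_{r+1}⁺` are left out. -/
def piece : PieceIndex r g.l → Set V :=
  Sum.elim (Sum.elim (fun i => g.core i) (fun i => (g.seg (2 * i)).inner))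
    (Sum.elim (fun i => g.outPart i) (Sum.elim (fun i => g.inPart i) (fun j => (g.Q j).inner)))

/-- The index in the vertex partition of the good decomposition of a piece off the spine. -/
def partIndex : Fin r ⊕ Fin r ⊕ Fin g.l → PartIndex r g.l :=
  Sum.elim (fun i => .forest .plus (i + 1) ⟨by omega, by omega⟩)
    (Sum.elim (fun i => .forest .minus (i + 2) ⟨by omega, by omega⟩) (fun j => .link j))

theorem partIndex_injective : Function.Injective g.partIndex := by
  rintro (i | i | i) (j | j | j) h <;> simp [partIndex] at h <;> simp [Fin.ext_iff, h]

theorem piece_inr (s : Fin r ⊕ Fin r ⊕ Fin g.l) : g.piece (.inr s) = g.part (g.partIndex s) := by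
  rcases s with i | i | i
  · exact (g.part_forest _ _ _).symm
  · exact (g.part_forest _ _ _).symm
  · exact (g.part_link i).symm

theorem core_subset {i : ℕ} (hi : i ≤ r) :
    g.core i ⊆ g.part .path ∪ g.part .inArb ∪ g.part .outArb := by
  rw [g.part_path, g.part_inArb, g.part_outArb]
  intro v hv
  by_cases hP : v ∈ g.P.support
  · exact Or.inl (Or.inl hP)
  rcases hi.lt_or_eq with hir | rfl
  · cases i with
    | zero => exact Or.inl (Or.inr ⟨g.core_zero ▸ hv, fun hvx => hP (hvx ▸ g.x_mem_P)⟩)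
    | succ i => exact absurd (g.core_succ_subset_P hir hv) hP
  · exact Or.inr ⟨g.core_last ▸ hv, fun hvy => hP (hvy ▸ g.y_mem_P)⟩

theorem piece_inl_subset (s : Fin (r + 1) ⊕ Fin r) :
    g.piece (.inl s) ⊆ g.part .path ∪ g.part .inArb ∪ g.part .outArb := by
  rcases s with ⟨i, hi⟩ | ⟨i, hi⟩
  · exact g.core_subset (by omega)
  · intro v hv
    rw [g.part_path]
    exact Or.inl (Or.inl ((g.mem_P_iff v).2 ⟨2 * i, by omega, ((DiPath.mem_inner _).1 hv).1⟩))

theorem disjoint_piece_inl_inr (s : Fin (r + 1) ⊕ Fin r) (t : Fin r ⊕ Fin r ⊕ Fin g.l) :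
    Disjoint (g.piece (.inl s)) (g.piece (.inr t)) := by
  rw [g.piece_inr]
  refine Set.disjoint_of_subset_left (g.piece_inl_subset s) ?_
  rw [Set.disjoint_union_left, Set.disjoint_union_left]
  refine ⟨⟨?_, ?_⟩, ?_⟩ <;> apply g.part_disjoint <;> rcases t with t | t | t <;>
    simp [partIndex]

theorem pairwise_disjoint_piece (hr : 1 ≤ r) (hm : 0 < m) :
    Pairwise fun s t => Disjoint (g.piece s) (g.piece t) := by
  rintro ((⟨i, hi⟩ | ⟨i, hi⟩) | s) ((⟨j, hj⟩ | ⟨j, hj⟩) | t) hst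
  · rcases lt_or_gt_of_ne (show i ≠ j by rintro rfl; exact hst rfl) with h | h
    · exact g.disjoint_core hr hm h (by omega)
    · exact (g.disjoint_core hr hm h (by omega)).symm
  · exact g.disjoint_core_inner_seg hr hm (by omega) hj
  · exact g.disjoint_piece_inl_inr _ _
  · exact (g.disjoint_core_inner_seg hr hm (by omega) hi).symm
  · rcases lt_or_gt_of_ne (show i ≠ j by rintro rfl; exact hst rfl) with h | h
    · exact g.disjoint_inner_seg h hj
    · exact (g.disjoint_inner_seg h hi).symm
  · exact g.disjoint_piece_inl_inr _ _
  · exact (g.disjoint_piece_inl_inr _ _).symm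
  · exact (g.disjoint_piece_inl_inr _ _).symm
  · rw [g.piece_inr, g.piece_inr]
    exact g.part_disjoint fun h => hst (by rw [g.partIndex_injective h])

theorem exists_mem_piece_of_mem_P (hr : 1 ≤ r) (hm : 0 < m) {v : V} (hv : v ∈ g.P.support) :
    ∃ s, v ∈ g.piece s := by
  obtain ⟨t, ht, hvt⟩ := (g.mem_P_iff v).1 hv
  obtain ⟨i, rfl | rfl⟩ : ∃ i, t = 2 * i ∨ t = 2 * i + 1 := ⟨t / 2, by omega⟩
  · by_cases hfirst : v = (g.seg (2 * i)).first
    · exact ⟨.inl (.inl ⟨i, by omega⟩), hfirst ▸ g.first_seg_mem_core hr hm (by omega)⟩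
    by_cases hlast : v = (g.seg (2 * i)).last
    · exact ⟨.inl (.inl ⟨i + 1, by omega⟩), hlast ▸ g.last_seg_mem_core hr hm (by omega)⟩
    exact ⟨.inl (.inr ⟨i, by omega⟩), (DiPath.mem_inner _).2 ⟨hvt, hfirst, hlast⟩⟩
  · refine ⟨.inl (.inl ⟨i + 1, by omega⟩), ?_⟩
    change v ∈ g.core (i + 1)
    rwa [g.core_succ (by omega)]

theorem exists_mem_piece_of_mem_forest {d : Sign} {i : ℕ} (hi : 1 ≤ i) (hi' : i ≤ r + 1) {v : V}
    (hv : v ∈ (g.F d i).verts) (hvS : v ∉ (g.S i).verts) : ∃ s, v ∈ g.piece s := by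
  cases d with
  | plus =>
    rcases hi'.lt_or_eq with hir | rfl
    · obtain ⟨i, rfl⟩ := Nat.exists_eq_add_of_le' hi
      exact ⟨.inr (.inl ⟨i, by omega⟩), hv, hvS⟩
    · exact absurd (g.verts_F_subset_of_forall_not_adj .plus hi le_rfl g.F_last hv) hvS
  | minus =>
    rcases hi.lt_or_eq with hi2 | rfl
    · obtain ⟨i, rfl⟩ := Nat.exists_eq_add_of_le' hi2
      exact ⟨.inr (.inr (.inl ⟨i, by omega⟩)), hv, hvS⟩
    · exact absurd (g.verts_F_subset_of_forall_not_adj .minus le_rfl hi' g.F_first hv) hvS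

theorem exists_mem_piece (hr : 1 ≤ r) (hm : 0 < m) (v : V) : ∃ s, v ∈ g.piece s := by
  have hv : v ∈ ⋃ k, g.part k := g.part_cover ▸ Set.mem_univ v
  obtain ⟨k, hk⟩ := Set.mem_iUnion.1 hv
  rcases k with _ | ⟨d, i, hi⟩ | _ | _ | j
  · rw [g.part_path] at hk
    exact g.exists_mem_piece_of_mem_P hr hm hk
  · rw [g.part_forest] at hk
    exact g.exists_mem_piece_of_mem_forest hi.1 hi.2 hk.1 hk.2
  · rw [g.part_inArb, ← g.core_zero] at hk
    exact ⟨.inl (.inl ⟨0, by omega⟩), hk.1⟩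
  · rw [g.part_outArb, ← g.core_last] at hk
    exact ⟨.inl (.inl ⟨r, by omega⟩), hk.1⟩
  · rw [g.part_link] at hk
    exact ⟨.inr (.inr (.inr j)), hk⟩

theorem card_eq_sum_ncard [Fintype V] (hr : 1 ≤ r) (hm : 0 < m) :
    Fintype.card V = ∑ i ∈ range (r + 1), (g.core i).ncard +
      ∑ i ∈ range r, ((g.seg (2 * i)).inner.ncard + (g.outPart i).ncard + (g.inPart i).ncard) +
      ∑ j, (g.Q j).inner.ncard := by
  classical
  have hunion : (univ : Finset V) = univ.biUnion fun s => (g.piece s).toFinset := by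
    ext v
    simpa using g.exists_mem_piece hr hm v
  have hsum : Fintype.card V = ∑ s, (g.piece s).ncard := by
    rw [← card_univ, hunion, card_biUnion fun s _ t _ hst =>
      Set.disjoint_toFinset.2 (g.pairwise_disjoint_piece hr hm hst)]
    exact sum_congr rfl fun s _ => (Set.ncard_eq_toFinset_card' _).symm
  rw [hsum, Fintype.sum_sum_type, Fintype.sum_sum_type, Fintype.sum_sum_type,
    Fintype.sum_sum_type, sum_add_distrib, sum_add_distrib, ← Fin.sum_univ_eq_sum_range,
    ← Fin.sum_univ_eq_sum_range, ← Fin.sum_univ_eq_sum_range, ← Fin.sum_univ_eq_sum_range]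
  simp only [piece, Sum.elim_inl, Sum.elim_inr]
  ring

theorem adj_cases (hr : 1 ≤ r) {u v : V} (h : D.Adj u v) :
    (∃ i ≤ r, (g.S (i + 1)).Adj u v) ∨ (∃ i < r, (g.seg (2 * i)).toSub.Adj u v) ∨
    (∃ i < r, (g.F .plus (i + 1)).Adj u v) ∨ (∃ i < r, (g.F .minus (i + 2)).Adj u v) ∨
    ∃ j, (g.Q j).toSub.Adj u v := by
  have hD : (SubDigraph.ofDigraph D).Adj u v := h
  rw [g.D_eq] at hD
  rcases hD with (((hin | hP) | hout) | ⟨⟨i, hi, hi'⟩, hminus | hplus⟩) | hQ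
  · exact Or.inl ⟨0, by omega, g.S_first ▸ hin⟩
  · obtain ⟨t, ht, hseg⟩ := (g.adj_P_iff u v).1 hP
    obtain ⟨i, rfl | rfl⟩ : ∃ i, t = 2 * i ∨ t = 2 * i + 1 := ⟨t / 2, by omega⟩
    · exact Or.inr (Or.inl ⟨i, by omega, hseg⟩)
    · refine Or.inl ⟨i + 1, by omega, ?_⟩
      rwa [g.S_mid _ (by omega) (by omega), ← g.seg_odd]
  · exact Or.inl ⟨r, le_rfl, g.S_last ▸ hout⟩
  · rcases hi.lt_or_eq with hi2 | rfl
    · obtain ⟨i, rfl⟩ := Nat.exists_eq_add_of_le' hi2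
      exact Or.inr (Or.inr (Or.inr (Or.inl ⟨i, by omega, hminus⟩)))
    · exact absurd hminus (g.F_first u v)
  · rcases hi'.lt_or_eq with hir | rfl
    · obtain ⟨i, rfl⟩ := Nat.exists_eq_add_of_le' hi
      exact Or.inr (Or.inr (Or.inl ⟨i, by omega, hplus⟩))
    · exact absurd hplus (g.F_last u v)
  · exact Or.inr (Or.inr (Or.inr (Or.inr hQ)))

end GoodDecomposition

namespace GoodDecomposition

variable {V : Type*} {r : ℕ} {m : ℝ} {D T : Digraph V} (g : GoodDecomposition r m D T)

/-- `π i` is the number of inner vertices of the link `Q e` to be placed between the `i`-th and the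
`(i + 1)`-st core: three in every gap between the cores of its ends for a link of type (i) of the
definition, and two in the gap before its last vertex for a link of type (ii). -/
def IsProfile (e : Fin g.l) (π : ℕ → ℕ) : Prop :=
  (∃ j j', j < j' ∧ j' ≤ r ∧
    (g.Q e).first ∈ (g.F .minus (j + 1)).verts ∪ (g.F .plus (j + 1)).verts ∧
    (g.Q e).last ∈ (g.F .minus (j' + 1)).verts ∪ (g.F .plus (j' + 1)).verts ∧
    (g.Q e).length = 3 * (j' - j) + 1 ∧ π = fun i => if j ≤ i ∧ i < j' then 3 else 0) ∨
  (∃ j, j + 1 < r ∧ (g.Q e).first ∈ g.inPart j ∧ (g.Q e).last = (g.seg (2 * j + 1)).last ∧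
    (g.Q e).length = 3 ∧ π = Pi.single j 2)

theorem exists_isProfile (e : Fin g.l) : ∃ π, g.IsProfile e π := by
  rcases g.link_Q e with ⟨j, j', hj, hjj', hj', hfirst, hlast, hlen⟩ |
    ⟨j, hj, hjr, hfirst, hlast, hlen⟩
  · obtain ⟨j, rfl⟩ := Nat.exists_eq_add_of_le' hj
    obtain ⟨j', rfl⟩ := Nat.exists_eq_add_of_le' (hj.trans hjj'.le)
    exact ⟨_, Or.inl ⟨j, j', by omega, by omega, hfirst, hlast, by omega, rfl⟩⟩
  · obtain ⟨j, rfl⟩ := Nat.exists_eq_add_of_le' hj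
    exact ⟨_, Or.inr ⟨j, by omega, hfirst, by rwa [g.seg_odd], hlen, rfl⟩⟩

variable {g}

namespace IsProfile

variable {e : Fin g.l} {π : ℕ → ℕ} (h : g.IsProfile e π)
include h

theorem length_pos : 0 < (g.Q e).length := by
  rcases h with ⟨j, j', -, -, -, -, hlen, -⟩ | ⟨j, -, -, -, hlen, -⟩ <;> omega

theorem length_le (hr : 1 ≤ r) : (g.Q e).length ≤ 3 * r + 1 := by
  rcases h with ⟨j, j', -, hj', -, -, hlen, -⟩ | ⟨j, -, -, -, hlen, -⟩ <;> omega

theorem sum_eq_ncard_inner : ∑ i ∈ range r, π i = (g.Q e).inner.ncard := by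
  rw [(g.Q e).ncard_inner h.length_pos]
  rcases h with ⟨j, j', -, hj', -, -, hlen, rfl⟩ | ⟨j, hj, -, -, hlen, rfl⟩
  · have hfilter : {i ∈ range r | j ≤ i ∧ i < j'} = Ico j j' := by grind
    rw [← sum_filter, hfilter, sum_const, Nat.card_Ico, hlen, smul_eq_mul]
    omega
  · rw [sum_pi_single', if_pos (mem_range.2 (by omega)), hlen]

end IsProfile

variable (g) in
/-- The intervals `[a i, b i]` and the gaps between them have the lengths needed to place the
pieces of the decomposition: `[a i, b i]` receives the `i`-th core, and the gap following it the
interior of `P_{i+1}`, the forest vertices attached to its two ends, and the inner vertices which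
the links have there. -/
structure Fits (lo hi : ℤ) (M : ℕ) (a b : ℕ → ℤ) (prof : Fin g.l → ℕ → ℕ) : Prop where
  arrangement : IsArrangement lo hi r M a b
  order_le : ∀ d i, 1 ≤ i → i ≤ r + 1 → (g.F d i).order ≤ M
  sq_le : 6 * r * r ≤ M
  profile : ∀ e, g.IsProfile e (prof e)
  first : b 0 - a 0 + 1 = g.inArb.order + g.inArb.inLeaves.ncard - 1
  last : b r - a r + 1 = g.outArb.order + g.outArb.outLeaves.ncard - 1
  mid : ∀ i, i + 1 < r → b (i + 1) - a (i + 1) + 1 = (g.core (i + 1)).ncard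
  gap : ∀ i < r, a (i + 1) - b i - 1 = (g.seg (2 * i)).inner.ncard + (g.outPart i).ncard +
    (g.inPart i).ncard + ∑ e, prof e i

variable (g) in
/-- `f` embeds `S_{i+1}` into the interval `[a i, b i]` in such a way that the ends of `P_i` and
`P_{i+1}` which lie on it are placed at `a i` and `b i`. -/
structure IsCoreEmbedding (R : ℤ → ℤ → Prop) (a b : ℕ → ℤ) (i : ℕ) (f : V → ℤ) : Prop where
  injOn : Set.InjOn f (g.core i)
  mem_Icc : ∀ v ∈ g.core i, f v ∈ Icc (a i) (b i)
  adj : ∀ u v, (g.S (i + 1)).Adj u v → R (f u) (f v)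
  first : i < r → f (g.seg (2 * i)).first = b i
  last : ∀ j, i = j + 1 → f (g.seg (2 * j)).last = a i

variable {R : ℤ → ℤ → Prop} {lo hi : ℤ} {M : ℕ} {a b : ℕ → ℤ} {prof : Fin g.l → ℕ → ℕ}
  {f f' : V → ℤ} {i : ℕ}

theorem IsCoreEmbedding.congr (h : g.IsCoreEmbedding R a b i f) (hff' : Set.EqOn f' f (g.core i))
    (hr : 1 ≤ r) (hm : 0 < m) (hi : i ≤ r) : g.IsCoreEmbedding R a b i f' where
  injOn := h.injOn.congr hff'.symm
  mem_Icc v hv := hff' hv ▸ h.mem_Icc v hv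
  adj u v huv := by
    rw [hff' ((g.S (i + 1)).left_mem huv), hff' ((g.S (i + 1)).right_mem huv)]
    exact h.adj u v huv
  first hir := (hff' (g.first_seg_mem_core hr hm hir)).trans (h.first hir)
  last j hij := by
    subst hij
    exact (hff' (g.last_seg_mem_core hr hm hi)).trans (h.last j rfl)

namespace Fits

variable [Finite V] (h : g.Fits lo hi M a b prof)
include h

theorem ncard_outPart_le (hi : i < r) : (g.outPart i).ncard ≤ M :=
  (Set.ncard_le_ncard Set.sdiff_subset).trans (h.order_le .plus (i + 1) (by omega) (by omega))

theorem ncard_inPart_le (hi : i < r) : (g.inPart i).ncard ≤ M :=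
  (Set.ncard_le_ncard Set.sdiff_subset).trans (h.order_le .minus (i + 2) (by omega) (by omega))

theorem exists_isCoreEmbedding_zero (hmedian : IsMedianOrder R (a 0) (b 0)) (hr : 1 ≤ r)
    (hm : 0 < m) : ∃ f, g.IsCoreEmbedding R a b 0 f := by
  have hfirst := h.first
  obtain ⟨f, hinj, hmem, hroot, hadj⟩ :=
    g.isIn.exists_embedding g.two_le_inArb hmedian (by omega)
  rw [← g.core_zero] at hinj hmem
  refine ⟨f, hinj, hmem, ?_, fun _ => ?_, fun j hj => by omega⟩
  · rwa [g.S_first]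
  · rw [Nat.mul_zero, g.first_seg_zero hr hm, hroot]

theorem exists_isCoreEmbedding_last (hmedian : IsMedianOrder R (a r) (b r)) (hr : 1 ≤ r)
    (hm : 0 < m) : ∃ f, g.IsCoreEmbedding R a b r f := by
  have hlast := h.last
  obtain ⟨f, hinj, hmem, hroot, hadj⟩ :=
    g.isOut.exists_embedding g.two_le_outArb hmedian (by omega)
  rw [← g.core_last] at hinj hmem
  refine ⟨f, hinj, hmem, ?_, fun hrr => absurd hrr (lt_irrefl r), fun j hj => ?_⟩
  · rwa [g.S_last]
  · rw [show j = r - 1 by omega, g.last_seg_last hr hm, hroot]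

omit [Finite V] in
theorem exists_isCoreEmbedding_succ (hir : i + 1 < r)
    (hmedian : IsMedianOrder R (a (i + 1)) (b (i + 1))) :
    ∃ f, g.IsCoreEmbedding R a b (i + 1) f := by
  obtain ⟨l, hl⟩ := hmedian.exists_isSpanningPath_of_free_end (c := 1) (A := ∅) le_rfl
    (h.arrangement.core _ hir.le).1 le_rfl (by simp) (by simp) (by simp)
  have hmid := h.mid i hir
  have := (g.seg (2 * i + 1)).length_support_pos
  rw [g.core_succ hir, DiPath.ncard_verts_toSub, DiPath.length] at hmid
  obtain ⟨f, hinj, hmem, -, hadj, hfirst, hlast⟩ := hl.exists_embedding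
    (p := g.seg (2 * i + 1)) (by rw [sdiff_empty, Int.card_Icc]; omega)
  rw [← g.core_succ hir] at hinj hmem
  refine ⟨f, hinj, by simpa only [sdiff_empty] using hmem, fun u v huv => ?_, fun _ => ?_,
    fun j hj => ?_⟩
  · rw [g.S_mid _ (by omega) (by omega), ← g.seg_odd] at huv
    exact hadj u v huv
  · rwa [show 2 * (i + 1) = 2 * i + 1 + 1 by ring, ← g.seg_last (by omega)]
  · obtain rfl : j = i := by omega
    rwa [g.seg_last (by omega)]

theorem exists_isCoreEmbedding (hR : IsMedianOrder R lo hi) (hr : 1 ≤ r) (hm : 0 < m)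
    (hi : i ≤ r) : ∃ f, g.IsCoreEmbedding R a b i f := by
  have hmedian : IsMedianOrder R (a i) (b i) :=
    hR.mono (h.arrangement.lo_le_start hi) (h.arrangement.end_le_hi hi)
  rcases hi.lt_or_eq with hir | rfl
  · cases i with
    | zero => exact h.exists_isCoreEmbedding_zero hmedian hr hm
    | succ i => exact h.exists_isCoreEmbedding_succ hir hmedian
  · exact h.exists_isCoreEmbedding_last hmedian hr hm

open Classical in
theorem exists_outForest_extension (hR : IsMedianOrder R lo hi) (hir : i < r)
    (hf : ∀ v ∈ g.core i, f v ∈ Icc (a i) (b i)) :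
    ∃ f' : V → ℤ, Set.EqOn f' f (g.core i) ∧ Set.InjOn f' (g.outPart i) ∧
      (∀ v ∈ g.outPart i, f' v ∈ Icc (b i + 8 * M) (b i + 40 * M)) ∧
      ∀ u v, (g.F .plus (i + 1)).Adj u v → R (f' u) (f' v) := by
  have hM := h.arrangement.large
  have hlo := h.arrangement.lo_le_start (i := i) hir.le
  have hhi := h.arrangement.end_le_hi (i := i + 1) hir
  have hcore := h.arrangement.core i hir.le
  have hcore' := h.arrangement.core (i + 1) hir
  have hgap := h.arrangement.gap i hir
  refine (g.F .plus (i + 1)).exists_extension_out (g.core i)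
    (g.forest_F .plus (i + 1) (by omega) (by omega))
    (g.component_F .plus (i + 1) (by omega) (by omega))
    (g.nbrs_F .plus (i + 1) (by omega) (by omega)) _ (fun s hs t ht hst => ?_) _ fun s hs => ?_
  · rw [Finset.mem_Icc] at hs ht
    exact hR.adj_iff_not_adj s t (by omega) (by omega) (by omega) (by omega) hst
  · have hfs := Finset.mem_Icc.1 (hf s hs)
    have hout := hR.sub_le_card_out_Icc (i := f s) (s := b i + 8 * M) (t := b i + 40 * M)
      (by omega) (by omega) (by omega) (by omega)
    have horder := h.order_le .plus (i + 1) (by omega) (by omega)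
    rw [← Set.ncard_coe_finset, coe_filter] at hout
    omega

open Classical in
theorem exists_inForest_extension (hR : IsMedianOrder R lo hi) (hir : i < r)
    (hf : ∀ v ∈ g.core (i + 1), f v ∈ Icc (a (i + 1)) (b (i + 1))) :
    ∃ f' : V → ℤ, Set.EqOn f' f (g.core (i + 1)) ∧ Set.InjOn f' (g.inPart i) ∧
      (∀ v ∈ g.inPart i, f' v ∈ Icc (a (i + 1) - 500 * M) (a (i + 1) - 220 * M)) ∧
      ∀ u v, (g.F .minus (i + 2)).Adj u v → R (f' u) (f' v) := by
  have hM := h.arrangement.large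
  have hlo := h.arrangement.lo_le_start (i := i) hir.le
  have hhi := h.arrangement.end_le_hi (i := i + 1) hir
  have hcore := h.arrangement.core i hir.le
  have hcore' := h.arrangement.core (i + 1) hir
  have hgap := h.arrangement.gap i hir
  refine (g.F .minus (i + 2)).exists_extension_in (g.core (i + 1))
    (g.forest_F .minus (i + 2) (by omega) (by omega))
    (g.component_F .minus (i + 2) (by omega) (by omega))
    (g.nbrs_F .minus (i + 2) (by omega) (by omega)) _ (fun s hs t ht hst => ?_) _ fun s hs => ?_
  · rw [Finset.mem_Icc] at hs ht
    exact hR.adj_iff_not_adj s t (by omega) (by omega) (by omega) (by omega) hst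
  · have hfs := Finset.mem_Icc.1 (hf s hs)
    have hin := hR.sub_le_card_in_Icc (j := f s) (s := a (i + 1) - 500 * M)
      (t := a (i + 1) - 220 * M) (by omega) (by omega) (by omega) (by omega)
    have horder := h.order_le .minus (i + 2) (by omega) (by omega)
    rw [← Set.ncard_coe_finset, coe_filter] at hin
    omega

end Fits

/-- `f` places the cores and the forests attached to them: the `i`-th core in `[a i, b i]`, its
out-forest shortly after it, and the in-forest of the next core shortly before that core. -/
structure IsBase (g : GoodDecomposition r m D T) (R : ℤ → ℤ → Prop) (M : ℕ) (a b : ℕ → ℤ)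
    (f : V → ℤ) : Prop where
  core : ∀ i ≤ r, g.IsCoreEmbedding R a b i f
  out_injOn : ∀ i < r, Set.InjOn f (g.outPart i)
  out_mem : ∀ i < r, ∀ v ∈ g.outPart i, f v ∈ Icc (b i + 8 * M) (b i + 40 * M)
  out_adj : ∀ i < r, ∀ u v, (g.F .plus (i + 1)).Adj u v → R (f u) (f v)
  in_injOn : ∀ i < r, Set.InjOn f (g.inPart i)
  in_mem : ∀ i < r, ∀ v ∈ g.inPart i, f v ∈ Icc (a (i + 1) - 500 * M) (a (i + 1) - 220 * M)
  in_adj : ∀ i < r, ∀ u v, (g.F .minus (i + 2)).Adj u v → R (f u) (f v)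

theorem Fits.exists_isBase [Finite V] (h : g.Fits lo hi M a b prof) (hR : IsMedianOrder R lo hi)
    (hr : 1 ≤ r) (hm : 0 < m) : ∃ f, IsBase g R M a b f := by
  choose fcore hcore using fun i : Fin (r + 1) => h.exists_isCoreEmbedding hR hr hm i.is_le
  choose fout hout_eq hout_inj hout_mem hout_adj using fun i : Fin r =>
    h.exists_outForest_extension hR i.2 (hcore i.castSucc).mem_Icc
  choose fin hin_eq hin_inj hin_mem hin_adj using fun i : Fin r =>
    h.exists_inForest_extension hR i.2 (hcore i.succ).mem_Icc
  obtain ⟨f, hf⟩ := exists_eqOn_of_pairwise_disjoint (g.pairwise_disjoint_piece hr hm)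
    (Sum.elim (Sum.elim fcore (fun _ _ => 0)) (Sum.elim fout (Sum.elim fin (fun _ _ => 0))))
  have hfcore : ∀ i (hi : i < r + 1), Set.EqOn f (fcore ⟨i, hi⟩) (g.core i) :=
    fun i hi => hf (.inl (.inl ⟨i, hi⟩))
  have hfout : ∀ i (hi : i < r), Set.EqOn f (fout ⟨i, hi⟩) (g.F .plus (i + 1)).verts := by
    intro i hi v hv
    by_cases hvS : v ∈ g.core i
    · exact (hfcore i (by omega) hvS).trans (hout_eq ⟨i, hi⟩ hvS).symm
    · exact hf (.inr (.inl ⟨i, hi⟩)) ⟨hv, hvS⟩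
  have hfin : ∀ i (hi : i < r), Set.EqOn f (fin ⟨i, hi⟩) (g.F .minus (i + 2)).verts := by
    intro i hi v hv
    by_cases hvS : v ∈ g.core (i + 1)
    · exact (hfcore (i + 1) (by omega) hvS).trans (hin_eq ⟨i, hi⟩ hvS).symm
    · exact hf (.inr (.inr (.inl ⟨i, hi⟩))) ⟨hv, hvS⟩
  refine ⟨f, fun i hi => (hcore ⟨i, by omega⟩).congr (hfcore i (by omega)) hr hm hi,
    fun i hi => (hout_inj ⟨i, hi⟩).congr ((hfout i hi).symm.mono Set.sdiff_subset),
    fun i hi v hv => hfout i hi hv.1 ▸ hout_mem ⟨i, hi⟩ v hv, fun i hi u v huv => ?_,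
    fun i hi => (hin_inj ⟨i, hi⟩).congr ((hfin i hi).symm.mono Set.sdiff_subset),
    fun i hi v hv => hfin i hi hv.1 ▸ hin_mem ⟨i, hi⟩ v hv, fun i hi u v huv => ?_⟩
  · rw [hfout i hi ((g.F _ _).left_mem huv), hfout i hi ((g.F _ _).right_mem huv)]
    exact hout_adj ⟨i, hi⟩ u v huv
  · rw [hfin i hi ((g.F _ _).left_mem huv), hfin i hi ((g.F _ _).right_mem huv)]
    exact hin_adj ⟨i, hi⟩ u v huv

end GoodDecomposition

namespace GoodDecomposition

section Base

variable {V : Type*} {r : ℕ} {m : ℝ} {D T : Digraph V} (g : GoodDecomposition r m D T)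

/-- The forest vertices which are placed between the `i`-th core and the next one. -/
def attached (i : ℕ) : Set V := g.outPart i ∪ g.inPart i

/-- The vertices which lie in a core or in a forest attached to it. -/
def base : Set V := {v | (∃ i ≤ r, v ∈ g.core i) ∨ ∃ i < r, v ∈ g.attached i}

variable {g} {R : ℤ → ℤ → Prop} {lo hi : ℤ} {M : ℕ} {a b : ℕ → ℤ} {prof : Fin g.l → ℕ → ℕ}
  {f : V → ℤ}

theorem mem_core_or_mem_part_of_mem_F {i : ℕ} (hi : i ≤ r) {v : V}
    (hv : v ∈ (g.F .minus (i + 1)).verts ∪ (g.F .plus (i + 1)).verts) :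
    v ∈ g.core i ∨ (i < r ∧ v ∈ g.outPart i) ∨ ∃ j < r, i = j + 1 ∧ v ∈ g.inPart j := by
  by_cases hcore : v ∈ g.core i
  · exact Or.inl hcore
  rcases hv with hv | hv
  · cases i with
    | zero =>
      exact absurd (g.verts_F_subset_of_forall_not_adj .minus le_rfl (by omega) g.F_first hv) hcore
    | succ j => exact Or.inr (Or.inr ⟨j, hi, rfl, hv, hcore⟩)
  · rcases hi.eq_or_lt with rfl | hlt
    · exact absurd (g.verts_F_subset_of_forall_not_adj .plus (by omega) le_rfl g.F_last hv) hcore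
    · exact Or.inr (Or.inl ⟨hlt, hv, hcore⟩)

theorem mem_base_of_mem_F {i : ℕ} (hi : i ≤ r) {v : V}
    (hv : v ∈ (g.F .minus (i + 1)).verts ∪ (g.F .plus (i + 1)).verts) : v ∈ g.base := by
  rcases mem_core_or_mem_part_of_mem_F hi hv with hv | ⟨hir, hv⟩ | ⟨j, hj, -, hv⟩
  · exact Or.inl ⟨i, hi, hv⟩
  · exact Or.inr ⟨i, hir, Or.inl hv⟩
  · exact Or.inr ⟨j, hj, Or.inr hv⟩

theorem IsProfile.ends_mem_base (hr : 1 ≤ r) (hm : 0 < m) {e : Fin g.l} {π : ℕ → ℕ}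
    (h : g.IsProfile e π) : (g.Q e).first ∈ g.base ∧ (g.Q e).last ∈ g.base := by
  rcases h with ⟨j, j', hjj', hj', hfirst, hlast, -, -⟩ | ⟨j, hj, hfirst, hlast, -, -⟩
  · exact ⟨mem_base_of_mem_F (by omega) hfirst, mem_base_of_mem_F hj' hlast⟩
  · refine ⟨Or.inr ⟨j, by omega, Or.inr hfirst⟩, Or.inl ⟨j + 1, by omega, ?_⟩⟩
    rw [hlast, g.seg_last (by omega)]
    exact g.first_seg_mem_core hr hm (i := j + 1) hj

namespace IsBase

variable (hf : IsBase g R M a b f) (h : IsArrangement lo hi r M a b)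
include hf h

theorem mem_Icc_of_mem_F {i : ℕ} (hi' : i ≤ r) {v : V}
    (hvF : v ∈ (g.F .minus (i + 1)).verts ∪ (g.F .plus (i + 1)).verts) :
    f v ∈ Icc lo hi ∧ f v ∈ Icc (a i - 500 * M) (b i + 40 * M) := by
  have := h.large
  have hcore := h.core i hi'
  have hlo := h.lo_le_start hi'
  have hhi := h.end_le_hi hi'
  simp only [Finset.mem_Icc]
  rcases mem_core_or_mem_part_of_mem_F hi' hvF with hv | ⟨hir, hv⟩ | ⟨j, hj, rfl, hv⟩
  · have := Finset.mem_Icc.1 ((hf.core i hi').mem_Icc v hv)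
    omega
  · have := Finset.mem_Icc.1 (hf.out_mem i hir v hv)
    have := h.gap i hir
    have := h.end_le_hi (i := i + 1) hir
    have := h.core (i + 1) hir
    omega
  · have := Finset.mem_Icc.1 (hf.in_mem j hj v hv)
    have := h.gap j hj
    have := h.lo_le_start hj.le
    have := h.core j hj.le
    omega

theorem mem_Ioo {i : ℕ} (hi' : i < r) {v : V} (hv : v ∈ g.attached i) :
    f v ∈ Ioo (b i) (a (i + 1)) := by
  have := h.large
  have hgap := h.gap i hi'
  rw [Finset.mem_Ioo]
  rcases hv with hv | hv
  · have := Finset.mem_Icc.1 (hf.out_mem i hi' v hv)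
    omega
  · have := Finset.mem_Icc.1 (hf.in_mem i hi' v hv)
    omega

theorem ne_of_mem_core {i j : ℕ} (hi' : i ≤ r) (hj : j < r) {v : V} (hv : v ∈ g.core i) {z : ℤ}
    (hz : z ∈ Ioo (b j) (a (j + 1))) : f v ≠ z := by
  rintro rfl
  have hmem := Finset.mem_Icc.1 ((hf.core i hi').mem_Icc v hv)
  rw [Finset.mem_Ioo] at hz
  have := h.start_succ_le hi' hj hmem.1 hmem.2 hz.1
  omega

theorem image_outPart_disjoint_image_inPart {i : ℕ} (hi' : i < r) :
    Disjoint (f '' g.outPart i) (f '' g.inPart i) := by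
  rw [Set.disjoint_left]
  rintro _ ⟨u, hu, rfl⟩ ⟨v, hv, huv⟩
  have hfu := Finset.mem_Icc.1 (hf.out_mem i hi' u hu)
  have hfv := Finset.mem_Icc.1 (hf.in_mem i hi' v hv)
  have := h.large
  have := h.gap i hi'
  omega

theorem injOn_attached {i : ℕ} (hi' : i < r) : Set.InjOn f (g.attached i) := by
  have hdisj := hf.image_outPart_disjoint_image_inPart h hi'
  refine (Set.injOn_union hdisj.of_image).2 ⟨hf.out_injOn i hi', hf.in_injOn i hi', ?_⟩
  exact fun u hu v hv => hdisj.ne_of_mem ⟨u, hu, rfl⟩ ⟨v, hv, rfl⟩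

theorem injOn : Set.InjOn f g.base := by
  have := h.large
  rintro u (⟨i, hi, hu⟩ | ⟨i, hi, hu⟩) v (⟨j, hj, hv⟩ | ⟨j, hj, hv⟩) huv
  · have hfu := Finset.mem_Icc.1 ((hf.core i hi).mem_Icc u hu)
    have hfv := Finset.mem_Icc.1 ((hf.core j hj).mem_Icc v hv)
    rcases lt_trichotomy i j with hij | rfl | hij
    · have := h.add_le_of_lt hij hj
      omega
    · exact (hf.core i hi).injOn hu hv huv
    · have := h.add_le_of_lt hij hi
      omega
  · exact absurd huv (hf.ne_of_mem_core h hi hj hu (hf.mem_Ioo h hj hv))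
  · exact absurd huv.symm (hf.ne_of_mem_core h hj hi hv (hf.mem_Ioo h hi hu))
  · obtain rfl := (h.mem_gap_iff hi hj (hf.mem_Ioo h hj hv)).1 (huv ▸ hf.mem_Ioo h hi hu)
    exact hf.injOn_attached h hi hu hv huv

end IsBase

end Base

section Linking

variable {V : Type*} [Finite V] {r : ℕ} {m : ℝ} {D T : Digraph V}

/-- The positions which the links must avoid: those taken by the forests attached to the cores, and
an interval in the middle of every gap, which stays free so that the remaining positions of the gap
can be joined to a path. -/
noncomputable def blocked (g : GoodDecomposition r m D T) (M : ℕ) (b : ℕ → ℤ) (f : V → ℤ) :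
    Finset ℤ :=
  (range r).biUnion fun i =>
    (Set.toFinite (f '' g.attached i)).toFinset ∪ Icc (b i + 993 * M) (b i + 1007 * M)

variable {g : GoodDecomposition r m D T} {R : ℤ → ℤ → Prop} {lo hi : ℤ} {M : ℕ} {a b : ℕ → ℤ}
  {prof : Fin g.l → ℕ → ℕ} {f : V → ℤ}

theorem IsBase.mem_blocked_iff (hf : IsBase g R M a b f) (h : IsArrangement lo hi r M a b) {i : ℕ}
    (hi' : i < r) {z : ℤ} (hz : z ∈ Ioo (b i) (a (i + 1))) :
    z ∈ g.blocked M b f ↔ z ∈ f '' g.attached i ∨ z ∈ Icc (b i + 993 * M) (b i + 1007 * M) := by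
  simp only [blocked, mem_biUnion, mem_union, mem_range, Set.Finite.mem_toFinset]
  refine ⟨fun ⟨j, hj, hzj⟩ => ?_, fun hzi => ⟨i, hi', hzi⟩⟩
  have := h.large
  have hgap := h.gap j hj
  have hz' : z ∈ Ioo (b j) (a (j + 1)) := by
    rcases hzj with ⟨v, hv, rfl⟩ | hzj
    · exact hf.mem_Ioo h hj hv
    · rw [Finset.mem_Icc] at hzj
      exact Finset.mem_Ioo.2 (by omega)
  rwa [← (h.mem_gap_iff hj hi' hz).1 hz']

namespace Fits

variable (h : g.Fits lo hi M a b prof) (hf : IsBase g R M a b f)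
include h hf

theorem card_blocked_inter_le {i : ℕ} (hi' : i < r) :
    (#(g.blocked M b f ∩ Ioo (b i) (a (i + 1))) : ℤ) ≤ 17 * M := by
  have hsub : g.blocked M b f ∩ Ioo (b i) (a (i + 1)) ⊆
      (Set.toFinite (f '' g.attached i)).toFinset ∪ Icc (b i + 993 * M) (b i + 1007 * M) := by
    intro z hz
    rw [mem_inter] at hz
    rw [mem_union, Set.Finite.mem_toFinset]
    exact (hf.mem_blocked_iff h.arrangement hi' hz.2).1 hz.1
  have hcard := (card_le_card hsub).trans (card_union_le _ _)
  rw [← Set.ncard_eq_toFinset_card _ (Set.toFinite _), Int.card_Icc] at hcard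
  have himage := Set.ncard_image_le (f := f) (Set.toFinite (g.attached i))
  have hunion : (g.attached i).ncard ≤ _ := Set.ncard_union_le _ _
  have := h.ncard_outPart_le hi'
  have := h.ncard_inPart_le hi'
  have := h.arrangement.large
  omega

theorem card_blocked_inter_end_le {i : ℕ} (hi' : i < r) :
    #(g.blocked M b f ∩ Ioo (a (i + 1) - 500 * M) (a (i + 1))) ≤ M := by
  have := h.arrangement.large
  have hgap := h.arrangement.gap i hi'
  have hsub : g.blocked M b f ∩ Ioo (a (i + 1) - 500 * M) (a (i + 1)) ⊆
      (Set.toFinite (f '' g.inPart i)).toFinset := by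
    intro z hz
    rw [mem_inter, Finset.mem_Ioo] at hz
    rw [Set.Finite.mem_toFinset]
    rcases (hf.mem_blocked_iff h.arrangement hi' (Finset.mem_Ioo.2 (by omega))).1 hz.1 with
      ⟨v, hv | hv, rfl⟩ | hmid
    · have := Finset.mem_Icc.1 (hf.out_mem i hi' v hv)
      omega
    · exact ⟨v, hv, rfl⟩
    · rw [Finset.mem_Icc] at hmid
      omega
  refine (card_le_card hsub).trans ?_
  rw [← Set.ncard_eq_toFinset_card _ (Set.toFinite _)]
  exact (Set.ncard_image_le (Set.toFinite _)).trans (h.ncard_inPart_le hi')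

theorem exists_isRoute (hR : IsMedianOrder R lo hi) (e : Fin g.l) {B : Finset ℤ} (hB : #B ≤ M) :
    ∃ c, (f (g.Q e).first :: (c ++ [f (g.Q e).last])).IsChain R ∧
      IsRoute R r M a b (g.blocked M b f ∪ B) (f (g.Q e).last) (prof e) c := by
  have := h.arrangement.large
  have hunion (s t : ℤ) : #((g.blocked M b f ∪ B) ∩ Ioo s t) ≤ #(g.blocked M b f ∩ Ioo s t) + M :=
    (card_le_card (by grind)).trans ((card_union_le _ B).trans (Nat.add_le_add_left hB _))
  rcases h.profile e with ⟨j, j', hjj', hj', hfirst, hlast, -, hprof⟩ |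
    ⟨j, hj, hfirst, hlast, -, hprof⟩
  · obtain ⟨hσ, hσj⟩ := hf.mem_Icc_of_mem_F h.arrangement (by omega) hfirst
    obtain ⟨hτ, hτj⟩ := hf.mem_Icc_of_mem_F h.arrangement hj' hlast
    rw [Finset.mem_Icc] at hσ hσj hτ hτj
    rw [hprof]
    refine h.arrangement.exists_route hR (fun i hi => ?_) hjj' hj' hσ.1 hσj.2 hσj.1 hτ.2 hτj.1 hτj.2
    have := hunion (b i) (a (i + 1))
    have := h.card_blocked_inter_le hf hi
    omega
  · have hσ := Finset.mem_Icc.1 (hf.in_mem j (by omega) _ hfirst)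
    have hτ : f (g.Q e).last = b (j + 1) := by
      rw [hlast, g.seg_last (by omega)]
      exact (hf.core (j + 1) (by omega)).first hj
    rw [hprof, hτ]
    refine h.arrangement.exists_route_to_end hR (by omega) hσ.1 hσ.2 ?_
    have := hunion (a (j + 1) - 500 * M) (a (j + 1))
    have := h.card_blocked_inter_end_le hf (i := j) (by omega)
    omega

end Fits

/-- `c e` lists the positions of the inner vertices of the link `Q e`, for every `e`. -/
structure IsLinking (g : GoodDecomposition r m D T) (R : ℤ → ℤ → Prop) (M : ℕ) (a b : ℕ → ℤ)
    (prof : Fin g.l → ℕ → ℕ) (f : V → ℤ) (c : Fin g.l → List ℤ) : Prop where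
  chain : ∀ e, (f (g.Q e).first :: (c e ++ [f (g.Q e).last])).IsChain R
  route : ∀ e, IsRoute R r M a b (g.blocked M b f) (f (g.Q e).last) (prof e) (c e)
  disjoint : Pairwise fun e e' => (c e).Disjoint (c e')

theorem Fits.exists_isLinking (h : g.Fits lo hi M a b prof) (hr : 1 ≤ r)
    (hR : IsMedianOrder R lo hi) (hf : IsBase g R M a b f) :
    ∃ c, IsLinking g R M a b prof f c := by
  refine (exists_pairwise_disjoint_lists (K := 3 * r)
    (fun e c => (f (g.Q e).first :: (c ++ [f (g.Q e).last])).IsChain R ∧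
      IsRoute R r M a b (g.blocked M b f) (f (g.Q e).last) (prof e) c)
    (fun e c hc => ?_) fun e B hB => ?_).imp
      fun c hc => ⟨fun e => (hc.1 e).1, fun e => (hc.1 e).2, hc.2⟩
  · rw [hc.2.length_eq h.arrangement, (h.profile e).sum_eq_ncard_inner,
      (g.Q e).ncard_inner (h.profile e).length_pos]
    have := (h.profile e).length_le hr
    omega
  · have hBM : #B ≤ M := calc
      #B ≤ g.l * (3 * r) := by simpa using hB
      _ ≤ 2 * r * (3 * r) := Nat.mul_le_mul_right _ g.l_le
      _ = 6 * r * r := by ring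
      _ ≤ M := h.sq_le
    obtain ⟨c, hchain, hc⟩ := h.exists_isRoute hf hR e hBM
    exact ⟨c, ⟨hchain, hc.anti subset_union_left⟩,
      fun z hz hzB => hc.notMem z hz (mem_union_right _ hzB)⟩

end Linking

end GoodDecomposition

namespace GoodDecomposition

section Placement

variable {V : Type*} {r : ℕ} {m : ℝ} {D T : Digraph V}

open Classical in
/-- The positions between the `i`-th core and the next one which are not available for the interior
of `P_{i+1}`, because they are taken by a forest vertex or by an inner vertex of a link. -/
noncomputable def occupied (g : GoodDecomposition r m D T) (a b : ℕ → ℤ) (f : V → ℤ)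
    (c : Fin g.l → List ℤ) (i : ℕ) : Finset ℤ :=
  {z ∈ Ioo (b i) (a (i + 1)) | z ∈ f '' g.attached i ∨ ∃ e, z ∈ c e}

variable {g : GoodDecomposition r m D T} {R : ℤ → ℤ → Prop} {lo hi : ℤ} {M : ℕ}
  {a b : ℕ → ℤ} {prof : Fin g.l → ℕ → ℕ} {f : V → ℤ} {c : Fin g.l → List ℤ}

open Classical in
theorem mem_occupied {i : ℕ} {z : ℤ} : z ∈ g.occupied a b f c i ↔
    z ∈ Ioo (b i) (a (i + 1)) ∧ (z ∈ f '' g.attached i ∨ ∃ e, z ∈ c e) :=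
  mem_filter

theorem Fits.sum_prof_le (h : g.Fits lo hi M a b prof) (i : ℕ) : ∑ e, prof e i ≤ M := by
  have hprof : ∀ e, prof e i ≤ 3 := by
    intro e
    rcases h.profile e with ⟨j, j', -, -, -, -, -, hπ⟩ | ⟨j, -, -, -, -, hπ⟩
    · rw [hπ]
      dsimp only
      split_ifs <;> omega
    · rw [hπ, Pi.single_apply]
      split_ifs <;> omega
  calc ∑ e, prof e i ≤ g.l * 3 := by simpa using sum_le_card_nsmul univ _ 3 fun e _ => hprof e
    _ ≤ 6 * r * r := by
      have := g.l_le
      have := Nat.le_mul_self r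
      linarith
    _ ≤ M := h.sq_le

namespace IsLinking

variable [Finite V] (hc : IsLinking g R M a b prof f c)
include hc

theorem ne_of_mem_attached {i : ℕ} (hi' : i < r) {e : Fin g.l} {z : ℤ} (hz : z ∈ c e) {v : V}
    (hv : v ∈ g.attached i) : f v ≠ z := by
  rintro rfl
  refine (hc.route e).notMem _ hz (mem_biUnion.2 ⟨i, mem_range.2 hi', mem_union_left _ ?_⟩)
  exact (Set.Finite.mem_toFinset _).2 ⟨v, hv, rfl⟩

theorem ne_of_mem_base (hf : IsBase g R M a b f) (h : IsArrangement lo hi r M a b) {e : Fin g.l}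
    {z : ℤ} (hz : z ∈ c e) {v : V} (hv : v ∈ g.base) : f v ≠ z := by
  have := h.large
  rcases hv with ⟨i, hi, hv⟩ | ⟨i, hi, hv⟩
  · obtain ⟨j, hj, hbz, hza⟩ := (hc.route e).mem_gap z hz
    exact hf.ne_of_mem_core h hi hj hv (Finset.mem_Ioo.2 (by omega))
  · exact hc.ne_of_mem_attached hi hz hv

open Classical in
theorem card_biUnion_filter_mem_gap {i : ℕ} (hi' : i < r) :
    #(univ.biUnion fun e => {z ∈ (c e).toFinset | z ∈ Ioo (b i) (a (i + 1))}) =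
      ∑ e, prof e i := by
  rw [card_biUnion]
  · refine sum_congr rfl fun e _ => ?_
    rw [← (hc.route e).count i hi', List.countP_eq_length_filter,
      ← List.toFinset_card_of_nodup ((hc.route e).nodup.filter _), List.toFinset_filter]
    simp only [decide_eq_true_eq]
  · refine fun e _ e' _ hne => disjoint_left.2 fun z hz hz' => ?_
    exact hc.disjoint hne (List.mem_toFinset.1 (mem_filter.1 hz).1)
      (List.mem_toFinset.1 (mem_filter.1 hz').1)

variable (h : g.Fits lo hi M a b prof) (hf : IsBase g R M a b f)
include h hf

theorem card_occupied {i : ℕ} (hi' : i < r) :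
    #(g.occupied a b f c i) = (g.outPart i).ncard + (g.inPart i).ncard + ∑ e, prof e i := by
  classical
  have hunion : g.occupied a b f c i = (Set.toFinite (f '' g.attached i)).toFinset ∪
      univ.biUnion fun e => {z ∈ (c e).toFinset | z ∈ Ioo (b i) (a (i + 1))} := by
    ext z
    simp only [mem_occupied, mem_filter, mem_union, Set.Finite.mem_toFinset, mem_biUnion, mem_univ,
      true_and, List.mem_toFinset]
    have := fun hz : z ∈ f '' g.attached i => hz.elim fun v hv =>
      hv.2 ▸ hf.mem_Ioo h.arrangement hi' hv.1
    grind
  rw [hunion, card_union_of_disjoint, hc.card_biUnion_filter_mem_gap hi',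
    ← Set.ncard_eq_toFinset_card _ (Set.toFinite _),
    (hf.injOn_attached h.arrangement hi').ncard_image, attached, Set.ncard_union_eq]
  · exact (hf.image_outPart_disjoint_image_inPart h.arrangement hi').of_image
  · rw [disjoint_left]
    intro z hz hz'
    obtain ⟨v, hv, rfl⟩ := (Set.Finite.mem_toFinset _).1 hz
    obtain ⟨e, -, hz'⟩ := mem_biUnion.1 hz'
    exact hc.ne_of_mem_attached hi' (List.mem_toFinset.1 (mem_filter.1 hz').1) hv rfl

theorem mem_Icc_of_mem_occupied {i : ℕ} (hi' : i < r) {z : ℤ} (hz : z ∈ g.occupied a b f c i) :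
    z ∈ Icc (b i + 8 * M) (a (i + 1) - 8 * M) ∧ z ∉ Icc (b i + 993 * M) (b i + 1007 * M) := by
  have := h.arrangement.large
  have := h.arrangement.gap i hi'
  obtain ⟨hgap, ⟨v, hv | hv, rfl⟩ | ⟨e, hz⟩⟩ := mem_occupied.1 hz
  · have := Finset.mem_Icc.1 (hf.out_mem i hi' v hv)
    simp only [Finset.mem_Icc]
    omega
  · have := Finset.mem_Icc.1 (hf.in_mem i hi' v hv)
    simp only [Finset.mem_Icc]
    omega
  · constructor
    · obtain ⟨j, hj, hbz, hza⟩ := (hc.route e).mem_gap z hz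
      obtain rfl := (h.arrangement.mem_gap_iff hj hi' hgap).1 (Finset.mem_Ioo.2 (by omega))
      exact Finset.mem_Icc.2 ⟨hbz, hza⟩
    · exact fun hmid => (hc.route e).notMem z hz
        ((hf.mem_blocked_iff h.arrangement hi' hgap).2 (Or.inr hmid))

theorem exists_isSpanningPath (hR : IsMedianOrder R lo hi) {i : ℕ} (hi' : i < r) :
    ∃ l, IsSpanningPath R (Icc (b i) (a (i + 1)) \ g.occupied a b f c i) (b i) (a (i + 1)) l := by
  have := h.arrangement.large
  have := h.arrangement.gap i hi'
  have := h.arrangement.core i hi'.le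
  have := h.arrangement.core (i + 1) hi'
  have := h.arrangement.lo_le_start hi'.le
  have := h.arrangement.end_le_hi (i := i + 1) hi'
  have := h.ncard_outPart_le hi'
  have := h.ncard_inPart_le hi'
  have := h.sum_prof_le i
  have := hc.card_occupied h hf hi'
  refine hR.exists_isSpanningPath (e := b i + 1000 * M) (c := 8 * M) (by omega) (by omega)
    (by omega) (by omega) (by omega) (fun z hz => ?_) fun z hez hze hz => ?_
  · exact Finset.mem_Icc.1 (hc.mem_Icc_of_mem_occupied h hf hi' hz).1
  · exact (hc.mem_Icc_of_mem_occupied h hf hi' hz).2 (Finset.mem_Icc.2 (by omega))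

theorem exists_segMap (hR : IsMedianOrder R lo hi) (hm : 0 < m) {i : ℕ} (hi' : i < r) :
    ∃ F : V → ℤ, Set.InjOn F (g.seg (2 * i)).inner ∧
      (∀ v ∈ (g.seg (2 * i)).inner, F v ∈ Ioo (b i) (a (i + 1)) \ g.occupied a b f c i) ∧
      (∀ u v, (g.seg (2 * i)).toSub.Adj u v → R (F u) (F v)) ∧
      F (g.seg (2 * i)).first = b i ∧ F (g.seg (2 * i)).last = a (i + 1) := by
  obtain ⟨l, hl⟩ := hc.exists_isSpanningPath h hf hR hi'
  have hsub : g.occupied a b f c i ⊆ Icc (b i) (a (i + 1)) :=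
    fun z hz => Ioo_subset_Icc_self (mem_occupied.1 hz).1
  have hlen : #(Icc (b i) (a (i + 1)) \ g.occupied a b f c i) = (g.seg (2 * i)).support.length := by
    have hpos := g.length_seg_even_pos hm hi'
    have hgap := h.gap i hi'
    rw [(g.seg (2 * i)).ncard_inner hpos] at hgap
    simp only [DiPath.length] at hpos hgap
    rw [card_sdiff_of_subset hsub, Int.card_Icc, hc.card_occupied h hf hi']
    omega
  obtain ⟨F, hinj, hmem, hne, hadj, hfirst, hlast⟩ := hl.exists_embedding hlen
  refine ⟨F, hinj.mono Set.sdiff_subset, fun v hv => ?_, hadj, hfirst, hlast⟩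
  obtain ⟨hFv, hocc⟩ := mem_sdiff.1 (hmem v hv.1)
  have := hne v hv
  rw [Finset.mem_Icc] at hFv
  exact mem_sdiff.2 ⟨Finset.mem_Ioo.2 (by omega), hocc⟩

theorem exists_linkMap (hr : 1 ≤ r) (hm : 0 < m) (e : Fin g.l) :
    ∃ F : V → ℤ, Set.InjOn F (g.Q e).inner ∧ (∀ v ∈ (g.Q e).inner, F v ∈ c e) ∧
      (∀ u v, (g.Q e).toSub.Adj u v → R (F u) (F v)) ∧ F (g.Q e).first = f (g.Q e).first ∧
      F (g.Q e).last = f (g.Q e).last := by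
  have hpos := (h.profile e).length_pos
  obtain ⟨hs, ht⟩ := (h.profile e).ends_mem_base hr hm
  have hends := (hf.injOn h.arrangement).ne hs ht ((g.Q e).first_ne_last hpos)
  set l := f (g.Q e).first :: (c e ++ [f (g.Q e).last]) with hl
  have hnodup : l.Nodup := by
    have := (hc.route e).nodup
    have := fun z (hz : z ∈ c e) => hc.ne_of_mem_base hf h.arrangement hz hs
    have := fun z (hz : z ∈ c e) => hc.ne_of_mem_base hf h.arrangement hz ht
    grind
  have hpath : IsSpanningPath R l.toFinset (f (g.Q e).first) (f (g.Q e).last) l :=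
    ⟨hc.chain e, hnodup, fun z => List.mem_toFinset.symm, rfl,
      by rw [hl, ← List.cons_append, List.getLast?_concat]⟩
  have hlen : #l.toFinset = (g.Q e).support.length := by
    have hsum := (h.profile e).sum_eq_ncard_inner
    rw [← (hc.route e).length_eq h.arrangement, (g.Q e).ncard_inner hpos] at hsum
    simp only [DiPath.length] at hsum hpos
    rw [List.toFinset_card_of_nodup hnodup, hl, List.length_cons, List.length_append,
      List.length_singleton, hsum]
    omega
  obtain ⟨F, hinj, hmem, hne, hadj, hfirst, hlast⟩ := hpath.exists_embedding hlen
  refine ⟨F, hinj.mono Set.sdiff_subset, fun v hv => ?_, hadj, hfirst, hlast⟩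
  have hFv := hmem v hv.1
  simpa only [List.mem_toFinset, hl, List.mem_cons, List.mem_append, List.not_mem_nil, hne v hv,
    false_or, or_false] using hFv

end IsLinking

end Placement

end GoodDecomposition

namespace GoodDecomposition

section Embedding

variable {V : Type*} {r : ℕ} {m : ℝ} {D T : Digraph V}

/-- `F` extends the embedding `f` of the cores and the forests to all of `D`: the interior of
`P_{i+1}` goes to the free positions between consecutive cores and the interior of the link `Q_e` to
the positions listed in `c e`. -/
structure IsPlacement (g : GoodDecomposition r m D T) (R : ℤ → ℤ → Prop) (a b : ℕ → ℤ) (f : V → ℤ)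
    (c : Fin g.l → List ℤ) (F : V → ℤ) : Prop where
  eqOn_base : Set.EqOn F f g.base
  seg_injOn : ∀ i < r, Set.InjOn F (g.seg (2 * i)).inner
  seg_mem : ∀ i < r, ∀ v ∈ (g.seg (2 * i)).inner,
    F v ∈ Ioo (b i) (a (i + 1)) \ g.occupied a b f c i
  seg_adj : ∀ i < r, ∀ u v, (g.seg (2 * i)).toSub.Adj u v → R (F u) (F v)
  link_injOn : ∀ e, Set.InjOn F (g.Q e).inner
  link_mem : ∀ e, ∀ v ∈ (g.Q e).inner, F v ∈ c e
  link_adj : ∀ e, ∀ u v, (g.Q e).toSub.Adj u v → R (F u) (F v)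

variable {g : GoodDecomposition r m D T} {R : ℤ → ℤ → Prop} {lo hi : ℤ} {M : ℕ}
  {a b : ℕ → ℤ} {prof : Fin g.l → ℕ → ℕ} {f F : V → ℤ} {c : Fin g.l → List ℤ}

theorem IsLinking.exists_isPlacement [Finite V] (hc : IsLinking g R M a b prof f c)
    (h : g.Fits lo hi M a b prof) (hf : IsBase g R M a b f) (hR : IsMedianOrder R lo hi)
    (hr : 1 ≤ r) (hm : 0 < m) : ∃ F, IsPlacement g R a b f c F := by
  choose fseg hseg_inj hseg_mem hseg_adj hseg_first hseg_last using fun i : Fin r =>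
    hc.exists_segMap h hf hR hm i.2
  choose flink hlink_inj hlink_mem hlink_adj hlink_first hlink_last using
    hc.exists_linkMap h hf hr hm
  obtain ⟨F, hF⟩ := exists_eqOn_of_pairwise_disjoint (g.pairwise_disjoint_piece hr hm)
    (Sum.elim (Sum.elim (fun _ => f) fseg) (Sum.elim (fun _ => f) (Sum.elim (fun _ => f) flink)))
  have hbase : Set.EqOn F f g.base := by
    rintro v (⟨i, hi, hv⟩ | ⟨i, hi, hv | hv⟩)
    · exact hF (.inl (.inl ⟨i, Nat.lt_succ_of_le hi⟩)) hv
    · exact hF (.inr (.inl ⟨i, hi⟩)) hv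
    · exact hF (.inr (.inr (.inl ⟨i, hi⟩))) hv
  have hseg (i : Fin r) : Set.EqOn F (fseg i) (g.seg (2 * i)).toSub.verts := by
    refine DiPath.eqOn_verts (hF (.inl (.inr i))) ?_ ?_
    · rw [hseg_first, hbase (.inl ⟨i, i.2.le, g.first_seg_mem_core hr hm i.2⟩),
        (hf.core i i.2.le).first i.2]
    · rw [hseg_last, hbase (.inl ⟨i + 1, i.2, g.last_seg_mem_core hr hm i.2⟩),
        (hf.core (i + 1) i.2).last i rfl]
  have hlink (e : Fin g.l) : Set.EqOn F (flink e) (g.Q e).toSub.verts := by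
    obtain ⟨hs, ht⟩ := (h.profile e).ends_mem_base hr hm
    exact DiPath.eqOn_verts (hF (.inr (.inr (.inr e)))) ((hbase hs).trans (hlink_first e).symm)
      ((hbase ht).trans (hlink_last e).symm)
  exact ⟨F, {
    eqOn_base := hbase
    seg_injOn i hi := (hseg_inj ⟨i, hi⟩).congr ((hseg ⟨i, hi⟩).mono Set.sdiff_subset).symm
    seg_mem i hi v hv := (hseg ⟨i, hi⟩ hv.1) ▸ hseg_mem ⟨i, hi⟩ v hv
    seg_adj i hi u v huv := by
      rw [hseg ⟨i, hi⟩ ((g.seg _).toSub.left_mem huv),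
        hseg ⟨i, hi⟩ ((g.seg _).toSub.right_mem huv)]
      exact hseg_adj ⟨i, hi⟩ u v huv
    link_injOn e := (hlink_inj e).congr ((hlink e).mono Set.sdiff_subset).symm
    link_mem e v hv := (hlink e hv.1) ▸ hlink_mem e v hv
    link_adj e u v huv := by
      rw [hlink e ((g.Q e).toSub.left_mem huv), hlink e ((g.Q e).toSub.right_mem huv)]
      exact hlink_adj e u v huv }⟩

theorem mem_base_or_mem_inner (hr : 1 ≤ r) (hm : 0 < m) (v : V) :
    v ∈ g.base ∨ (∃ i < r, v ∈ (g.seg (2 * i)).inner) ∨ ∃ e, v ∈ (g.Q e).inner := by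
  obtain ⟨(i | i) | i | i | e, hv⟩ := g.exists_mem_piece hr hm v
  · exact .inl (.inl ⟨i, i.is_le, hv⟩)
  · exact .inr (.inl ⟨i, i.2, hv⟩)
  · exact .inl (.inr ⟨i, i.2, .inl hv⟩)
  · exact .inl (.inr ⟨i, i.2, .inr hv⟩)
  · exact .inr (.inr ⟨e, hv⟩)

namespace IsPlacement

variable (hF : IsPlacement g R a b f c F)
include hF

theorem adj (hf : IsBase g R M a b f) (hr : 1 ≤ r) {u v : V} (huv : D.Adj u v) :
    R (F u) (F v) := by
  rcases g.adj_cases hr huv with ⟨i, hi, h⟩ | ⟨i, hi, h⟩ | ⟨i, hi, h⟩ | ⟨i, hi, h⟩ | ⟨e, h⟩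
  · rw [hF.eqOn_base (.inl ⟨i, hi, (g.S (i + 1)).left_mem h⟩),
      hF.eqOn_base (.inl ⟨i, hi, (g.S (i + 1)).right_mem h⟩)]
    exact (hf.core i hi).adj u v h
  · exact hF.seg_adj i hi u v h
  · rw [hF.eqOn_base (g.mem_base_of_mem_F hi.le (.inr ((g.F _ _).left_mem h))),
      hF.eqOn_base (g.mem_base_of_mem_F hi.le (.inr ((g.F _ _).right_mem h)))]
    exact hf.out_adj i hi u v h
  · rw [hF.eqOn_base (g.mem_base_of_mem_F (i := i + 1) hi (.inl ((g.F _ _).left_mem h))),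
      hF.eqOn_base (g.mem_base_of_mem_F (i := i + 1) hi (.inl ((g.F _ _).right_mem h)))]
    exact hf.in_adj i hi u v h
  · exact hF.link_adj e u v h

theorem notMem_of_mem_inner_seg {i : ℕ} (hi' : i < r) {v : V} (hv : v ∈ (g.seg (2 * i)).inner)
    (e : Fin g.l) : F v ∉ c e := by
  obtain ⟨hgap, hocc⟩ := mem_sdiff.1 (hF.seg_mem i hi' v hv)
  exact fun hmem => hocc (mem_occupied.2 ⟨hgap, .inr ⟨e, hmem⟩⟩)

variable (hf : IsBase g R M a b f) (h : IsArrangement lo hi r M a b)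
include h

theorem eq_of_mem_inner_seg {i j : ℕ} (hi' : i < r) (hj : j < r) {u v : V}
    (hu : u ∈ (g.seg (2 * i)).inner) (hv : v ∈ (g.seg (2 * j)).inner) (huv : F u = F v) :
    u = v := by
  have hu' := (mem_sdiff.1 (hF.seg_mem i hi' u hu)).1
  have hv' := (mem_sdiff.1 (hF.seg_mem j hj v hv)).1
  obtain rfl := (h.mem_gap_iff hi' hj hv').1 (huv ▸ hu')
  exact hF.seg_injOn i hi' hu hv huv

include hf

theorem ne_of_mem_base_of_mem_inner_seg {i : ℕ} (hi' : i < r) {u v : V} (hu : u ∈ g.base)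
    (hv : v ∈ (g.seg (2 * i)).inner) : F u ≠ F v := by
  obtain ⟨hgap, hocc⟩ := mem_sdiff.1 (hF.seg_mem i hi' v hv)
  rw [hF.eqOn_base hu]
  rcases hu with ⟨j, hj, hu⟩ | ⟨j, hj, hu⟩
  · exact hf.ne_of_mem_core h hj hi' hu hgap
  · intro huv
    obtain rfl := (h.mem_gap_iff hj hi' hgap).1 (huv ▸ hf.mem_Ioo h hj hu)
    exact hocc (mem_occupied.2 ⟨hgap, .inl ⟨u, hu, huv⟩⟩)

variable [Finite V] (hc : IsLinking g R M a b prof f c)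
include hc

theorem injective (hr : 1 ≤ r) (hm : 0 < m) : Function.Injective F := by
  have base_ne_link {u v : V} (hu : u ∈ g.base) {e : Fin g.l} (hv : v ∈ (g.Q e).inner) :
      F u ≠ F v :=
    hF.eqOn_base hu ▸ hc.ne_of_mem_base hf h (hF.link_mem e v hv) hu
  have seg_ne_link {i : ℕ} (hi' : i < r) {u v : V} (hu : u ∈ (g.seg (2 * i)).inner) {e : Fin g.l}
      (hv : v ∈ (g.Q e).inner) : F u ≠ F v :=
    fun huv => hF.notMem_of_mem_inner_seg hi' hu e (huv ▸ hF.link_mem e v hv)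
  intro u v huv
  rcases mem_base_or_mem_inner (g := g) hr hm u with hu | ⟨i, hi', hu⟩ | ⟨e, hu⟩ <;>
    rcases mem_base_or_mem_inner (g := g) hr hm v with hv | ⟨j, hj, hv⟩ | ⟨e', hv⟩
  · rw [hF.eqOn_base hu, hF.eqOn_base hv] at huv
    exact hf.injOn h hu hv huv
  · exact absurd huv (hF.ne_of_mem_base_of_mem_inner_seg hf h hj hu hv)
  · exact absurd huv (base_ne_link hu hv)
  · exact absurd huv.symm (hF.ne_of_mem_base_of_mem_inner_seg hf h hi' hv hu)
  · exact hF.eq_of_mem_inner_seg h hi' hj hu hv huv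
  · exact absurd huv (seg_ne_link hi' hu hv)
  · exact absurd huv.symm (base_ne_link hv hu)
  · exact absurd huv.symm (seg_ne_link hj hv hu)
  · obtain rfl : e = e' := by
      by_contra hne
      exact hc.disjoint hne (hF.link_mem e u hu) (huv ▸ hF.link_mem e' v hv)
    exact hF.link_injOn e hu hv huv

theorem mem_Icc (hr : 1 ≤ r) (hm : 0 < m) (v : V) : F v ∈ Icc lo hi := by
  have := h.large
  have mem_Icc_of_mem_gap {i : ℕ} (hi' : i < r) {z : ℤ} (hz : z ∈ Icc (b i) (a (i + 1))) :
      z ∈ Icc lo hi := by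
    have := h.lo_le_start hi'.le
    have := h.core i hi'.le
    have := h.end_le_hi (i := i + 1) hi'
    have := h.core (i + 1) hi'
    rw [Finset.mem_Icc] at hz ⊢
    omega
  rcases mem_base_or_mem_inner (g := g) hr hm v with hv | ⟨i, hi', hv⟩ | ⟨e, hv⟩
  · rw [hF.eqOn_base hv]
    rcases hv with ⟨i, hi', hv⟩ | ⟨i, hi', hv⟩
    · exact Icc_subset_Icc (h.lo_le_start hi') (h.end_le_hi hi') ((hf.core i hi').mem_Icc v hv)
    · exact mem_Icc_of_mem_gap hi' (Ioo_subset_Icc_self (hf.mem_Ioo h hi' hv))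
  · exact mem_Icc_of_mem_gap hi' (Ioo_subset_Icc_self (mem_sdiff.1 (hF.seg_mem i hi' v hv)).1)
  · obtain ⟨i, hi', hbz, hza⟩ := (hc.route e).mem_gap _ (hF.link_mem e v hv)
    exact mem_Icc_of_mem_gap hi' (Finset.mem_Icc.2 (by omega))

end IsPlacement

theorem Fits.exists_embedding [Finite V] (h : g.Fits lo hi M a b prof) (hR : IsMedianOrder R lo hi)
    (hr : 1 ≤ r) (hm : 0 < m) :
    ∃ F : V → ℤ, Function.Injective F ∧ (∀ v, F v ∈ Icc lo hi) ∧
      ∀ u v, D.Adj u v → R (F u) (F v) := by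
  obtain ⟨f, hf⟩ := h.exists_isBase hR hr hm
  obtain ⟨c, hc⟩ := h.exists_isLinking hr hR hf
  obtain ⟨F, hF⟩ := hc.exists_isPlacement h hf hR hr hm
  exact ⟨F, hF.injective hf h.arrangement hc hr hm, hF.mem_Icc hf h.arrangement hc hr hm,
    fun _ _ => hF.adj hf hr⟩

end Embedding

end GoodDecomposition

theorem isArrangement_of_lengths {r : ℕ} {M : ℤ} {s t : ℕ → ℤ} (hM : 100 ≤ M)
    (hs : ∀ i ≤ r, s i ∈ Icc 1 (2 * M)) (ht : ∀ i < r, 2000 * M - 1 ≤ t i) :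
    IsArrangement 0 (∑ i ∈ range (r + 1), s i + ∑ i ∈ range r, t i - 1) r M
      (fun i => ∑ j ∈ range i, (s j + t j)) (fun i => ∑ j ∈ range i, (s j + t j) + s i - 1) where
  lo_le := by simp
  le_hi := by
    rw [sum_range_succ, sum_add_distrib]
    omega
  core i hi := by
    have := Finset.mem_Icc.1 (hs i hi)
    omega
  gap i hi := by
    have := ht i hi
    rw [sum_range_succ]
    omega
  large := hM

namespace GoodDecomposition

section Copy

variable {V : Type*} {r : ℕ} {m : ℝ} {D T : Digraph V} (g : GoodDecomposition r m D T)

theorem core_nonempty (hr : 1 ≤ r) (hm : 0 < m) {i : ℕ} (hi : i ≤ r) : (g.core i).Nonempty := by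
  rcases hi.eq_or_lt with rfl | hlt
  · exact ⟨g.y, g.y_mem_core⟩
  · exact ⟨_, g.first_seg_mem_core hr hm hlt⟩

/-- The length of the interval reserved for the `i`-th core: one position for each vertex of a path,
and for each arborescence as many positions as it has vertices and leaves, less one. -/
noncomputable def coreRoom (i : ℕ) : ℤ :=
  (g.core i).ncard + (if i = 0 then (g.inArb.inLeaves.ncard : ℤ) - 1 else 0) +
    if i = r then (g.outArb.outLeaves.ncard : ℤ) - 1 else 0

/-- The number of vertices which go between the `i`-th core and the next one if the links are
distributed over the gaps by `prof`. -/
noncomputable def gapRoom (prof : Fin g.l → ℕ → ℕ) (i : ℕ) : ℤ :=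
  (g.seg (2 * i)).inner.ncard + (g.outPart i).ncard + (g.inPart i).ncard + ∑ e, prof e i

theorem coreRoom_zero (hr : 1 ≤ r) :
    g.coreRoom 0 = g.inArb.order + g.inArb.inLeaves.ncard - 1 := by
  rw [coreRoom, if_pos rfl, if_neg (by omega), g.core_zero, SubDigraph.order]
  ring

theorem coreRoom_last (hr : 1 ≤ r) :
    g.coreRoom r = g.outArb.order + g.outArb.outLeaves.ncard - 1 := by
  rw [coreRoom, if_neg (by omega), if_pos rfl, g.core_last, SubDigraph.order]
  ring

theorem coreRoom_succ {i : ℕ} (hi : i + 1 < r) : g.coreRoom (i + 1) = (g.core (i + 1)).ncard := by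
  rw [coreRoom, if_neg (by omega), if_neg (by omega), add_zero, add_zero]

theorem coreRoom_mem_Icc [Finite V] (hr : 1 ≤ r) (hm : 0 < m) {M : ℕ}
    (hM : ∀ d i, 1 ≤ i → i ≤ r + 1 → (g.F d i).order ≤ M) {i : ℕ} (hi : i ≤ r) :
    g.coreRoom i ∈ Icc 1 (2 * (M : ℤ)) := by
  have hpos : 0 < (g.core i).ncard := (Set.ncard_pos).2 (g.core_nonempty hr hm hi)
  have hle : (g.core i).ncard ≤ M :=
    (Set.ncard_le_ncard (g.S_sub_F .plus (i + 1) (by omega) (by omega))).trans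
      (hM .plus (i + 1) (by omega) (by omega))
  have hin : g.inArb.inLeaves.ncard ≤ g.inArb.order := Set.ncard_le_ncard fun v hv => hv.1
  have hout : g.outArb.outLeaves.ncard ≤ g.outArb.order := Set.ncard_le_ncard fun v hv => hv.1
  have := g.two_le_inArb
  have := g.two_le_outArb
  rw [Finset.mem_Icc]
  rcases Nat.eq_zero_or_pos i with rfl | hi0
  · rw [g.core_zero, ← SubDigraph.order] at hle
    rw [g.coreRoom_zero hr]
    omega
  rcases hi.eq_or_lt with rfl | hir
  · rw [g.core_last, ← SubDigraph.order] at hle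
    rw [g.coreRoom_last hr]
    omega
  · obtain ⟨i, rfl⟩ := Nat.exists_eq_add_one.2 hi0
    rw [g.coreRoom_succ hir]
    omega

theorem length_le_gapRoom (prof : Fin g.l → ℕ → ℕ) {i : ℕ} (hpos : 0 < (g.seg (2 * i)).length) :
    ((g.seg (2 * i)).length : ℤ) - 1 ≤ g.gapRoom prof i := by
  have := (g.seg (2 * i)).ncard_inner hpos
  rw [gapRoom]
  omega

theorem sum_coreRoom_add_sum_gapRoom [Fintype V] (hr : 1 ≤ r) (hm : 0 < m)
    {prof : Fin g.l → ℕ → ℕ} (hprof : ∀ e, g.IsProfile e (prof e)) :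
    ∑ i ∈ range (r + 1), g.coreRoom i + ∑ i ∈ range r, g.gapRoom prof i =
      Fintype.card V + g.inArb.inLeaves.ncard + g.outArb.outLeaves.ncard - 2 := by
  have hcore : ∑ i ∈ range (r + 1), g.coreRoom i =
      ∑ i ∈ range (r + 1), ((g.core i).ncard : ℤ) + (g.inArb.inLeaves.ncard - 1) +
        (g.outArb.outLeaves.ncard - 1) := by
    simp only [coreRoom, sum_add_distrib, sum_ite_eq', mem_range]
    rw [if_pos (by omega), if_pos (by omega)]
  have hlinks : ∑ i ∈ range r, ∑ e, prof e i = ∑ e, (g.Q e).inner.ncard := by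
    rw [sum_comm]
    exact sum_congr rfl fun e _ => (hprof e).sum_eq_ncard_inner
  have hgap : ∑ i ∈ range r, g.gapRoom prof i =
      ∑ i ∈ range r, (((g.seg (2 * i)).inner.ncard : ℤ) + (g.outPart i).ncard +
        (g.inPart i).ncard) + ∑ e, ((g.Q e).inner.ncard : ℤ) := by
    rw [← Nat.cast_sum, ← hlinks, Nat.cast_sum, ← sum_add_distrib]
    rfl
  rw [hcore, hgap, g.card_eq_sum_ncard hr hm]
  push_cast
  ring

theorem exists_fits [Fintype V] (hr : 1 ≤ r) (hm : 0 < m) {M : ℕ} (hM : 100 ≤ M)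
    (hF : ∀ d i, 1 ≤ i → i ≤ r + 1 → (g.F d i).order ≤ M)
    (hP : ∀ i < r, 2000 * M ≤ (g.seg (2 * i)).length) (hrM : 6 * r * r ≤ M) :
    ∃ a b prof, g.Fits 0 (Fintype.card V + g.inArb.inLeaves.ncard + g.outArb.outLeaves.ncard - 3)
      M a b prof := by
  choose prof hprof using g.exists_isProfile
  have harr := isArrangement_of_lengths (M := M) (by omega)
    (fun i hi => g.coreRoom_mem_Icc hr hm hF hi) (t := g.gapRoom prof) fun i hi => by
      have := hP i hi
      have := g.length_le_gapRoom prof (g.length_seg_even_pos hm hi)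
      omega
  rw [g.sum_coreRoom_add_sum_gapRoom hr hm hprof, sub_sub] at harr
  exact ⟨_, _, prof, {
    arrangement := harr
    order_le := hF
    sq_le := hrM
    profile := hprof
    first := by
      rw [g.coreRoom_zero hr]
      ring
    last := by
      rw [g.coreRoom_last hr]
      ring
    mid i hi := by
      rw [g.coreRoom_succ hi]
      ring
    gap i _ := by
      rw [sum_range_succ, gapRoom]
      push_cast
      ring }⟩

theorem length_seg_even_lt_card [Fintype V] (i : ℕ) :
    (g.seg (2 * i)).length < Fintype.card V := by
  have hcard := (g.seg (2 * i)).nodup.length_le_card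
  have hpos := (g.seg (2 * i)).length_support_pos
  rw [DiPath.length]
  omega

include g in
theorem containsCopy [Fintype V] {W : Type*} [Fintype W] {G : Digraph W} (hr : 1 ≤ r)
    (hm : 6 * r * r + 101 ≤ m) (hG : IsTournament G)
    (hW : Fintype.card V + (leaves T).ncard ≤ Fintype.card W + 2) : ContainsCopy G D := by
  have hm0 : 0 < m := lt_of_lt_of_le (by positivity) hm
  have hM : 6 * r * r + 101 ≤ ⌊m⌋₊ := Nat.le_floor (by exact_mod_cast hm)
  have hlen : ∀ i < r, 2000 * ⌊m⌋₊ ≤ (g.seg (2 * i)).length := by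
    intro i hi
    rw [g.seg_even, ← Nat.cast_le (α := ℝ)]
    push_cast
    linarith [g.length_segP (i + 1) (by omega) (by omega), Nat.floor_le hm0.le]
  obtain ⟨a, b, prof, hfits⟩ := g.exists_fits hr hm0 (by omega)
    (fun d i hi hi' => Nat.le_floor (g.order_F d i hi hi')) hlen (by omega)
  have := hlen 0 hr
  have := g.length_seg_even_lt_card 0
  have := g.leaves_le
  have : Nonempty W := Fintype.card_pos_iff.1 (by omega)
  obtain ⟨e, he, hmedian⟩ := exists_isMedianOrder G.Adj fun u v huv =>
    xor_iff_iff_not.1 (hG.2 u v huv)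
  obtain ⟨F, hinj, hmem, hadj⟩ :=
    hfits.exists_embedding (hmedian.mono le_rfl (by omega)) hr hm0
  refine ⟨⟨fun v => e (F v), fun u v huv => hinj (he ?_ ?_ huv)⟩, hadj⟩ <;>
    exact Set.Icc_subset_Icc_right (by omega) (Finset.mem_Icc.1 (hmem _))

end Copy

end GoodDecomposition

end TreesInTournaments

theorem lemma4p4_general (μ : ℝ) (hμ : 0 < μ) (r : ℕ) (hr : 1 ≤ r) :
    ∃ n₀ : ℕ, ∀ n : ℕ, n₀ ≤ n → ∀ m : ℝ, μ * n ≤ m →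
      ∀ (V : Type*) [Fintype V] (W : Type*) [Fintype W] (D T : Digraph V) (G : Digraph W),
        Fintype.card V = n → TreesInTournaments.GoodDecomposition r m D T →
        n + (TreesInTournaments.leaves T).ncard ≤ Fintype.card W + 2 →
        TreesInTournaments.IsTournament G → TreesInTournaments.ContainsCopy G D := by
  refine ⟨⌈(6 * r * r + 101) / μ⌉₊, fun n hn m hm V _ W _ D T G hV g hW hG => ?_⟩
  have hμn : 6 * r * r + 101 ≤ μ * n := (div_le_iff₀' hμ).1 (Nat.ceil_le.1 hn)
  exact g.containsCopy hr (hμn.trans hm) hG (hV ▸ hW)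

theorem lemma4p4 (μ : ℝ) (hμ : 0 < μ) (r k : ℕ) (hr : 1 ≤ r) (hk : 1 ≤ k) :
    ∃ n₀ : ℕ, ∀ n : ℕ, n₀ ≤ n → ∀ m : ℝ, μ * n ≤ m →
      ∀ (V : Type*) [Fintype V] (W : Type*) [Fintype W] (T : Digraph V) (G : Digraph W),
        Fintype.card V = n → TreesInTournaments.IsOrientedTree T →
        (TreesInTournaments.leaves T).ncard = k →
        TreesInTournaments.HasGoodDecomposition r m T →
        Fintype.card W = n + k - 2 → TreesInTournaments.IsTournament G →
        TreesInTournaments.ContainsCopy G T := by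
  obtain ⟨n₀, h⟩ := lemma4p4_general μ hμ r hr
  refine ⟨n₀, fun n hn m hm V _ W _ T G hV _ hleaves ⟨D, ⟨g⟩⟩ hW hG => ?_⟩
  obtain ⟨f, hf⟩ := h n hn m hm V W D T G hV g (by omega) hG
  exact ⟨f, fun u v huv => hf u v (g.T_sub.2 u v huv)⟩
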